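/- Let $0<\varphi<\pi$ and $\ell,h>0$. The SCD (Schmitt--Conway--Danzer) prototile is the bi-prism with rhombic basis obtained as follows: take a horizontal rhombus with vertices $0,a,b,a+b$, where $|a|=|b|=\ell$ and $b$ arises from $a$ by the rotation through $\varphi$ in the horizontal plane; with $e_3$ the vertical unit vector, let $c=\tfrac12 b+he_3$ and $d=\tfrac12 a-he_3$; the tile is the union of the triangular prisms $\mathrm{conv}\{0,a,b,a+b,c,a+c\}$ and $\mathrm{conv}\{0,a,b,a+b,d,b+d\}$, so that the angle between its upper and its lower roof ridge is $\varphi$. It is called incommensurate if $\varphi\notin\pi\mathbb{Q}$. An SCD tiling is a tiling of $\mathbb{R}^3$ (the tiles cover $\mathbb{R}^3$ and have pairwise disjoint interiors) by images of the prototile under orientation-preserving isometries (Euclidean motions), joined face to face at the triangular facets, that is, each of the four triangular facets of a tile is also a triangular facet of another tile. It is repetitive if, for every ball, the positions at which a congruent copy (under Euclidean motions) of the patch of tiles meeting this ball occurs in the tiling are relatively dense in $\mathbb{R}^3$. A point set $\varLambda$ represents the MLD class of the tiling if each of the two is locally derivable from the other, i.e. there is a compact neighbourhood $K$ of $0$ such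 that, whenever the $K$-patches of the one at two positions $x$ and $y$ coincide up to the translation by $y-x$, the other looks the same at $x$ and at $y$. Proposition. Consider a repetitive, incommensurate SCD tiling, and let $\varLambda\subset\mathbb{R}^3$ be a Delone representative of its MLD class. Then $\varLambda$ is topologically aperiodic: every element $\varLambda'$ of its hull $\mathbb{X}(\varLambda)$, the closure of the set of translates $\{t+\varLambda\mid t\in\mathbb{R}^3\}$ in the local topology, is non-periodic, that is, $t+\varLambda'=\varLambda'$ holds only for $t=0$. More generally, every Delone set that is a limit, in the local rubber topology, of congruent copies of $\varLambda$ (images under Euclidean motions) is non-periodic. Here, $\varLambda'$ is $\varepsilon$-close to $\varLambda$ in the local topology if $\varLambda'$ and $t+\varLambda$ agree in the open ball $B_{1/\varepsilon}(0)$ for some $t\in B_\varepsilon(0)$, and $\varLambda,\varLambda'$ are $\varepsilon$-close in the local rubber topology if each point of either of them in $B_{1/\varepsilon}(0)$ has distance at most $\varepsilon$ to some point of the other. -/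

import Mathlib

open Set Metric Topology
open scoped Pointwise

namespace SCD

/-- Euclidean three-space. -/
abbrev E3 : Type := EuclideanSpace ℝ (Fin 3)

/-! ### Point sets, periods -/

/-- The point set `Λ` is a Delone set. -/
def IsDelone (Λ : Set E3) : Prop := ∃ D : Delone.DeloneSet E3, (D : Set E3) = Λ

/-- The set of periods of `Λ`. -/
def periods (Λ : Set E3) : Set E3 := {t | t +ᵥ Λ = Λ}

/-- `Λ` has no non-trivial period. -/
def IsNonperiodic (Λ : Set E3) : Prop := periods Λ = {0}

/-! ### Euclidean motions -/

/-- A Euclidean motion: an orientation-preserving isometry (reflections are not allowed). -/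
def IsMotion (g : E3 ≃ᵃⁱ[ℝ] E3) : Prop :=
  LinearMap.det (g.linearIsometryEquiv.toLinearEquiv : E3 →ₗ[ℝ] E3) = 1

/-! ### Hulls -/

/-- `Λ'` is `ε`-close to `Λ` in the local topology: on the ball of radius `1/ε` around `0`, it
agrees with `Λ` up to a global translation by less than `ε`. -/
def LocalClose (ε : ℝ) (Λ Λ' : Set E3) : Prop :=
  ∃ t ∈ ball (0 : E3) ε, Λ' ∩ ball 0 (1 / ε) = (t +ᵥ Λ) ∩ ball 0 (1 / ε)

/-- The (translational, continuous) hull: the closure of the set of translates of `Λ` in the local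
topology. -/
def hull (Λ : Set E3) : Set (Set E3) :=
  {Λ' | ∀ ε > 0, ∃ x : E3, LocalClose ε (x +ᵥ Λ) Λ'}

/-- `Λ` is topologically aperiodic: all elements of its hull are non-periodic. -/
def TopologicallyAperiodic (Λ : Set E3) : Prop := ∀ Λ' ∈ hull Λ, IsNonperiodic Λ'

/-- `Λ` and `Λ'` are `ε`-close in the local rubber topology: on the ball of radius `1/ε` around
`0`, they agree up to moving each point individually by at most `ε`. -/
def RubberClose (ε : ℝ) (Λ Λ' : Set E3) : Prop :=
  (∀ p ∈ Λ ∩ ball 0 (1 / ε), ∃ q ∈ Λ', dist p q ≤ ε) ∧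
  (∀ q ∈ Λ' ∩ ball 0 (1 / ε), ∃ p ∈ Λ, dist p q ≤ ε)

/-- The Euclidean hull: all Delone sets that are limits, in the local rubber topology, of
congruent copies of `Λ` (images under Euclidean motions). -/
def euclideanHull (Λ : Set E3) : Set (Set E3) :=
  {Λ' | IsDelone Λ' ∧
    ∀ ε > 0, ∃ g : E3 ≃ᵃⁱ[ℝ] E3, IsMotion g ∧ RubberClose ε (g '' Λ) Λ'}

/-! ### The SCD prototile

The rhombic basis has the vertices `0, a, b, a + b` in the plane `z = 0`, where `a`, `b` have length
`ℓ` and enclose the angle `φ`. Above it stands a gable roof of height `h` with ridge parallel to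
`a`, below it hangs a gable roof of depth `h` with ridge parallel to `b`. -/

section Tile

variable (ℓ φ h : ℝ)

/-- First side of the rhombic basis. -/
noncomputable def sideA : E3 := !₂[ℓ, 0, 0]

/-- Second side of the rhombic basis. -/
noncomputable def sideB : E3 := !₂[ℓ * Real.cos φ, ℓ * Real.sin φ, 0]

/-- Starting point of the upper ridge, at height `h` above the midpoint of the side `[0, b]`. -/
noncomputable def topApex : E3 := (1 / 2 : ℝ) • sideB ℓ φ + !₂[0, 0, h]

/-- Starting point of the lower ridge, at depth `h` below the midpoint of the side `[0, a]`. -/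
noncomputable def bottomApex : E3 := (1 / 2 : ℝ) • sideA ℓ - !₂[0, 0, h]

/-- The triangular prism on top of the rhombus; its ridge is parallel to `a`. -/
noncomputable def upperPrism : Set E3 :=
  convexHull ℝ {0, sideA ℓ, sideB ℓ φ, sideA ℓ + sideB ℓ φ,
    topApex ℓ φ h, sideA ℓ + topApex ℓ φ h}

/-- The triangular prism below the rhombus; its ridge is parallel to `b`. -/
noncomputable def lowerPrism : Set E3 :=
  convexHull ℝ {0, sideA ℓ, sideB ℓ φ, sideA ℓ + sideB ℓ φ,
    bottomApex ℓ h, sideB ℓ φ + bottomApex ℓ h}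

/-- The SCD prototile: a bi-prism with rhombic basis, whose two ridges enclose the angle `φ`. -/
noncomputable def prototile : Set E3 := upperPrism ℓ φ h ∪ lowerPrism ℓ φ h

/-- The four triangular facets of the SCD prototile. -/
noncomputable def triangularFacets : Set (Set E3) :=
  {convexHull ℝ {0, sideB ℓ φ, topApex ℓ φ h},
   convexHull ℝ {sideA ℓ, sideA ℓ + sideB ℓ φ, sideA ℓ + topApex ℓ φ h},
   convexHull ℝ {0, sideA ℓ, bottomApex ℓ h},
   convexHull ℝ {sideB ℓ φ, sideB ℓ φ + sideA ℓ, sideB ℓ φ + bottomApex ℓ h}}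

/-- An SCD tiling: a space-filling tiling by congruent copies of the prototile (the reflected tile
is not used) that are joined face to face at the triangular facets. -/
structure IsSCDTiling (T : Set (Set E3)) : Prop where
  /-- Every tile is the image of the prototile under a Euclidean motion. -/
  congruent : ∀ s ∈ T, ∃ g : E3 ≃ᵃⁱ[ℝ] E3, IsMotion g ∧ s = g '' prototile ℓ φ h
  /-- The tiles cover space. -/
  covers : ⋃₀ T = univ
  /-- Distinct tiles have disjoint interiors. -/
  packs : T.PairwiseDisjoint interior
  /-- Every triangular facet of a tile is also a triangular facet of another tile. -/
  faceToFace : ∀ g : E3 ≃ᵃⁱ[ℝ] E3, IsMotion g → g '' prototile ℓ φ h ∈ T →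
    ∀ F ∈ triangularFacets ℓ φ h,
      ∃ g' : E3 ≃ᵃⁱ[ℝ] E3, IsMotion g' ∧ g' '' prototile ℓ φ h ∈ T ∧
        g' '' prototile ℓ φ h ≠ g '' prototile ℓ φ h ∧
        ∃ F' ∈ triangularFacets ℓ φ h, g' '' F' = g '' F

end Tile

/-- The prototile with angle `φ` between its ridges is incommensurate: `φ ∉ πℚ`. -/
def IsIncommensurate (φ : ℝ) : Prop := ∀ q : ℚ, φ ≠ Real.pi * q

/-! ### Repetitivity and mutual local derivability -/

/-- The patch of all tiles of `T` that meet `K`. -/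
def tilesMeeting (T : Set (Set E3)) (K : Set E3) : Set (Set E3) := {s ∈ T | (s ∩ K).Nonempty}

/-- Repetitivity with respect to Euclidean motions: the places where a congruent copy of a given
(ball) patch of `T` occurs in `T` are relatively dense. -/
def IsRepetitive (T : Set (Set E3)) : Prop :=
  ∀ (x : E3) (ρ : ℝ), ∃ R : ℝ, ∀ y : E3, ∃ g : E3 ≃ᵃⁱ[ℝ] E3, IsMotion g ∧ dist (g x) y ≤ R ∧
    tilesMeeting T (closedBall (g x) ρ) = (fun s => g '' s) '' tilesMeeting T (closedBall x ρ)

/-- The `K`-patch of the tiling `T` at the position `x`, moved to the origin. -/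
def tilePatch (T : Set (Set E3)) (K : Set E3) (x : E3) : Set (Set E3) :=
  (fun s : Set E3 => -x +ᵥ s) '' tilesMeeting T (x +ᵥ K)

/-- The `K`-patch of the point set `Λ` at the position `x`, moved to the origin. -/
def pointPatch (Λ : Set E3) (K : Set E3) (x : E3) : Set E3 := (-x +ᵥ Λ) ∩ K

/-- The point set `Λ` is locally derivable from the tiling `T`. -/
def PointsDerivableFromTiling (Λ : Set E3) (T : Set (Set E3)) : Prop :=
  ∃ K : Set E3, IsCompact K ∧ K ∈ 𝓝 (0 : E3) ∧
    ∀ x y : E3, tilePatch T K x = tilePatch T K y → pointPatch Λ {0} x = pointPatch Λ {0} y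

/-- The tiling `T` is locally derivable from the point set `Λ`. -/
def TilingDerivableFromPoints (T : Set (Set E3)) (Λ : Set E3) : Prop :=
  ∃ K : Set E3, IsCompact K ∧ K ∈ 𝓝 (0 : E3) ∧
    ∀ x y : E3, pointPatch Λ K x = pointPatch Λ K y → tilePatch T {0} x = tilePatch T {0} y

/-- `Λ` and `T` are mutually locally derivable, so that `Λ` represents the MLD class of `T`. -/
def MLD (Λ : Set E3) (T : Set (Set E3)) : Prop :=
  PointsDerivableFromTiling Λ T ∧ TilingDerivableFromPoints T Λ

end SCD

namespace SCD

open scoped RealInnerProductSpace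

/-! The tiling is forced to be a stack of lattice-periodic layers, each rotated against the one
below it by the same angle. Two things have to be shown: that this rigidity holds, and that it
leaves no room for a period in any limit.

Rigidity. The neighbour across an upright triangular facet is the image of the tile under a motion
that preserves the facet and reverses its normal. If the triangle is not equilateral, this is the
half-turn about its altitude, so the neighbour is a translate of the tile. An equilateral triangle
admits two further half-turns, which are excluded by dihedral angles: around a generic point of a
suitable edge the angle left over would have to be a multiple of the ridge angle `2 * hr`, which is
incompatible with `two_hr_lt_sml` and `sml_lt`. Hence every tile lies in a layer of lattice
translates (`translate_mem`, `lattice_mem`). Two layers never overlap, so they are parallel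
(`upright_of_separate`), and the ridges of the next layer have to fit into the valleys of the
present one. This fixes the rotation (by `-ang`, sending `b` to `a`) and the height `ht` of the
step, and leaves only a slide along the ridge (`exists_step`). The tiling becomes a tower whose
layers have the linear parts `lin (G 0) * lin S.rot ^ n`.

Common vectors. By the pigeonhole principle, repetitivity yields two occurrences of a patch that
differ by a translation. This translation matches up all layers of the patch, so any number of
consecutive rotated lattices share a nonzero vector (`exists_coincidence`). A point set locally
derived from the tiling sees boundedly many layers at a time and is therefore invariant, slab by
slab, under rotated coincidence vectors (`add_lin_mem`). In the form `IsLayered` this property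
survives motions and limits in the rubber topology (`exists_isLayered_of_tendsto`).

Periods (`IsLayered.eq_zero_of_period`). A period that is not horizontal carries coincidence vectors
of infinitely many layers to one and the same point. These are infinitely many rotated images of one
vector, all of the same length, and they violate uniform discreteness. A horizontal period, seen in
the frame of any occurring layer, has a multiple of bounded order in the coincidence lattice;
rotating back gives infinitely many different vectors in a finite set. Both contradictions rest on
the infinite order of the rotation, that is, on incommensurability. -/

/-- The parameters of a non-degenerate SCD prototile. -/
structure Shape where
  /-- length of the sides of the rhombus -/
  len : ℝ
  /-- angle of the rhombus -/
  ang : ℝ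
  /-- height of the roofs -/
  ht : ℝ
  len_pos : 0 < len
  ht_pos : 0 < ht
  sin_pos : 0 < Real.sin ang

/-! ### Affine coordinates adapted to the rhombus -/

/-- The inner product of Euclidean three-space in coordinates. -/
lemma inner_eq_sum (x y : E3) : ⟪x, y⟫ = x 0 * y 0 + x 1 * y 1 + x 2 * y 2 := by
  simp [PiLp.inner_apply, Fin.sum_univ_three]
  ring

namespace Shape

variable (S : Shape)

/-- cosine of the angle of the rhombus -/
noncomputable def c : ℝ := Real.cos S.ang

lemma sin_sq : Real.sin S.ang ^ 2 = 1 - S.c ^ 2 := by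
  have := Real.sin_sq_add_cos_sq S.ang
  unfold c; linarith

lemma c_sq_lt : S.c ^ 2 < 1 := by
  have := S.sin_sq
  have := pow_pos S.sin_pos 2
  linarith

lemma c_lt : S.c < 1 := by nlinarith [S.c_sq_lt]

lemma neg_c_lt : -1 < S.c := by nlinarith [S.c_sq_lt]

/-- The first side of the rhombus. -/
noncomputable def a : E3 := sideA S.len

/-- The second side of the rhombus. -/
noncomputable def b : E3 := sideB S.len S.ang

/-- The vertical vector whose length is twice the height of a roof. -/
noncomputable def e : E3 := !₂[0, 0, 2 * S.ht]

/-- Gradient of the first coordinate. -/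
noncomputable def nS : E3 := !₂[1 / S.len, -(Real.cos S.ang) / (S.len * Real.sin S.ang), 0]

/-- Gradient of the second coordinate. -/
noncomputable def nT : E3 := !₂[0, 1 / (S.len * Real.sin S.ang), 0]

/-- Gradient of the third coordinate. -/
noncomputable def nZ : E3 := !₂[0, 0, 1 / (2 * S.ht)]

/-- Coordinate along `a`. -/
noncomputable def cs : E3 →L[ℝ] ℝ := innerSL ℝ S.nS

/-- Coordinate along `b`. -/
noncomputable def ct : E3 →L[ℝ] ℝ := innerSL ℝ S.nT

/-- Coordinate along `e`. -/
noncomputable def cz : E3 →L[ℝ] ℝ := innerSL ℝ S.nZ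

/-- The point with given coordinates. -/
noncomputable def pt (s t z : ℝ) : E3 := s • S.a + t • S.b + z • S.e

lemma cs_apply (x : E3) :
    S.cs x = x 0 / S.len - x 1 * Real.cos S.ang / (S.len * Real.sin S.ang) := by
  rw [cs, innerSL_apply_apply, inner_eq_sum]
  simp [nS]
  ring

lemma ct_apply (x : E3) : S.ct x = x 1 / (S.len * Real.sin S.ang) := by
  rw [ct, innerSL_apply_apply, inner_eq_sum]
  simp [nT]
  ring

lemma cz_apply (x : E3) : S.cz x = x 2 / (2 * S.ht) := by
  rw [cz, innerSL_apply_apply, inner_eq_sum]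
  simp [nZ]
  ring

@[simp] lemma cs_a : S.cs S.a = 1 := by
  have := S.len_pos.ne'
  simp [cs_apply, a, sideA, this]

@[simp] lemma ct_a : S.ct S.a = 0 := by simp [ct_apply, a, sideA]

@[simp] lemma cz_a : S.cz S.a = 0 := by simp [cz_apply, a, sideA]

@[simp] lemma cs_b : S.cs S.b = 0 := by
  have := S.len_pos.ne'
  have := S.sin_pos.ne'
  simp only [cs_apply, b, sideB]
  simp
  field_simp
  ring

@[simp] lemma ct_b : S.ct S.b = 1 := by
  have := S.len_pos.ne'
  have := S.sin_pos.ne'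
  simp only [ct_apply, b, sideB]
  simp [*]

@[simp] lemma cz_b : S.cz S.b = 0 := by simp [cz_apply, b, sideB]

@[simp] lemma cs_e : S.cs S.e = 0 := by simp [cs_apply, e]

@[simp] lemma ct_e : S.ct S.e = 0 := by simp [ct_apply, e]

@[simp] lemma cz_e : S.cz S.e = 1 := by
  have := S.ht_pos.ne'
  simp [cz_apply, e, this]

@[simp] lemma cs_pt (s t z : ℝ) : S.cs (S.pt s t z) = s := by simp [pt]

@[simp] lemma ct_pt (s t z : ℝ) : S.ct (S.pt s t z) = t := by simp [pt]

@[simp] lemma cz_pt (s t z : ℝ) : S.cz (S.pt s t z) = z := by simp [pt]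

lemma pt_coord (x : E3) : S.pt (S.cs x) (S.ct x) (S.cz x) = x := by
  have h1 := S.len_pos.ne'
  have h2 := S.sin_pos.ne'
  have h3 := S.ht_pos.ne'
  ext i
  fin_cases i <;>
    simp [pt, cs_apply, ct_apply, cz_apply, a, b, e, sideA, sideB] <;> field_simp
  ring

lemma ext_coord {x y : E3} (h1 : S.cs x = S.cs y) (h2 : S.ct x = S.ct y) (h3 : S.cz x = S.cz y) :
    x = y := by
  rw [← S.pt_coord x, ← S.pt_coord y, h1, h2, h3]

lemma pt_add (s t z s' t' z' : ℝ) :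
    S.pt s t z + S.pt s' t' z' = S.pt (s + s') (t + t') (z + z') := by
  apply S.ext_coord <;> simp

lemma pt_sub (s t z s' t' z' : ℝ) :
    S.pt s t z - S.pt s' t' z' = S.pt (s - s') (t - t') (z - z') := by
  apply S.ext_coord <;> simp

lemma smul_pt (r s t z : ℝ) : r • S.pt s t z = S.pt (r * s) (r * t) (r * z) := by
  apply S.ext_coord <;> simp

lemma pt_a : S.pt 1 0 0 = S.a := by simp [pt]
lemma pt_b : S.pt 0 1 0 = S.b := by simp [pt]
lemma pt_e : S.pt 0 0 1 = S.e := by simp [pt]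
lemma pt_zero : S.pt 0 0 0 = 0 := by simp [pt]

@[simp] lemma inner_aa : ⟪S.a, S.a⟫ = S.len ^ 2 := by
  rw [inner_eq_sum]; simp [a, sideA]; ring

@[simp] lemma inner_bb : ⟪S.b, S.b⟫ = S.len ^ 2 := by
  have := Real.sin_sq_add_cos_sq S.ang
  rw [inner_eq_sum]; simp [b, sideB]
  linear_combination S.len ^ 2 * this

@[simp] lemma inner_ab : ⟪S.a, S.b⟫ = S.len ^ 2 * S.c := by
  rw [inner_eq_sum]; simp [a, b, c, sideA, sideB]; ring

@[simp] lemma inner_ba : ⟪S.b, S.a⟫ = S.len ^ 2 * S.c := by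
  rw [real_inner_comm, inner_ab]

@[simp] lemma inner_ae : ⟪S.a, S.e⟫ = 0 := by
  rw [inner_eq_sum]; simp [a, e, sideA]

@[simp] lemma inner_be : ⟪S.b, S.e⟫ = 0 := by
  rw [inner_eq_sum]; simp [b, e, sideB]

@[simp] lemma inner_ea : ⟪S.e, S.a⟫ = 0 := by rw [real_inner_comm, inner_ae]

@[simp] lemma inner_eb : ⟪S.e, S.b⟫ = 0 := by rw [real_inner_comm, inner_be]

@[simp] lemma inner_ee : ⟪S.e, S.e⟫ = 4 * S.ht ^ 2 := by
  rw [inner_eq_sum]; simp [e]; ring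

lemma inner_pt (s t z s' t' z' : ℝ) : ⟪S.pt s t z, S.pt s' t' z'⟫ =
    S.len ^ 2 * (s * s' + t * t' + S.c * (s * t' + t * s')) + 4 * S.ht ^ 2 * (z * z') := by
  simp only [pt, inner_add_left, inner_add_right, inner_smul_left, inner_smul_right, inner_aa,
    inner_bb, inner_ab, inner_ba, inner_ae, inner_be, inner_ea, inner_eb, inner_ee,
    RCLike.conj_to_real]
  ring

lemma norm_sq_pt (s t z : ℝ) : ‖S.pt s t z‖ ^ 2 =
    S.len ^ 2 * (s ^ 2 + t ^ 2 + 2 * S.c * (s * t)) + 4 * S.ht ^ 2 * z ^ 2 := by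
  rw [← real_inner_self_eq_norm_sq, inner_pt]; ring

/-! ### The prototile in coordinates -/

/-- The outward functionals of the eight facets of the prototile. -/
noncomputable def facet : Fin 8 → E3 →L[ℝ] ℝ :=
  ![-S.cs, S.cs, -S.ct, S.ct, S.cz - S.ct, S.cz + S.ct, -S.cz - S.cs, -S.cz + S.cs]

/-- The values of the functionals on the facets. -/
def bound : Fin 8 → ℝ := ![0, 1, 0, 1, 0, 1, 0, 1]

/-- The prototile. -/
noncomputable def tile : Set E3 := prototile S.len S.ang S.ht

lemma forall_facet {p : Fin 8 → ℝ → ℝ → Prop} {x : E3} :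
    (∀ i, p i (S.facet i x) (bound i)) ↔
      p 0 (-S.cs x) 0 ∧ p 1 (S.cs x) 1 ∧ p 2 (-S.ct x) 0 ∧ p 3 (S.ct x) 1 ∧
      p 4 (S.cz x - S.ct x) 0 ∧ p 5 (S.cz x + S.ct x) 1 ∧ p 6 (-S.cz x - S.cs x) 0 ∧
      p 7 (-S.cz x + S.cs x) 1 := by
  constructor
  · intro h
    exact ⟨h 0, h 1, h 2, h 3, h 4, h 5, h 6, h 7⟩
  · rintro ⟨h0, h1, h2, h3, h4, h5, h6, h7⟩ i
    fin_cases i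
    · exact h0
    · exact h1
    · exact h2
    · exact h3
    · exact h4
    · exact h5
    · exact h6
    · exact h7

lemma convex_facets : Convex ℝ {x : E3 | ∀ i, S.facet i x ≤ bound i} := by
  rw [ofPred_forall]
  exact convex_iInter fun i => convex_halfSpace_le (S.facet i).isLinear _

lemma topApex_eq : topApex S.len S.ang S.ht = S.pt 0 (1 / 2) (1 / 2) := by
  simp only [topApex, pt, zero_smul, zero_add]
  congr 1
  ext i; fin_cases i <;> simp [e]

lemma bottomApex_eq : bottomApex S.len S.ht = S.pt (1 / 2) 0 (-(1 / 2)) := by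
  have : (!₂[0, 0, S.ht] : E3) = (1 / 2 : ℝ) • S.e := by
    ext i; fin_cases i <;> simp [e]
  simp only [bottomApex, pt, zero_smul, add_zero, this, neg_smul, ← sub_eq_add_neg]
  rfl

/-- The vertices of the triangle standing on the side `b` of the rhombus. -/
lemma triangle_combo {C : Set E3} (hC : Convex ℝ C) {x y z : E3} (hx : x ∈ C) (hy : y ∈ C)
    (hz : z ∈ C) {p q r : ℝ} (hp : 0 ≤ p) (hq : 0 ≤ q) (hr : 0 ≤ r) (h : p + q + r = 1) :
    p • x + q • y + r • z ∈ C := by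
  have := hC.sum_mem (t := Finset.univ) (w := ![p, q, r]) (z := ![x, y, z])
    (by intro i _; fin_cases i <;> simpa) (by simp [Fin.sum_univ_three, h])
    (by intro i _; fin_cases i <;> simpa)
  simpa [Fin.sum_univ_three] using this

lemma upperPrism_eq : upperPrism S.len S.ang S.ht =
    {x | 0 ≤ S.cs x ∧ S.cs x ≤ 1 ∧ 0 ≤ S.cz x ∧ S.cz x ≤ S.ct x ∧ S.cz x ≤ 1 - S.ct x} := by
  have ha : sideA S.len = S.pt 1 0 0 := S.pt_a.symm
  have hb : sideB S.len S.ang = S.pt 0 1 0 := S.pt_b.symm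
  unfold upperPrism
  rw [ha, hb, topApex_eq, pt_add, pt_add]
  apply Subset.antisymm
  · apply convexHull_min
    · rintro x (rfl | rfl | rfl | rfl | rfl | rfl) <;> simp <;> norm_num
    · have h1 := convex_halfSpace_ge (𝕜 := ℝ) S.cs.isLinear 0
      have h2 := convex_halfSpace_le (𝕜 := ℝ) S.cs.isLinear 1
      have h3 := convex_halfSpace_ge (𝕜 := ℝ) S.cz.isLinear 0
      have h4 := convex_halfSpace_le (𝕜 := ℝ) (S.cz - S.ct).isLinear 0
      have h5 := convex_halfSpace_le (𝕜 := ℝ) (S.cz + S.ct).isLinear 1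
      convert h1.inter (h2.inter (h3.inter (h4.inter h5))) using 1
      ext x
      simp [le_sub_iff_add_le]
  · rintro x ⟨h1, h2, h3, h4, h5⟩
    set V : Set E3 := {0, S.pt 1 0 0, S.pt 0 1 0, S.pt (1 + 0) (0 + 1) (0 + 0),
      S.pt 0 (1 / 2) (1 / 2), S.pt (1 + 0) (0 + 1 / 2) (0 + 1 / 2)} with hV
    have hC := convex_convexHull ℝ V
    have m : ∀ v ∈ V, v ∈ convexHull ℝ V := fun v hv => subset_convexHull ℝ V hv
    -- Inside the triangles at `s = 0` and `s = 1` the weights are the barycentric coordinates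
    -- belonging to `(t, z)`; the point itself divides the segment between these two points in the
    -- ratio given by `s`.
    have k1 := triangle_combo hC (m 0 (by simp [V]))
      (m (S.pt 0 1 0) (by simp [V]))
      (m (S.pt 0 (1 / 2) (1 / 2)) (by simp [V]))
      (p := 1 - S.ct x - S.cz x) (q := S.ct x - S.cz x) (r := 2 * S.cz x)
      (by linarith) (by linarith) (by linarith) (by ring)
    have k2 := triangle_combo hC (m (S.pt 1 0 0) (by simp [V]))
      (m (S.pt (1 + 0) (0 + 1) (0 + 0)) (by simp [V]))
      (m (S.pt (1 + 0) (0 + 1 / 2) (0 + 1 / 2)) (by simp [V]))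
      (p := 1 - S.ct x - S.cz x) (q := S.ct x - S.cz x) (r := 2 * S.cz x)
      (by linarith) (by linarith) (by linarith) (by ring)
    have k3 := hC k1 k2 (a := 1 - S.cs x) (b := S.cs x) (by linarith) (by linarith) (by ring)
    convert k3
    apply S.ext_coord <;> simp <;> ring

lemma lowerPrism_eq : lowerPrism S.len S.ang S.ht =
    {x | 0 ≤ S.ct x ∧ S.ct x ≤ 1 ∧ S.cz x ≤ 0 ∧ -S.cz x ≤ S.cs x ∧ -S.cz x ≤ 1 - S.cs x} := by
  have ha : sideA S.len = S.pt 1 0 0 := S.pt_a.symm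
  have hb : sideB S.len S.ang = S.pt 0 1 0 := S.pt_b.symm
  unfold lowerPrism
  rw [ha, hb, bottomApex_eq, pt_add, pt_add]
  apply Subset.antisymm
  · apply convexHull_min
    · rintro x (rfl | rfl | rfl | rfl | rfl | rfl) <;> simp <;> norm_num
    · have h1 := convex_halfSpace_ge (𝕜 := ℝ) S.ct.isLinear 0
      have h2 := convex_halfSpace_le (𝕜 := ℝ) S.ct.isLinear 1
      have h3 := convex_halfSpace_le (𝕜 := ℝ) S.cz.isLinear 0
      have h4 := convex_halfSpace_ge (𝕜 := ℝ) (S.cz + S.cs).isLinear 0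
      have h5 := convex_halfSpace_le (𝕜 := ℝ) (-S.cz + S.cs).isLinear 1
      convert h1.inter (h2.inter (h3.inter (h4.inter h5))) using 1
      ext x
      simp [le_sub_iff_add_le, neg_le_iff_add_nonneg']
  · rintro x ⟨h1, h2, h3, h4, h5⟩
    set V : Set E3 := {0, S.pt 1 0 0, S.pt 0 1 0, S.pt (1 + 0) (0 + 1) (0 + 0),
      S.pt (1 / 2) 0 (-(1 / 2)), S.pt (0 + 1 / 2) (1 + 0) (0 + -(1 / 2))} with hV
    have hC := convex_convexHull ℝ V
    have m : ∀ v ∈ V, v ∈ convexHull ℝ V := fun v hv => subset_convexHull ℝ V hv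
    have k1 := triangle_combo hC (m 0 (by simp [V]))
      (m (S.pt 1 0 0) (by simp [V]))
      (m (S.pt (1 / 2) 0 (-(1 / 2))) (by simp [V]))
      (p := 1 - S.cs x + S.cz x) (q := S.cs x + S.cz x) (r := -2 * S.cz x)
      (by linarith) (by linarith) (by linarith) (by ring)
    have k2 := triangle_combo hC (m (S.pt 0 1 0) (by simp [V]))
      (m (S.pt (1 + 0) (0 + 1) (0 + 0)) (by simp [V]))
      (m (S.pt (0 + 1 / 2) (1 + 0) (0 + -(1 / 2))) (by simp [V]))
      (p := 1 - S.cs x + S.cz x) (q := S.cs x + S.cz x) (r := -2 * S.cz x)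
      (by linarith) (by linarith) (by linarith) (by ring)
    have k3 := hC k1 k2 (a := 1 - S.ct x) (b := S.ct x) (by linarith) (by linarith) (by ring)
    convert k3
    apply S.ext_coord <;> simp <;> ring

/-- The union of the two prisms is convex: where `z ≥ 0`, the inequalities of the lower roof follow
from `0 ≤ s ≤ 1`, and where `z ≤ 0`, those of the upper roof follow from `0 ≤ t ≤ 1`. So no case
distinction on the sign of `z` is needed in the description by facets. -/
lemma tile_eq : S.tile = {x | ∀ i, S.facet i x ≤ bound i} := by
  unfold tile prototile
  rw [upperPrism_eq, lowerPrism_eq]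
  ext x
  simp only [mem_union, mem_ofPred_eq, S.forall_facet (p := fun _ u v => u ≤ v)]
  constructor
  · rintro (⟨h1, h2, h3, h4, h5⟩ | ⟨h1, h2, h3, h4, h5⟩) <;>
      refine ⟨?_, ?_, ?_, ?_, ?_, ?_, ?_, ?_⟩ <;> linarith
  · rintro ⟨h0, h1, h2, h3, h4, h5, h6, h7⟩
    rcases le_total 0 (S.cz x) with h | h
    · left; refine ⟨?_, ?_, ?_, ?_, ?_⟩ <;> linarith
    · right; refine ⟨?_, ?_, ?_, ?_, ?_⟩ <;> linarith

lemma mem_tile {x : E3} : x ∈ S.tile ↔ (0 ≤ S.cs x ∧ S.cs x ≤ 1) ∧ (0 ≤ S.ct x ∧ S.ct x ≤ 1) ∧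
    (S.cz x ≤ S.ct x ∧ S.cz x ≤ 1 - S.ct x) ∧ (-S.cz x ≤ S.cs x ∧ -S.cz x ≤ 1 - S.cs x) := by
  rw [tile_eq, mem_ofPred_eq, S.forall_facet (p := fun _ u v => u ≤ v)]
  constructor
  · rintro ⟨h0, h1, h2, h3, h4, h5, h6, h7⟩
    refine ⟨⟨?_, ?_⟩, ⟨?_, ?_⟩, ⟨?_, ?_⟩, ?_, ?_⟩ <;> linarith
  · rintro ⟨⟨h0, h1⟩, ⟨h2, h3⟩, ⟨h4, h5⟩, h6, h7⟩
    refine ⟨?_, ?_, ?_, ?_, ?_, ?_, ?_, ?_⟩ <;> linarith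

lemma facet_surjective (i : Fin 8) : Function.Surjective (S.facet i) := by
  intro r
  fin_cases i
  · exact ⟨S.pt (-r) 0 0, by simp [facet]⟩
  · exact ⟨S.pt r 0 0, by simp [facet]⟩
  · exact ⟨S.pt 0 (-r) 0, by simp [facet]⟩
  · exact ⟨S.pt 0 r 0, by simp [facet]⟩
  · exact ⟨S.pt 0 0 r, by simp [facet]⟩
  · exact ⟨S.pt 0 0 r, by simp [facet]⟩
  · exact ⟨S.pt 0 0 (-r), by simp [facet]⟩
  · exact ⟨S.pt 0 0 (-r), by simp [facet]⟩

lemma interior_tile : interior S.tile = {x | ∀ i, S.facet i x < bound i} := by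
  have : S.tile = ⋂ i, (S.facet i) ⁻¹' Iic (bound i) := by
    rw [tile_eq, ofPred_forall]; rfl
  rw [this, interior_iInter_of_finite, ofPred_forall]
  congr 1
  funext i
  rw [ContinuousLinearMap.interior_preimage _ (S.facet_surjective i), interior_Iic]
  rfl

lemma mem_interior_tile {x : E3} : x ∈ interior S.tile ↔
    (0 < S.cs x ∧ S.cs x < 1) ∧ (0 < S.ct x ∧ S.ct x < 1) ∧
    (S.cz x < S.ct x ∧ S.cz x < 1 - S.ct x) ∧ (-S.cz x < S.cs x ∧ -S.cz x < 1 - S.cs x) := by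
  rw [interior_tile, mem_ofPred_eq, S.forall_facet (p := fun _ u v => u < v)]
  constructor
  · rintro ⟨h0, h1, h2, h3, h4, h5, h6, h7⟩
    refine ⟨⟨?_, ?_⟩, ⟨?_, ?_⟩, ⟨?_, ?_⟩, ?_, ?_⟩ <;> linarith
  · rintro ⟨⟨h0, h1⟩, ⟨h2, h3⟩, ⟨h4, h5⟩, h6, h7⟩
    refine ⟨?_, ?_, ?_, ?_, ?_, ?_, ?_, ?_⟩ <;> linarith

lemma convex_tile : Convex ℝ S.tile := by
  rw [tile_eq]; exact S.convex_facets

lemma isCompact_tile : IsCompact S.tile := by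
  unfold tile prototile upperPrism lowerPrism
  exact ((Set.toFinite _).isCompact_convexHull ℝ).union ((Set.toFinite _).isCompact_convexHull ℝ)

lemma center_mem_interior : S.pt (1 / 2) (1 / 2) 0 ∈ interior S.tile := by
  rw [mem_interior_tile]; simp; norm_num

lemma closure_interior_tile : closure (interior S.tile) = S.tile := by
  rw [S.convex_tile.closure_interior_eq_closure_of_nonempty_interior ⟨_, S.center_mem_interior⟩,
    S.isCompact_tile.isClosed.closure_eq]

end Shape

/-! ### Motions -/

/-- The group of Euclidean motions. -/
noncomputable def motions : Subgroup (E3 ≃ᵃⁱ[ℝ] E3) where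
  carrier := {g | IsMotion g}
  mul_mem' {g h} hg hh := by
    have : ((g * h).linearIsometryEquiv.toLinearEquiv : E3 →ₗ[ℝ] E3) =
      (g.linearIsometryEquiv.toLinearEquiv : E3 →ₗ[ℝ] E3) ∘ₗ
        (h.linearIsometryEquiv.toLinearEquiv : E3 →ₗ[ℝ] E3) := rfl
    simp only [mem_ofPred_eq, IsMotion] at *
    rw [this, LinearMap.det_comp, hg, hh, one_mul]
  one_mem' := by
    have : (((1 : E3 ≃ᵃⁱ[ℝ] E3)).linearIsometryEquiv.toLinearEquiv : E3 →ₗ[ℝ] E3) =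
      LinearMap.id := rfl
    simp only [mem_ofPred_eq, IsMotion]
    rw [this, LinearMap.det_id]
  inv_mem' {g} hg := by
    simp only [mem_ofPred_eq, IsMotion] at *
    have h1 : ((g⁻¹).linearIsometryEquiv.toLinearEquiv : E3 →ₗ[ℝ] E3) ∘ₗ
        (g.linearIsometryEquiv.toLinearEquiv : E3 →ₗ[ℝ] E3) = LinearMap.id := by
      ext1 x
      exact g.linearIsometryEquiv.symm_apply_apply x
    have h2 := congrArg LinearMap.det h1
    rwa [LinearMap.det_comp, hg, mul_one, LinearMap.det_id] at h2

lemma mem_motions {g : E3 ≃ᵃⁱ[ℝ] E3} : g ∈ motions ↔ IsMotion g := Iff.rfl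

/-- The linear part of an isometry. -/
noncomputable abbrev lin (g : E3 ≃ᵃⁱ[ℝ] E3) : E3 ≃ₗᵢ[ℝ] E3 := g.linearIsometryEquiv

lemma lin_mul (g h : E3 ≃ᵃⁱ[ℝ] E3) : lin (g * h) = lin g * lin h := rfl

lemma lin_inv (g : E3 ≃ᵃⁱ[ℝ] E3) : lin g⁻¹ = (lin g)⁻¹ := rfl

lemma map_add_lin (g : E3 ≃ᵃⁱ[ℝ] E3) (x v : E3) : g (x + v) = g x + lin g v := by
  have := g.map_vadd x v
  rw [vadd_eq_add, vadd_eq_add] at this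
  rw [add_comm, this, add_comm]

lemma lin_sub (g : E3 ≃ᵃⁱ[ℝ] E3) (x y : E3) : lin g (x - y) = g x - g y :=
  g.map_vsub x y

lemma map_eq_lin (g : E3 ≃ᵃⁱ[ℝ] E3) (x : E3) : g x = lin g x + g 0 := by
  have := map_add_lin g 0 x
  rw [zero_add] at this
  rw [this, add_comm]

/-- The translation by `v`. -/
noncomputable def tr (v : E3) : E3 ≃ᵃⁱ[ℝ] E3 := AffineIsometryEquiv.constVAdd ℝ E3 v

@[simp] lemma tr_apply (v x : E3) : tr v x = v + x := rfl

lemma lin_tr (v : E3) : lin (tr v) = 1 := by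
  ext1 x
  have := map_add_lin (tr v) 0 x
  simpa using this.symm

lemma tr_mem (v : E3) : tr v ∈ motions := by
  have : (lin (tr v)).toLinearEquiv = (LinearEquiv.refl ℝ E3) := by
    rw [lin_tr]; rfl
  rw [mem_motions, IsMotion, this]
  exact LinearMap.det_id

lemma mul_image (g h : E3 ≃ᵃⁱ[ℝ] E3) (s : Set E3) : (g * h) '' s = g '' (h '' s) := by
  rw [AffineIsometryEquiv.coe_mul, image_comp]

lemma inv_image (g : E3 ≃ᵃⁱ[ℝ] E3) (s : Set E3) : (g⁻¹ : E3 ≃ᵃⁱ[ℝ] E3) '' (g '' s) = s := by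
  rw [← mul_image, inv_mul_cancel]; exact image_id s

lemma image_inv (g : E3 ≃ᵃⁱ[ℝ] E3) (s : Set E3) : g '' ((g⁻¹ : E3 ≃ᵃⁱ[ℝ] E3) '' s) = s := by
  rw [← mul_image, mul_inv_cancel]; exact image_id s

lemma inv_apply_apply (g : E3 ≃ᵃⁱ[ℝ] E3) (x : E3) : g⁻¹ (g x) = x := g.symm_apply_apply x

lemma apply_inv_apply (g : E3 ≃ᵃⁱ[ℝ] E3) (x : E3) : g (g⁻¹ x) = x := g.apply_symm_apply x

lemma mem_image_iff (g : E3 ≃ᵃⁱ[ℝ] E3) (s : Set E3) (x : E3) : x ∈ g '' s ↔ g⁻¹ x ∈ s := by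
  constructor
  · rintro ⟨y, hy, rfl⟩; rwa [inv_apply_apply]
  · intro h; exact ⟨_, h, apply_inv_apply g x⟩

lemma interior_image (g : E3 ≃ᵃⁱ[ℝ] E3) (s : Set E3) : interior (g '' s) = g '' interior s :=
  (g.toHomeomorph.image_interior s).symm

lemma closure_image (g : E3 ≃ᵃⁱ[ℝ] E3) (s : Set E3) : closure (g '' s) = g '' closure s :=
  (g.toHomeomorph.image_closure s).symm

lemma fact_finrank : Fact (Module.finrank ℝ E3 = 2 + 1) := ⟨by simp⟩

attribute [local instance] fact_finrank

/-- The half-turn about the axis through `p` with direction `k`. -/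
noncomputable def halfTurn (p k : E3) : E3 ≃ᵃⁱ[ℝ] E3 :=
  tr p * ((ℝ ∙ k).reflection).toAffineIsometryEquiv * tr (-p)

lemma halfTurn_apply (p k x : E3) :
    halfTurn p k x = p + ((2 * (⟪k, x - p⟫ / ‖k‖ ^ 2)) • k - (x - p)) := by
  have h : halfTurn p k x = p + (ℝ ∙ k).reflection (-p + x) := rfl
  rw [h, Submodule.reflection_singleton_apply, neg_add_eq_sub, ← Nat.cast_smul_eq_nsmul ℝ,
    smul_smul]
  rfl

lemma lin_halfTurn (p k : E3) : lin (halfTurn p k) = (ℝ ∙ k).reflection := by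
  ext1 x
  simp only [halfTurn, lin_mul, lin_tr, one_mul, mul_one]
  rfl

/-- The reflection in a line is `-1` on a plane, so its determinant is `(-1) ^ 2`. -/
lemma halfTurn_mem (p : E3) {k : E3} (hk : k ≠ 0) : halfTurn p k ∈ motions := by
  rw [mem_motions, IsMotion, ← lin, lin_halfTurn, Submodule.det_reflection,
    Submodule.finrank_orthogonal_span_singleton (n := 2) hk]
  norm_num

namespace Shape

variable (S : Shape)

lemma len_ne : S.len ≠ 0 := S.len_pos.ne'
lemma ht_ne : S.ht ≠ 0 := S.ht_pos.ne'

lemma e_ne : S.e ≠ 0 := by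
  intro h
  have := S.cz_e
  rw [h] at this; simp at this

lemma a_ne : S.a ≠ 0 := by
  intro h
  have := S.cs_a
  rw [h] at this; simp at this

lemma b_ne : S.b ≠ 0 := by
  intro h
  have := S.ct_b
  rw [h] at this; simp at this

/-- A linear isometry of determinant `1` fixing `b` and `e` is the identity. -/
lemma eq_one_of_fix {A : E3 ≃ₗᵢ[ℝ] E3}
    (hA : LinearMap.det (A.toLinearEquiv : E3 →ₗ[ℝ] E3) = 1)
    (hb : A S.b = S.b) (he : A S.e = S.e) : A = 1 := by
  -- The component of `a` orthogonal to `b` and `e`. Its image is orthogonal to `b` and `e` as well,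
  -- hence `± n`; the minus sign would give a reflection in a plane, of determinant `-1`.
  set n : E3 := S.pt 1 (-S.c) 0 with hn
  have hl := pow_pos S.len_pos 2
  have hh := pow_pos S.ht_pos 2
  have hc := S.c_sq_lt
  have hnn : ⟪n, n⟫ = S.len ^ 2 * (1 - S.c ^ 2) := by rw [hn, inner_pt]; ring
  have hna : S.a = n + S.c • S.b := by
    apply S.ext_coord <;> simp [hn]
  have hnb : ⟪S.b, n⟫ = 0 := by rw [← S.pt_b, hn, inner_pt]; ring
  have hne : ⟪S.e, n⟫ = 0 := by rw [← S.pt_e, hn, inner_pt]; ring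
  have h1 : ⟪S.b, A n⟫ = 0 := by rw [← hb, A.inner_map_map, hnb]
  have h2 : ⟪S.e, A n⟫ = 0 := by rw [← he, A.inner_map_map, hne]
  have h3 : A n = S.cs (A n) • n := by
    rw [← S.pt_coord (A n), ← S.pt_b, inner_pt] at h1
    rw [← S.pt_coord (A n), ← S.pt_e, inner_pt] at h2
    apply S.ext_coord
    · simp [hn]
    · simp only [hn, map_smul, ct_pt, smul_eq_mul] at h1 ⊢
      have : S.len ^ 2 * (S.ct (A n) + S.c * S.cs (A n)) = 0 := by linarith
      rcases mul_eq_zero.mp this with h | h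
      · exact absurd h hl.ne'
      · linarith
    · simp only [hn, map_smul, cz_pt, smul_eq_mul] at h2 ⊢
      have : 4 * S.ht ^ 2 * S.cz (A n) = 0 := by linarith
      rcases mul_eq_zero.mp this with h | h
      · linarith
      · linarith
  set r := S.cs (A n) with hr
  have hr1 : r ^ 2 = 1 := by
    have := A.inner_map_map n n
    rw [h3, inner_smul_left, inner_smul_right, hnn, RCLike.conj_to_real] at this
    have h4 : S.len ^ 2 * (1 - S.c ^ 2) ≠ 0 := by
      have : 0 < 1 - S.c ^ 2 := by linarith
      positivity
    have h5 : (r ^ 2 - 1) * (S.len ^ 2 * (1 - S.c ^ 2)) = 0 := by linarith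
    rcases mul_eq_zero.mp h5 with h | h
    · linarith
    · exact absurd h h4
  have hext : ∀ B : E3 ≃ₗᵢ[ℝ] E3, B S.b = S.b → B S.e = S.e → B n = r • n → A = B := by
    intro B h4 h5 h6
    ext1 x
    rw [← S.pt_coord x]
    simp only [pt, map_add, map_smul, hna, hb, he, h3, h4, h5, h6]
  rcases (mul_eq_zero.mp (by linear_combination hr1 : (r - 1) * (r + 1) = 0)).imp
      sub_eq_zero.mp eq_neg_of_add_eq_zero_left with h | h
  · exact hext 1 rfl rfl (by rw [h, one_smul]; rfl)
  · exfalso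
    have h4 : A = ((ℝ ∙ n)ᗮ).reflection := by
      apply hext
      · apply Submodule.reflection_mem_subspace_eq_self
        rw [Submodule.mem_orthogonal_singleton_iff_inner_left]; exact hnb
      · apply Submodule.reflection_mem_subspace_eq_self
        rw [Submodule.mem_orthogonal_singleton_iff_inner_left]; exact hne
      · rw [Submodule.reflection_orthogonalComplement_singleton_eq_neg, h, neg_smul, one_smul]
    have hn0 : n ≠ 0 := by
      intro h0
      have := congrArg S.cs h0
      simp [hn] at this
    rw [h4, Submodule.det_reflection, Submodule.orthogonal_orthogonal,
      finrank_span_singleton hn0] at hA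
    norm_num at hA

/-- A motion fixing the vertices of an upright triangular facet is the identity. -/
lemma motion_eq_one {g : E3 ≃ᵃⁱ[ℝ] E3} (hg : g ∈ motions) (h0 : g 0 = 0) (hb : g S.b = S.b)
    (hc : g (S.pt 0 (1 / 2) (1 / 2)) = S.pt 0 (1 / 2) (1 / 2)) : g = 1 := by
  have hl : ∀ x, g x = lin g x := fun x => by rw [map_eq_lin, h0, add_zero]
  have h1 : lin g = 1 := by
    apply S.eq_one_of_fix hg
    · rw [← lin, ← hl, hb]
    · have : S.e = (2 : ℝ) • S.pt 0 (1 / 2) (1 / 2) - S.b := by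
        apply S.ext_coord <;> simp
      rw [← lin, this, map_sub, map_smul, ← hl, ← hl, hb, hc]
  ext1 x
  rw [hl, h1]; rfl

/-! ### Symmetries of the prototile -/

/-- The half-turn about the vertical axis of the prototile. -/
noncomputable def turnV : E3 ≃ᵃⁱ[ℝ] E3 := halfTurn (S.pt (1 / 2) (1 / 2) 0) S.e

/-- The half-turn about a diagonal of the rhombus. -/
noncomputable def turnD : E3 ≃ᵃⁱ[ℝ] E3 := halfTurn 0 (S.a + S.b)

lemma turnV_mem : S.turnV ∈ motions := halfTurn_mem _ S.e_ne

lemma ab_ne : S.a + S.b ≠ 0 := by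
  intro h
  have := congrArg S.cs h
  simp at this

lemma turnD_mem : S.turnD ∈ motions := halfTurn_mem _ S.ab_ne

lemma halfTurn_pt (p1 p2 p3 k1 k2 k3 s t z : ℝ) :
    halfTurn (S.pt p1 p2 p3) (S.pt k1 k2 k3) (S.pt s t z) =
      S.pt p1 p2 p3 + ((2 * (⟪S.pt k1 k2 k3, S.pt (s - p1) (t - p2) (z - p3)⟫ /
        ‖S.pt k1 k2 k3‖ ^ 2)) • S.pt k1 k2 k3 - S.pt (s - p1) (t - p2) (z - p3)) := by
  rw [halfTurn_apply, pt_sub]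

lemma turnV_pt (s t z : ℝ) : S.turnV (S.pt s t z) = S.pt (1 - s) (1 - t) z := by
  have := S.ht_ne
  rw [turnV, ← S.pt_e, halfTurn_pt, inner_pt, norm_sq_pt]
  have : 2 * ((S.len ^ 2 * (0 * (s - 1 / 2) + 0 * (t - 1 / 2) + S.c * (0 * (t - 1 / 2) +
      0 * (s - 1 / 2))) + 4 * S.ht ^ 2 * (1 * (z - 0))) / (S.len ^ 2 * (0 ^ 2 + 0 ^ 2 +
      2 * S.c * (0 * 0)) + 4 * S.ht ^ 2 * 1 ^ 2)) = 2 * z := by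
    field_simp; ring
  rw [this]
  apply S.ext_coord <;> simp <;> ring

lemma turnD_pt (s t z : ℝ) : S.turnD (S.pt s t z) = S.pt t s (-z) := by
  have h1 := S.len_ne
  have h2 : S.len ^ 2 * (2 * (1 + S.c)) ≠ 0 := by
    have := S.neg_c_lt
    have := pow_pos S.len_pos 2
    have h3 : 0 < 1 + S.c := by linarith
    positivity
  have h3 : S.a + S.b = S.pt 1 1 0 := by
    apply S.ext_coord <;> simp
  rw [turnD, h3, ← S.pt_zero, halfTurn_pt, inner_pt, norm_sq_pt]
  have : 2 * ((S.len ^ 2 * (1 * (s - 0) + 1 * (t - 0) + S.c * (1 * (t - 0) + 1 * (s - 0))) +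
      4 * S.ht ^ 2 * (0 * (z - 0))) / (S.len ^ 2 * (1 ^ 2 + 1 ^ 2 + 2 * S.c * (1 * 1)) +
      4 * S.ht ^ 2 * 0 ^ 2)) = s + t := by
    have h4 : (S.len ^ 2 * (1 ^ 2 + 1 ^ 2 + 2 * S.c * (1 * 1)) + 4 * S.ht ^ 2 * 0 ^ 2)
      = S.len ^ 2 * (2 * (1 + S.c)) := by ring
    have h5 : 1 + S.c ≠ 0 := fun h => h2 (by rw [h]; ring)
    rw [h4]; field_simp; ring
  rw [this]
  apply S.ext_coord <;> simp

lemma cs_turnV (x : E3) : S.cs (S.turnV x) = 1 - S.cs x := by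
  rw [← S.pt_coord x, turnV_pt]; simp
lemma ct_turnV (x : E3) : S.ct (S.turnV x) = 1 - S.ct x := by
  rw [← S.pt_coord x, turnV_pt]; simp
lemma cz_turnV (x : E3) : S.cz (S.turnV x) = S.cz x := by
  rw [← S.pt_coord x, turnV_pt]; simp
lemma cs_turnD (x : E3) : S.cs (S.turnD x) = S.ct x := by
  rw [← S.pt_coord x, turnD_pt]; simp
lemma ct_turnD (x : E3) : S.ct (S.turnD x) = S.cs x := by
  rw [← S.pt_coord x, turnD_pt]; simp
lemma cz_turnD (x : E3) : S.cz (S.turnD x) = -S.cz x := by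
  rw [← S.pt_coord x, turnD_pt]; simp

lemma turnV_turnV (x : E3) : S.turnV (S.turnV x) = x := by
  rw [← S.pt_coord x, turnV_pt, turnV_pt]; congr 1 <;> ring

lemma turnD_turnD (x : E3) : S.turnD (S.turnD x) = x := by
  rw [← S.pt_coord x, turnD_pt, turnD_pt]; congr 1; ring

lemma image_tile_eq {g : E3 ≃ᵃⁱ[ℝ] E3} (hg : ∀ x, g (g x) = x)
    (h : ∀ x ∈ S.tile, g x ∈ S.tile) : g '' S.tile = S.tile := by
  apply Subset.antisymm
  · rintro _ ⟨x, hx, rfl⟩; exact h x hx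
  · intro x hx; exact ⟨g x, h x hx, hg x⟩

lemma turnV_tile : S.turnV '' S.tile = S.tile := by
  apply S.image_tile_eq S.turnV_turnV
  intro x hx
  rw [mem_tile] at *
  rw [cs_turnV, ct_turnV, cz_turnV]
  obtain ⟨⟨h0, h1⟩, ⟨h2, h3⟩, ⟨h4, h5⟩, h6, h7⟩ := hx
  refine ⟨⟨?_, ?_⟩, ⟨?_, ?_⟩, ⟨?_, ?_⟩, ?_, ?_⟩ <;> linarith

lemma turnD_tile : S.turnD '' S.tile = S.tile := by
  apply S.image_tile_eq S.turnD_turnD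
  intro x hx
  rw [mem_tile] at *
  rw [cs_turnD, ct_turnD, cz_turnD]
  obtain ⟨⟨h0, h1⟩, ⟨h2, h3⟩, ⟨h4, h5⟩, h6, h7⟩ := hx
  refine ⟨⟨?_, ?_⟩, ⟨?_, ?_⟩, ⟨?_, ?_⟩, ?_, ?_⟩ <;> linarith

/-- The upright triangular facet in the plane `s = 0`. -/
noncomputable def tri0 : Set E3 := convexHull ℝ {0, S.b, S.pt 0 (1 / 2) (1 / 2)}

lemma image_convexHull3 (g : E3 ≃ᵃⁱ[ℝ] E3) (x y z : E3) :
    g '' convexHull ℝ {x, y, z} = convexHull ℝ {g x, g y, g z} := by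
  have := g.toAffineEquiv.toAffineMap.image_convexHull {x, y, z}
  simp only [image_insert_eq, image_singleton] at this
  exact this

/-- The symmetries of the prototile act transitively on its triangular facets. -/
lemma exists_symm_of_mem_facets {F : Set E3} (hF : F ∈ triangularFacets S.len S.ang S.ht) :
    ∃ d ∈ motions, d '' S.tile = S.tile ∧ d '' S.tri0 = F := by
  have ha : sideA S.len = S.pt 1 0 0 := S.pt_a.symm
  have hb : sideB S.len S.ang = S.pt 0 1 0 := S.pt_b.symm
  unfold triangularFacets at hF
  rw [ha, hb, topApex_eq, bottomApex_eq, ← S.pt_zero] at hF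
  simp only [pt_add] at hF
  have h1 : (S.turnD * S.turnV) '' S.tile = S.tile := by
    rw [mul_image, turnV_tile, turnD_tile]
  unfold tri0
  rw [← S.pt_b, ← S.pt_zero]
  rcases hF with rfl | rfl | rfl | rfl
  · exact ⟨1, one_mem _, image_id _, image_id _⟩
  · refine ⟨S.turnV, S.turnV_mem, S.turnV_tile, ?_⟩
    rw [image_convexHull3, turnV_pt, turnV_pt, turnV_pt]
    congr 1
    norm_num
    rw [insert_comm]
  · refine ⟨S.turnD, S.turnD_mem, S.turnD_tile, ?_⟩
    rw [image_convexHull3, turnD_pt, turnD_pt, turnD_pt]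
    norm_num
  · refine ⟨S.turnD * S.turnV, mul_mem S.turnD_mem S.turnV_mem, h1, ?_⟩
    rw [mul_image, image_convexHull3, turnV_pt, turnV_pt, turnV_pt, image_convexHull3, turnD_pt,
      turnD_pt, turnD_pt]
    congr 1
    norm_num
    rw [insert_comm]

lemma tri0_mem_facets : S.tri0 ∈ triangularFacets S.len S.ang S.ht := by
  left
  rw [tri0, topApex_eq]; rfl

end Shape

/-! ### Transport of tilings by motions, and neighbours across facets -/

/-- The image of a family of sets under an isometry. -/
def mapT (g : E3 ≃ᵃⁱ[ℝ] E3) (T : Set (Set E3)) : Set (Set E3) := (fun s => g '' s) '' T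

lemma mem_mapT {g : E3 ≃ᵃⁱ[ℝ] E3} {T : Set (Set E3)} {s : Set E3} :
    s ∈ mapT g T ↔ (g⁻¹ : E3 ≃ᵃⁱ[ℝ] E3) '' s ∈ T := by
  constructor
  · rintro ⟨t, ht, rfl⟩
    simpa only [inv_image] using ht
  · intro h
    exact ⟨_, h, image_inv g s⟩

lemma image_mem_mapT {g : E3 ≃ᵃⁱ[ℝ] E3} {T : Set (Set E3)} {s : Set E3} :
    g '' s ∈ mapT g T ↔ s ∈ T := by
  rw [mem_mapT, inv_image]

namespace Shape

variable (S : Shape)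

/-- The family `T` is an SCD tiling. -/
def IsTiling (T : Set (Set E3)) : Prop := IsSCDTiling S.len S.ang S.ht T

variable {S}

namespace IsTiling

variable {T : Set (Set E3)}

lemma congruent (hT : S.IsTiling T) {s : Set E3} (hs : s ∈ T) :
    ∃ g ∈ motions, s = g '' S.tile :=
  IsSCDTiling.congruent hT s hs

lemma closure_interior (hT : S.IsTiling T) {s : Set E3} (hs : s ∈ T) :
    closure (interior s) = s := by
  obtain ⟨g, -, rfl⟩ := hT.congruent hs
  rw [interior_image, closure_image, closure_interior_tile]

lemma isClosed (hT : S.IsTiling T) {s : Set E3} (hs : s ∈ T) : IsClosed s := by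
  rw [← hT.closure_interior hs]; exact isClosed_closure

lemma interior_nonempty (hT : S.IsTiling T) {s : Set E3} (hs : s ∈ T) :
    (interior s).Nonempty := by
  obtain ⟨g, -, rfl⟩ := hT.congruent hs
  rw [interior_image]
  exact ⟨_, mem_image_of_mem _ S.center_mem_interior⟩

/-- Tiles overlapping in an interior point coincide. -/
lemma eq_of_inter (hT : S.IsTiling T) {s s' : Set E3} (hs : s ∈ T) (hs' : s' ∈ T) {x : E3}
    (hx : x ∈ interior s) (hx' : x ∈ s') : s = s' := by
  by_contra hne
  have h1 := IsSCDTiling.packs hT hs hs' hne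
  rw [← hT.closure_interior hs'] at hx'
  have h2 := mem_closure_iff.mp hx' _ isOpen_interior hx
  obtain ⟨y, hy, hy'⟩ := h2
  exact disjoint_left.mp h1 hy hy'

/-- A neighbourhood of a point of a tile contains interior points of this tile. -/
lemma exists_interior (hT : S.IsTiling T) {s : Set E3} (hs : s ∈ T) {x : E3} (hx : x ∈ s)
    {U : Set E3} (hU : IsOpen U) (hxU : x ∈ U) : ∃ y ∈ U, y ∈ interior s := by
  rw [← hT.closure_interior hs] at hx
  exact mem_closure_iff.mp hx U hU hxU

lemma exists_mem (hT : S.IsTiling T) (x : E3) : ∃ s ∈ T, x ∈ s := by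
  have : x ∈ ⋃₀ T := by rw [IsSCDTiling.covers hT]; trivial
  exact this

lemma exists_motion (hT : S.IsTiling T) (x : E3) :
    ∃ g ∈ motions, g '' S.tile ∈ T ∧ x ∈ g '' S.tile := by
  obtain ⟨s, hs, hx⟩ := hT.exists_mem x
  obtain ⟨g, hg, rfl⟩ := hT.congruent hs
  exact ⟨g, hg, hs, hx⟩

/-- Composing the motion of the neighbour with a symmetry of the prototile makes the shared facet
the image of `tri0` from both sides, so that gluings are described by the motions preserving `tri0`.
-/
lemma exists_neighbor (hT : S.IsTiling T) {g : E3 ≃ᵃⁱ[ℝ] E3} (hg : g ∈ motions)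
    (h : g '' S.tile ∈ T) : ∃ g' ∈ motions, g' '' S.tile ∈ T ∧ g' '' S.tile ≠ g '' S.tile ∧
      g' '' S.tri0 = g '' S.tri0 := by
  obtain ⟨g', hg', h1, h2, F', hF', h3⟩ :=
    IsSCDTiling.faceToFace hT g hg h S.tri0 S.tri0_mem_facets
  obtain ⟨d, hd, hd1, rfl⟩ := S.exists_symm_of_mem_facets hF'
  have h4 : (g' * d) '' S.tile = g' '' S.tile := by rw [mul_image, hd1]
  refine ⟨g' * d, mul_mem hg' hd, ?_, ?_, ?_⟩
  · rw [h4]; exact h1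
  · rw [h4]; exact h2
  · rw [mul_image]; exact h3

lemma map (hT : S.IsTiling T) {g : E3 ≃ᵃⁱ[ℝ] E3} (hg : g ∈ motions) : S.IsTiling (mapT g T) where
  congruent := by
    rintro _ ⟨s, hs, rfl⟩
    obtain ⟨g', hg', rfl⟩ := hT.congruent hs
    exact ⟨g * g', mul_mem hg hg', (mul_image g g' _).symm⟩
  covers := by
    rw [eq_univ_iff_forall]
    intro x
    obtain ⟨s, hs, hx⟩ := hT.exists_mem (g⁻¹ x)
    refine ⟨g '' s, mem_image_of_mem _ hs, ?_⟩
    rwa [mem_image_iff]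
  packs := by
    rintro _ ⟨s, hs, rfl⟩ _ ⟨s', hs', rfl⟩ hne
    have hne' : s ≠ s' := fun h => hne (by rw [h])
    have h1 := IsSCDTiling.packs hT hs hs' hne'
    simp only [Function.onFun, interior_image]
    exact (disjoint_image_iff g.injective).mpr h1
  faceToFace := by
    intro k hk hkT F hF
    rw [mem_mapT, ← mul_image] at hkT
    obtain ⟨k', hk', h1, h2, F', hF', h3⟩ :=
      IsSCDTiling.faceToFace hT _ (mul_mem (inv_mem hg) hk) hkT F hF
    refine ⟨g * k', mul_mem hg hk', ?_, ?_, F', hF', ?_⟩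
    · rw [mul_image]; exact image_mem_mapT.mpr h1
    · intro h
      apply h2
      rw [mul_image, ← h, mul_image, inv_image]
    · rw [mul_image, h3, mul_image, image_inv]

end IsTiling

end Shape

open MeasureTheory

attribute [local instance] fact_finrank

/-! ### The volume of a wedge -/

/-- In polar coordinates a sector is a product, so its area factorises into a radial integral, which
is the same for all sectors, and the length of the interval of angles. -/
lemma volume_polar {ρ : ℝ} {A : Set (ℝ × ℝ)} (hA : MeasurableSet A) {J : Set ℝ}
    (hJ : MeasurableSet J) (hJπ : J ⊆ Ioo (-Real.pi) Real.pi)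
    (h : ∀ r > 0, ∀ α ∈ Ioo (-Real.pi) Real.pi,
      ((r * Real.cos α, r * Real.sin α) ∈ A ↔ r ^ 2 < ρ ∧ α ∈ J)) :
    volume A = (∫⁻ r in Ioi (0 : ℝ), ENNReal.ofReal r * ({r : ℝ | r ^ 2 < ρ}.indicator 1 r)) *
      volume J := by
  have hm : MeasurableSet {r : ℝ | r ^ 2 < ρ} :=
    (isOpen_lt (continuous_pow 2) continuous_const).measurableSet
  rw [← lintegral_indicator_one hA, ← lintegral_comp_polarCoord_symm, polarCoord_target]
  have h1 : ∀ p ∈ Ioi (0 : ℝ) ×ˢ Ioo (-Real.pi) Real.pi,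
      ENNReal.ofReal p.1 • A.indicator (1 : ℝ × ℝ → ENNReal) (polarCoord.symm p) =
      (ENNReal.ofReal p.1 * ({r : ℝ | r ^ 2 < ρ}.indicator 1 p.1)) *
        (J.indicator (1 : ℝ → ENNReal) p.2) := by
    rintro ⟨r, α⟩ ⟨hr, hα⟩
    have := h r hr α hα
    rw [polarCoord_symm_apply, smul_eq_mul, mul_assoc]
    dsimp only
    congr 1
    by_cases h2 : r ^ 2 < ρ
    · by_cases h3 : α ∈ J
      · rw [indicator_of_mem (this.mpr ⟨h2, h3⟩),
          indicator_of_mem (show r ∈ {r | r ^ 2 < ρ} from h2), indicator_of_mem h3]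
        simp
      · rw [indicator_of_notMem (fun h => h3 (this.mp h).2), indicator_of_notMem h3, mul_zero]
    · rw [indicator_of_notMem (fun h => h2 (this.mp h).1),
        indicator_of_notMem (show r ∉ {r | r ^ 2 < ρ} from h2), zero_mul]
  rw [setLIntegral_congr_fun (measurableSet_Ioi.prod measurableSet_Ioo) h1,
    Measure.volume_eq_prod, ← Measure.prod_restrict]
  refine (lintegral_prod_mul
    (f := fun r : ℝ => ENNReal.ofReal r * ({r : ℝ | r ^ 2 < ρ}.indicator 1 r))
    (g := J.indicator 1) ?_ ?_).trans ?_
  rotate_left 2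
  · congr 1
    rw [lintegral_indicator_one hJ, Measure.restrict_apply hJ, inter_eq_left.mpr hJπ]
  · exact (ENNReal.measurable_ofReal.mul (measurable_one.indicator hm)).aemeasurable
  · exact (measurable_one.indicator hJ).aemeasurable

/-- The two half-plane conditions read `|α| ≤ π / 2` and `|α - θ| ≤ π / 2` for the polar angle,
leaving an interval of length `π - θ` out of `2π`. -/
lemma volume_planar_wedge {θ : ℝ} (h0 : 0 ≤ θ) (hπ : θ < Real.pi) (ρ : ℝ) :
    volume {q : ℝ × ℝ | q.1 ^ 2 + q.2 ^ 2 < ρ ∧ 0 ≤ q.1 ∧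
      0 ≤ Real.cos θ * q.1 + Real.sin θ * q.2} =
    ENNReal.ofReal ((Real.pi - θ) / (2 * Real.pi)) *
      volume {q : ℝ × ℝ | q.1 ^ 2 + q.2 ^ 2 < ρ} := by
  have hpi := Real.pi_pos
  have hc : ∀ r α : ℝ, (r * Real.cos α) ^ 2 + (r * Real.sin α) ^ 2 = r ^ 2 := fun r α => by
    linear_combination r ^ 2 * Real.sin_sq_add_cos_sq α
  have hball : IsOpen {q : ℝ × ℝ | q.1 ^ 2 + q.2 ^ 2 < ρ} :=
    isOpen_lt (by fun_prop) (by fun_prop)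
  have k1 : MeasurableSet {q : ℝ × ℝ | 0 ≤ q.1} := measurableSet_le (by fun_prop) (by fun_prop)
  have k2 : MeasurableSet {q : ℝ × ℝ | 0 ≤ Real.cos θ * q.1 + Real.sin θ * q.2} :=
    measurableSet_le (by fun_prop) (by fun_prop)
  have hw : MeasurableSet {q : ℝ × ℝ | q.1 ^ 2 + q.2 ^ 2 < ρ ∧ 0 ≤ q.1 ∧
      0 ≤ Real.cos θ * q.1 + Real.sin θ * q.2} :=
    hball.measurableSet.inter (k1.inter k2)
  have hJ : Icc (θ - Real.pi / 2) (Real.pi / 2) ⊆ Ioo (-Real.pi) Real.pi := by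
    rintro x ⟨h1, h2⟩
    constructor <;> linarith
  rw [volume_polar hw measurableSet_Icc hJ, volume_polar hball.measurableSet measurableSet_Ioo
    Subset.rfl (ρ := ρ), Real.volume_Icc, Real.volume_Ioo, mul_left_comm,
    ← ENNReal.ofReal_mul (div_nonneg (by linarith) (by linarith))]
  · congr 2
    field_simp
    ring
  · intro r hr α hα
    simp [hc, hα.1, hα.2]
  · intro r hr α hα
    have h1 : Real.cos θ * (r * Real.cos α) + Real.sin θ * (r * Real.sin α) =
      r * Real.cos (α - θ) := by rw [Real.cos_sub]; ring
    simp only [mem_ofPred_eq, hc, h1, mul_nonneg_iff_of_pos_left hr, mem_Icc]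
    refine and_congr_right fun _ => ⟨fun ⟨h2, h3⟩ => ?_, fun ⟨h2, h3⟩ => ⟨?_, ?_⟩⟩
    · have h4 : α ≤ Real.pi / 2 := by
        by_contra! h4
        exact absurd (Real.cos_neg_of_pi_div_two_lt_of_lt h4 (by linarith [hα.2])) (by linarith)
      refine ⟨?_, h4⟩
      by_contra! h5
      rcases lt_or_ge α (-(Real.pi / 2)) with h6 | h6
      · have := Real.cos_neg_of_pi_div_two_lt_of_lt (x := -α) (by linarith) (by linarith [hα.1])
        rw [Real.cos_neg] at this
        linarith
      · have := Real.cos_neg_of_pi_div_two_lt_of_lt (x := -(α - θ)) (by linarith) (by linarith)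
        rw [Real.cos_neg] at this
        linarith
    · exact Real.cos_nonneg_of_mem_Icc ⟨by linarith, h3⟩
    · exact Real.cos_nonneg_of_mem_Icc ⟨by linarith, by linarith⟩

/-- Two vectors in an adapted orthonormal basis. -/
lemma exists_adapted_basis {n m : E3} (hn : n ≠ 0) (hm : m ≠ 0) :
    ∃ B : OrthonormalBasis (Fin 3) ℝ E3, n = ‖n‖ • B 0 ∧
      m = ‖m‖ • (Real.cos (InnerProductGeometry.angle n m) • B 0 +
        Real.sin (InnerProductGeometry.angle n m) • B 1) := by
  set θ := InnerProductGeometry.angle n m with hθ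
  have hn' := norm_pos_iff.mpr hn
  have hm' := norm_pos_iff.mpr hm
  set u : E3 := ‖n‖⁻¹ • n with hu
  have hu1 : ‖u‖ = 1 := norm_smul_inv_norm hn
  set w : E3 := ‖m‖⁻¹ • m - Real.cos θ • u with hw
  have huw : ⟪u, w⟫ = 0 := by
    rw [hw, inner_sub_right, inner_smul_right, inner_smul_right, hu, inner_smul_left,
      inner_smul_left, inner_smul_right, real_inner_self_eq_norm_sq,
      ← InnerProductGeometry.cos_angle_mul_norm_mul_norm n m]
    simp only [RCLike.conj_to_real]
    field_simp
    ring
  have hw1 : ‖w‖ ^ 2 = Real.sin θ ^ 2 := by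
    have h1 : ⟪‖m‖⁻¹ • m, u⟫ = Real.cos θ := by
      rw [hu, inner_smul_left, inner_smul_right, real_inner_comm,
        ← InnerProductGeometry.cos_angle_mul_norm_mul_norm n m]
      simp only [RCLike.conj_to_real]
      field_simp
      rfl
    have h2 : ‖‖m‖⁻¹ • m‖ = 1 := norm_smul_inv_norm hm
    rw [hw, norm_sub_sq_real, inner_smul_right, h1, h2, norm_smul, hu1, Real.norm_eq_abs]
    rw [mul_one, sq_abs]
    linarith [Real.sin_sq_add_cos_sq θ]
  have hs : 0 ≤ Real.sin θ := InnerProductGeometry.sin_angle_nonneg n m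
  have hwn : ‖w‖ = Real.sin θ := by
    rw [← abs_of_nonneg hs, ← abs_of_nonneg (norm_nonneg w)]
    exact sq_eq_sq_iff_abs_eq_abs _ _ |>.mp hw1
  obtain ⟨v, hv1, hv2, hv3⟩ : ∃ v : E3, ‖v‖ = 1 ∧ ⟪u, v⟫ = 0 ∧ w = Real.sin θ • v := by
    -- For parallel vectors the sine vanishes and any unit vector orthogonal to `u` will do.
    by_cases h0 : w = 0
    · have hu0 : u ≠ 0 := fun h => by rw [h] at hu1; simp at hu1
      have hf := Submodule.finrank_orthogonal_span_singleton (𝕜 := ℝ) (n := 2) hu0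
      obtain ⟨⟨v, hv⟩, hv0⟩ : ∃ v : (ℝ ∙ u)ᗮ, v ≠ 0 := by
        have : Nontrivial (ℝ ∙ u)ᗮ := Module.nontrivial_of_finrank_pos (R := ℝ) (by omega)
        exact exists_ne 0
      have hv0' : v ≠ 0 := fun h => hv0 (by ext1; exact h)
      refine ⟨‖v‖⁻¹ • v, norm_smul_inv_norm hv0', ?_, ?_⟩
      · rw [inner_smul_right, Submodule.mem_orthogonal_singleton_iff_inner_right.mp hv, mul_zero]
      · rw [h0, ← hwn, h0]; simp
    · refine ⟨‖w‖⁻¹ • w, norm_smul_inv_norm h0, by rw [inner_smul_right, huw, mul_zero], ?_⟩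
      rw [← hwn, smul_smul, mul_inv_cancel₀ (norm_ne_zero_iff.mpr h0), one_smul]
  have hon : Orthonormal ℝ (({0, 1} : Set (Fin 3)).domRestrict ![u, v, 0]) := by
    constructor
    · rintro ⟨i, rfl | rfl⟩
      · exact hu1
      · exact hv1
    · rintro ⟨i, rfl | rfl⟩ ⟨j, rfl | rfl⟩ hij
      · exact absurd rfl hij
      · exact hv2
      · show ⟪v, u⟫ = 0
        rw [real_inner_comm, hv2]
      · exact absurd rfl hij
  obtain ⟨B, hB⟩ := hon.exists_orthonormalBasis_extension_of_card_eq (by simp)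
  have hB0 : B 0 = u := hB 0 (by simp)
  have hB1 : B 1 = v := hB 1 (by simp)
  refine ⟨B, ?_, ?_⟩
  · rw [hB0, hu, smul_smul, mul_inv_cancel₀ hn'.ne', one_smul]
  · rw [hB0, hB1, ← hv3, hw, add_sub_cancel, smul_smul, mul_inv_cancel₀ hm'.ne', one_smul]

/-- Slicing along the edge of the wedge: every slice of the ball is a disc cut by the same planar
wedge, so the proportion passes to the volume. -/
lemma volume_wedge_coord {θ : ℝ} (h0 : 0 ≤ θ) (hπ : θ < Real.pi) (r : ℝ) :
    volume {x : E3 | x 0 ^ 2 + x 1 ^ 2 + x 2 ^ 2 < r ∧ 0 ≤ x 0 ∧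
      0 ≤ Real.cos θ * x 0 + Real.sin θ * x 1} =
    ENNReal.ofReal ((Real.pi - θ) / (2 * Real.pi)) *
      volume {x : E3 | x 0 ^ 2 + x 1 ^ 2 + x 2 ^ 2 < r} := by
  have hp : MeasurePreserving (fun x : E3 => (x 2, (x 0, x 1))) volume volume := by
    have h1 := EuclideanSpace.volume_preserving_symm_measurableEquiv_toLp (Fin 3)
    have h2 := volume_preserving_piFinSuccAbove (fun _ : Fin 3 => ℝ) 2
    have h3 := (MeasurePreserving.id (volume : Measure ℝ)).prod (volume_preserving_finTwoArrow ℝ)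
    exact h3.comp (h2.comp h1)
  set W : Set (ℝ × ℝ × ℝ) := {q | q.2.1 ^ 2 + q.2.2 ^ 2 + q.1 ^ 2 < r ∧ 0 ≤ q.2.1 ∧
      0 ≤ Real.cos θ * q.2.1 + Real.sin θ * q.2.2} with hW
  set D : Set (ℝ × ℝ × ℝ) := {q | q.2.1 ^ 2 + q.2.2 ^ 2 + q.1 ^ 2 < r} with hD
  have hDm : MeasurableSet D := (isOpen_lt (by fun_prop) (by fun_prop)).measurableSet
  have k1 : MeasurableSet {q : ℝ × ℝ × ℝ | 0 ≤ q.2.1} :=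
    measurableSet_le (by fun_prop) (by fun_prop)
  have k2 : MeasurableSet {q : ℝ × ℝ × ℝ | 0 ≤ Real.cos θ * q.2.1 + Real.sin θ * q.2.2} :=
    measurableSet_le (by fun_prop) (by fun_prop)
  have hWm : MeasurableSet W := hDm.inter (k1.inter k2)
  have e1 := hp.measure_preimage hWm.nullMeasurableSet
  have e2 := hp.measure_preimage hDm.nullMeasurableSet
  rw [show {x : E3 | x 0 ^ 2 + x 1 ^ 2 + x 2 ^ 2 < r ∧ 0 ≤ x 0 ∧
      0 ≤ Real.cos θ * x 0 + Real.sin θ * x 1} = (fun x : E3 => (x 2, (x 0, x 1))) ⁻¹' W from rfl,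
    show {x : E3 | x 0 ^ 2 + x 1 ^ 2 + x 2 ^ 2 < r} =
      (fun x : E3 => (x 2, (x 0, x 1))) ⁻¹' D from rfl, e1, e2, Measure.volume_eq_prod,
    Measure.prod_apply hWm, Measure.prod_apply hDm,
    ← lintegral_const_mul _ (measurable_measure_prodMk_left hDm)]
  congr 1
  funext z
  have := volume_planar_wedge h0 hπ (r - z ^ 2)
  simpa only [hW, hD, preimage_ofPred_eq, lt_sub_iff_add_lt] using this

/-- The volume of the part of a ball that lies in a wedge. -/
lemma volume_wedge {n m : E3} (hn : n ≠ 0) (hm : m ≠ 0)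
    (hnm : InnerProductGeometry.angle n m < Real.pi) (p : E3) {r : ℝ} (hr : 0 < r) :
    volume {x ∈ ball p r | 0 ≤ ⟪n, x - p⟫ ∧ 0 ≤ ⟪m, x - p⟫} =
      ENNReal.ofReal ((Real.pi - InnerProductGeometry.angle n m) / (2 * Real.pi)) *
        volume (ball p r) := by
  obtain ⟨B, h1, h2⟩ := exists_adapted_basis hn hm
  have hn' := norm_pos_iff.mpr hn
  have hm' := norm_pos_iff.mpr hm
  set θ := InnerProductGeometry.angle n m with hθ
  have hp : MeasurePreserving (fun x : E3 => B.repr (x - p)) volume volume :=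
    (B.repr.measurePreserving).comp (measurePreserving_sub_right volume p)
  have hmeas1 : MeasurableSet {x : E3 | x 0 ^ 2 + x 1 ^ 2 + x 2 ^ 2 < r ^ 2} :=
    (isOpen_lt (by fun_prop) (by fun_prop)).measurableSet
  have k1 : MeasurableSet {x : E3 | 0 ≤ x 0} := measurableSet_le (by fun_prop) (by fun_prop)
  have k2 : MeasurableSet {x : E3 | 0 ≤ Real.cos θ * x 0 + Real.sin θ * x 1} :=
    measurableSet_le (by fun_prop) (by fun_prop)
  have hmeas2 : MeasurableSet {x : E3 | x 0 ^ 2 + x 1 ^ 2 + x 2 ^ 2 < r ^ 2 ∧ 0 ≤ x 0 ∧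
      0 ≤ Real.cos θ * x 0 + Real.sin θ * x 1} :=
    hmeas1.inter (k1.inter k2)
  have e1 := hp.measure_preimage hmeas1.nullMeasurableSet
  have e2 := hp.measure_preimage hmeas2.nullMeasurableSet
  have hball : ∀ x : E3, x ∈ ball p r ↔ B.repr (x - p) 0 ^ 2 + B.repr (x - p) 1 ^ 2 +
      B.repr (x - p) 2 ^ 2 < r ^ 2 := by
    intro x
    have h3 : ‖x - p‖ ^ 2 = B.repr (x - p) 0 ^ 2 + B.repr (x - p) 1 ^ 2 +
        B.repr (x - p) 2 ^ 2 := by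
      rw [← B.repr.norm_map, EuclideanSpace.norm_sq_eq, Fin.sum_univ_three]
      simp
    rw [mem_ball, dist_eq_norm, ← h3]
    exact (pow_lt_pow_iff_left₀ (norm_nonneg _) hr.le two_ne_zero).symm
  have hin : ∀ x : E3, ⟪n, x⟫ = ‖n‖ * B.repr x 0 ∧
      ⟪m, x⟫ = ‖m‖ * (Real.cos θ * B.repr x 0 + Real.sin θ * B.repr x 1) := by
    intro x
    constructor
    · conv_lhs => rw [h1]
      rw [inner_smul_left, B.repr_apply_apply]; simp
    · conv_lhs => rw [h2]
      rw [inner_smul_left, inner_add_left, inner_smul_left, inner_smul_left, B.repr_apply_apply,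
        B.repr_apply_apply]; simp
  have s1 : ball p r = (fun x : E3 => B.repr (x - p)) ⁻¹'
      {x : E3 | x 0 ^ 2 + x 1 ^ 2 + x 2 ^ 2 < r ^ 2} := by
    ext x; exact hball x
  have s2 : {x ∈ ball p r | 0 ≤ ⟪n, x - p⟫ ∧ 0 ≤ ⟪m, x - p⟫} =
      (fun x : E3 => B.repr (x - p)) ⁻¹' {x : E3 | x 0 ^ 2 + x 1 ^ 2 + x 2 ^ 2 < r ^ 2 ∧ 0 ≤ x 0 ∧
      0 ≤ Real.cos θ * x 0 + Real.sin θ * x 1} := by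
    ext x
    simp only [mem_ofPred_eq, hball x, (hin (x - p)).1, (hin (x - p)).2, mem_preimage,
      mul_nonneg_iff_of_pos_left hn', mul_nonneg_iff_of_pos_left hm']
  rw [s2, s1, e1, e2]
  exact volume_wedge_coord (InnerProductGeometry.angle_nonneg _ _) hnm _

/-! ### Finiteness of the symmetry group of the prototile -/

lemma map_mem_extremePoints {g : E3 ≃ᵃⁱ[ℝ] E3} {s : Set E3} (hg : g '' s = s) {x : E3}
    (hx : x ∈ s.extremePoints ℝ) : g x ∈ s.extremePoints ℝ := by
  rw [mem_extremePoints] at hx ⊢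
  refine ⟨hg ▸ mem_image_of_mem g hx.1, ?_⟩
  intro y hy z hz hyz
  rw [← hg, mem_image_iff] at hy hz
  have h1 : x ∈ openSegment ℝ (g⁻¹ y) (g⁻¹ z) := by
    have := mem_image_of_mem (g⁻¹ : E3 ≃ᵃⁱ[ℝ] E3).toAffineEquiv.toAffineMap hyz
    rw [image_openSegment] at this
    have h3 : (g⁻¹ : E3 ≃ᵃⁱ[ℝ] E3) (g x) ∈ openSegment ℝ (g⁻¹ y) (g⁻¹ z) := this
    rwa [inv_apply_apply] at h3
  have h2 := hx.2 _ hy _ hz h1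
  exact ⟨by rw [← h2.1, apply_inv_apply], by rw [← h2.2, apply_inv_apply]⟩

namespace Shape

variable (S : Shape)

lemma exists_finite_tile_eq_convexHull : ∃ V : Set E3, V.Finite ∧ S.tile = convexHull ℝ V := by
  obtain ⟨V, hV, hU⟩ : ∃ V : Set E3, V.Finite ∧ upperPrism S.len S.ang S.ht = convexHull ℝ V :=
    ⟨_, by simp, rfl⟩
  obtain ⟨W, hW, hL⟩ : ∃ V : Set E3, V.Finite ∧ lowerPrism S.len S.ang S.ht = convexHull ℝ V :=
    ⟨_, by simp, rfl⟩
  refine ⟨V ∪ W, hV.union hW, ?_⟩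
  have h : S.tile = convexHull ℝ V ∪ convexHull ℝ W := by rw [← hU, ← hL]; rfl
  apply Subset.antisymm
  · rw [h]
    exact union_subset (convexHull_mono subset_union_left) (convexHull_mono subset_union_right)
  · apply convexHull_min _ S.convex_tile
    rw [h]
    exact union_subset_union (subset_convexHull ℝ V) (subset_convexHull ℝ W)

/-- An isometry is determined by its values on the prototile. -/
lemma eq_of_eqOn_tile {g g' : E3 ≃ᵃⁱ[ℝ] E3} (h : ∀ x ∈ S.tile, g x = g' x) : g = g' := by
  have h0 : (0 : E3) ∈ S.tile := by rw [mem_tile]; simp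
  have ha : S.a ∈ S.tile := by rw [mem_tile]; simp
  have hb : S.b ∈ S.tile := by rw [mem_tile]; simp
  have hc : S.pt 0 (1 / 2) (1 / 2) ∈ S.tile := by rw [mem_tile]; simp; norm_num
  have e0 := h 0 h0
  have hlin : ∀ x ∈ S.tile, lin g x = lin g' x := by
    intro x hx
    have := h x hx
    rw [map_eq_lin g, map_eq_lin g', e0] at this
    exact add_right_cancel this
  have he : lin g S.e = lin g' S.e := by
    have : S.e = (2 : ℝ) • S.pt 0 (1 / 2) (1 / 2) - S.b := by
      apply S.ext_coord <;> simp
    rw [this, map_sub, map_sub, map_smul, map_smul, hlin _ hc, hlin _ hb]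
  ext1 x
  rw [map_eq_lin g, map_eq_lin g', e0, ← S.pt_coord x]
  simp only [pt, map_add, map_smul, hlin _ ha, hlin _ hb, he]

/-- The prototile has finitely many symmetries. -/
lemma finite_symm : {g : E3 ≃ᵃⁱ[ℝ] E3 | g '' S.tile = S.tile}.Finite := by
  obtain ⟨V, hV, hVt⟩ := S.exists_finite_tile_eq_convexHull
  set E := S.tile.extremePoints ℝ with hE
  have hEf : E.Finite := hV.subset (by rw [hE, hVt]; exact extremePoints_convexHull_subset)
  have hmaps : ∀ g : E3 ≃ᵃⁱ[ℝ] E3, g '' S.tile = S.tile → ∀ x ∈ E, g x ∈ E :=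
    fun g hg x hx => map_mem_extremePoints hg hx
  have hfin : Finite E := hEf
  -- A symmetry permutes the finitely many extreme points, and this permutation determines it, since
  -- the tile is the closed convex hull of its extreme points.
  let F : {g : E3 ≃ᵃⁱ[ℝ] E3 | g '' S.tile = S.tile} → (E → E) :=
    fun g x => ⟨g.1 x.1, hmaps g.1 g.2 x.1 x.2⟩
  refine @Finite.of_injective _ _ _ F ?_
  intro g g' hgg
  apply Subtype.ext
  apply S.eq_of_eqOn_tile
  have hEq : EqOn g.1 g'.1 E := fun x hx => congrArg Subtype.val (congrFun hgg ⟨x, hx⟩)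
  have hcl : IsClosed {x : E3 | g.1 x = g'.1 x} :=
    isClosed_eq g.1.continuous g'.1.continuous
  have hcv : Convex ℝ {x : E3 | g.1 x = g'.1 x} := by
    intro x hx y hy s t _ _ hst
    have e1 := Convex.combo_affine_apply (f := g.1.toAffineEquiv.toAffineMap) (x := x) (y := y) hst
    have e2 := Convex.combo_affine_apply (f := g'.1.toAffineEquiv.toAffineMap) (x := x) (y := y) hst
    have hx' : g.1 x = g'.1 x := hx
    have hy' : g.1 y = g'.1 y := hy
    change g.1 _ = g'.1 _
    change g.1 _ = s • g.1 x + t • g.1 y at e1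
    change g'.1 _ = s • g'.1 x + t • g'.1 y at e2
    rw [e1, e2, hx', hy']
  have := closure_convexHull_extremePoints S.isCompact_tile S.convex_tile
  intro x hx
  rw [← this] at hx
  exact closure_minimal (convexHull_min hEq hcv) hcl hx

end Shape

/-! ### Dihedral angles, measured by the volume occupied in small balls -/

lemma volume_image (g : E3 ≃ᵃⁱ[ℝ] E3) (s : Set E3) : volume (g '' s) = volume s := by
  have h1 : MeasurePreserving (fun x => (lin g⁻¹) x + g⁻¹ 0) (volume : Measure E3) volume :=
    (measurePreserving_add_right volume (g⁻¹ 0)).comp (lin g⁻¹).measurePreserving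
  have h2 : (fun x => (lin g⁻¹) x + g⁻¹ 0) = (g⁻¹ : E3 ≃ᵃⁱ[ℝ] E3) := by
    funext x; exact (map_eq_lin _ _).symm
  rw [h2] at h1
  have h3 : g '' s = (g⁻¹ : E3 ≃ᵃⁱ[ℝ] E3) ⁻¹' s := by
    ext x; exact mem_image_iff g s x
  rw [h3, h1.measure_preimage_emb (g⁻¹ : E3 ≃ᵃⁱ[ℝ] E3).toHomeomorph.measurableEmbedding]

/-- Near `p`, the set `X` occupies the same portion of space as a wedge of angle `α`. -/
def HasAngle (X : Set E3) (p : E3) (α : ℝ) : Prop :=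
  0 ≤ α ∧ ∃ ε > 0, ∀ r, 0 < r → r ≤ ε →
    volume (X ∩ ball p r) = ENNReal.ofReal (α / (2 * Real.pi)) * volume (ball p r)

namespace HasAngle

variable {X : Set E3} {p : E3} {α β : ℝ}

lemma unique (h : HasAngle X p α) (h' : HasAngle X p β) : α = β := by
  obtain ⟨hα, ε, hε, h⟩ := h
  obtain ⟨hβ, δ, hδ, h'⟩ := h'
  have hr : 0 < min ε δ := lt_min hε hδ
  have e := h _ hr (min_le_left _ _)
  rw [h' _ hr (min_le_right _ _)] at e
  have hb := (measure_ball_pos volume p hr).ne'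
  have hb' : volume (ball p (min ε δ)) ≠ ⊤ := measure_ball_lt_top.ne
  rw [ENNReal.mul_left_inj hb hb',
    ENNReal.ofReal_eq_ofReal_iff (by positivity) (by positivity)] at e
  have := Real.pi_pos
  field_simp at e
  exact e.symm

lemma image (h : HasAngle X p α) (g : E3 ≃ᵃⁱ[ℝ] E3) : HasAngle (g '' X) (g p) α := by
  obtain ⟨hα, ε, hε, h⟩ := h
  refine ⟨hα, ε, hε, fun r hr hr' => ?_⟩
  have hb : ball (g p) r = g '' ball p r := (g.toIsometryEquiv.image_ball p r).symm
  rw [hb, ← image_inter g.injective, volume_image, volume_image, h r hr hr']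

lemma of_image {g : E3 ≃ᵃⁱ[ℝ] E3} (h : HasAngle X (g⁻¹ p) α) : HasAngle (g '' X) p α := by
  have := h.image g
  rwa [apply_inv_apply] at this

end HasAngle

namespace Shape

variable {S : Shape}

namespace IsTiling

variable {T : Set (Set E3)}

lemma countable (hT : S.IsTiling T) : T.Countable :=
  hT.packs.countable_of_isOpen (fun _ _ => isOpen_interior) (fun _ hs => hT.interior_nonempty hs)

/-- Only countably many isometries map the prototile to a tile. -/
lemma countable_motions (hT : S.IsTiling T) :
    {g : E3 ≃ᵃⁱ[ℝ] E3 | g '' S.tile ∈ T}.Countable := by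
  have : {g : E3 ≃ᵃⁱ[ℝ] E3 | g '' S.tile ∈ T} = ⋃ X ∈ T, {g : E3 ≃ᵃⁱ[ℝ] E3 | g '' S.tile = X} := by
    ext g; simp
  rw [this]
  refine hT.countable.biUnion fun X _ => ?_
  rcases eq_empty_or_nonempty {g : E3 ≃ᵃⁱ[ℝ] E3 | g '' S.tile = X} with h | ⟨g0, hg0⟩
  · rw [h]; exact countable_empty
  · refine (S.finite_symm.image (fun g => g0 * g)).countable.mono ?_
    intro g hg
    refine ⟨g0⁻¹ * g, ?_, by simp⟩
    change (g0⁻¹ * g) '' S.tile = S.tile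
    have hg' : g '' S.tile = X := hg
    have hg0' : g0 '' S.tile = X := hg0
    rw [mul_image, hg', ← hg0', inv_image]

lemma measurableSet (hT : S.IsTiling T) {s : Set E3} (hs : s ∈ T) : MeasurableSet s :=
  (hT.isClosed hs).measurableSet

/-- Only finitely many tiles meet a bounded set. -/
lemma finite_meeting (hT : S.IsTiling T) (p : E3) (r : ℝ) :
    {X ∈ T | (X ∩ ball p r).Nonempty}.Finite := by
  obtain ⟨D, hD⟩ := S.isCompact_tile.isBounded.subset_ball 0
  have hpos : 0 < volume (interior S.tile) :=
    isOpen_interior.measure_pos volume ⟨_, S.center_mem_interior⟩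
  -- A tile has diameter less than `2 * D`, so each tile meeting the ball lies in the enlarged ball;
  -- there is room in it for finitely many disjoint interiors of the same positive volume.
  have key := Measure.finite_const_le_meas_of_disjoint_iUnion (volume : Measure E3) hpos
    (As := fun X : T => interior X.1 ∩ ball p (r + 2 * D))
    (fun X => isOpen_interior.measurableSet.inter measurableSet_ball)
    (fun X Y hXY => (hT.packs X.2 Y.2 (fun h => hXY (Subtype.ext h))).mono
      inter_subset_left inter_subset_left)
    (ne_top_of_le_ne_top (measure_ball_lt_top (x := p) (r := r + 2 * D)).ne
      (measure_mono (iUnion_subset fun X => inter_subset_right)))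
  refine (key.image Subtype.val).subset ?_
  rintro X ⟨hX, y, hyX, hy⟩
  refine ⟨⟨X, hX⟩, ?_, rfl⟩
  obtain ⟨g, hg, rfl⟩ := hT.congruent hX
  have hsub : g '' S.tile ⊆ ball p (r + 2 * D) := by
    rintro _ ⟨x, hx, rfl⟩
    obtain ⟨y', hy', rfl⟩ := hyX
    have h1 := hD hx
    have h2 := hD hy'
    rw [mem_ball] at *
    have : dist (g x) (g y') = dist x y' := g.dist_map _ _
    have h3 := dist_triangle (g x) (g y') p
    have h4 := dist_triangle_right x y' 0
    linarith
  change volume (interior S.tile) ≤ volume (interior (g '' S.tile) ∩ ball p (r + 2 * D))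
  rw [inter_eq_left.mpr (interior_subset.trans hsub), interior_image, volume_image]

/-- The tiles containing `p` cover a neighbourhood of `p`. -/
lemma exists_star (hT : S.IsTiling T) (p : E3) :
    ∃ F : Finset (Set E3), (∀ X, X ∈ F ↔ X ∈ T ∧ p ∈ X) ∧ ∃ ε > 0, ball p ε ⊆ ⋃ X ∈ F, X := by
  have hfin := hT.finite_meeting p 1
  have hF : {X ∈ T | p ∈ X}.Finite :=
    hfin.subset fun X hX => ⟨hX.1, p, hX.2, mem_ball_self one_pos⟩
  have hG : {X ∈ T | (X ∩ ball p 1).Nonempty ∧ p ∉ X}.Finite :=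
    hfin.subset fun X hX => ⟨hX.1, hX.2.1⟩
  have hcl : IsClosed (⋃ X ∈ {X ∈ T | (X ∩ ball p 1).Nonempty ∧ p ∉ X}, X) :=
    hG.isClosed_biUnion fun X hX => hT.isClosed hX.1
  have hp : p ∈ (⋃ X ∈ {X ∈ T | (X ∩ ball p 1).Nonempty ∧ p ∉ X}, X)ᶜ := by
    simp only [mem_compl_iff, mem_iUnion, not_exists]
    exact fun X hX hpX => hX.2.2 hpX
  obtain ⟨ε, hε, hsub⟩ := Metric.isOpen_iff.mp hcl.isOpen_compl p hp
  refine ⟨hF.toFinset, by simp, min ε 1, lt_min hε one_pos, fun x hx => ?_⟩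
  obtain ⟨X, hX, hxX⟩ := hT.exists_mem x
  simp only [mem_iUnion, Finite.mem_toFinset]
  refine ⟨X, ⟨hX, ?_⟩, hxX⟩
  by_contra hpX
  refine hsub (ball_subset_ball (min_le_left _ _) hx) ?_
  simp only [mem_iUnion]
  exact ⟨X, ⟨hX, ⟨x, hxX, ball_subset_ball (min_le_right _ _) hx⟩, hpX⟩, hxX⟩

/-- Two tiles can only meet in their frontiers, and frontiers of convex sets are null sets. -/
lemma aedisjoint (hT : S.IsTiling T) {X Y : Set E3} (hX : X ∈ T) (hY : Y ∈ T) (h : X ≠ Y) :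
    AEDisjoint volume X Y := by
  have key : ∀ X ∈ T, volume (frontier X) = 0 := by
    intro X hX
    obtain ⟨g, hg, rfl⟩ := hT.congruent hX
    refine Convex.addHaar_frontier volume ?_
    have : Convex ℝ (g.toAffineEquiv.toAffineMap '' S.tile) := S.convex_tile.affine_image _
    exact this
  refine measure_mono_null (t := frontier X ∪ frontier Y) ?_
    (measure_union_null (key X hX) (key Y hY))
  rintro x ⟨hx, hy⟩
  by_contra hc
  simp only [mem_union, not_or, frontier, mem_sdiff, not_and, not_not] at hc
  exact disjoint_left.mp (hT.packs hX hY h) (hc.1 (subset_closure hx)) (hc.2 (subset_closure hy))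

lemma volume_inter_ball (hT : S.IsTiling T) {F : Finset (Set E3)} (hF : ∀ X ∈ F, X ∈ T) (p : E3)
    (r : ℝ) : volume ((⋃ X ∈ F, X) ∩ ball p r) = ∑ X ∈ F, volume (X ∩ ball p r) := by
  rw [iUnion₂_inter, measure_biUnion_finset₀]
  · intro X hX Y hY hXY
    exact (hT.aedisjoint (hF X hX) (hF Y hY) hXY).mono inter_subset_left inter_subset_left
  · intro X hX
    exact ((hT.measurableSet (hF X hX)).inter measurableSet_ball).nullMeasurableSet

/-- The angles of tiles at a point. -/
lemma exists_sum_angle (hT : S.IsTiling T) {F : Finset (Set E3)} (hF : ∀ X ∈ F, X ∈ T) {p : E3}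
    {f : Set E3 → ℝ} (hf : ∀ X ∈ F, HasAngle X p (f X)) {ε : ℝ} (hε : 0 < ε) :
    ∃ r, 0 < r ∧ r ≤ ε ∧ volume ((⋃ X ∈ F, X) ∩ ball p r) =
      ENNReal.ofReal ((∑ X ∈ F, f X) / (2 * Real.pi)) * volume (ball p r) := by
  have : ∃ δ > 0, ∀ X ∈ F, ∀ r, 0 < r → r ≤ δ →
      volume (X ∩ ball p r) = ENNReal.ofReal (f X / (2 * Real.pi)) * volume (ball p r) := by
    clear hF
    induction F using Finset.induction_on with
    | empty => exact ⟨1, one_pos, by simp⟩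
    | insert X F hXF ih =>
      obtain ⟨δ, hδ, h⟩ := ih fun Y hY => hf Y (Finset.mem_insert_of_mem hY)
      obtain ⟨_, δ', hδ', h'⟩ := hf X (Finset.mem_insert_self _ _)
      refine ⟨min δ δ', lt_min hδ hδ', fun Y hY r hr hr' => ?_⟩
      rcases Finset.mem_insert.mp hY with rfl | hY
      · exact h' r hr (hr'.trans (min_le_right _ _))
      · exact h Y hY r hr (hr'.trans (min_le_left _ _))
  obtain ⟨δ, hδ, h⟩ := this
  refine ⟨min δ ε, lt_min hδ hε, min_le_right _ _, ?_⟩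
  rw [hT.volume_inter_ball hF, Finset.sum_div,
    ENNReal.ofReal_sum_of_nonneg (fun X hX => div_nonneg (hf X hX).1 (by positivity)),
    Finset.sum_mul]
  exact Finset.sum_congr rfl fun X hX => h X hX _ (lt_min hδ hε) (min_le_left _ _)

lemma sum_angle_le (hT : S.IsTiling T) {F : Finset (Set E3)} (hF : ∀ X ∈ F, X ∈ T) {p : E3}
    {f : Set E3 → ℝ} (hf : ∀ X ∈ F, HasAngle X p (f X)) : ∑ X ∈ F, f X ≤ 2 * Real.pi := by
  obtain ⟨r, hr, -, h⟩ := hT.exists_sum_angle hF hf one_pos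
  have hb := (measure_ball_pos volume p hr).ne'
  have hb' : volume (ball p r) ≠ ⊤ := measure_ball_lt_top.ne
  have h1 : volume ((⋃ X ∈ F, X) ∩ ball p r) ≤ 1 * volume (ball p r) := by
    rw [one_mul]; exact measure_mono inter_subset_right
  rw [h, ENNReal.mul_le_mul_iff_left hb hb', ENNReal.ofReal_le_one] at h1
  have := Real.pi_pos
  rwa [div_le_one (by positivity)] at h1

/-- On a ball small enough for all the tiles involved, the angles measure the shares of the volume
of the ball. A complete star fills the ball; an incomplete one only gives the inequality of
`sum_angle_le`. -/
lemma sum_angle_eq (hT : S.IsTiling T) {F : Finset (Set E3)} (hF : ∀ X ∈ F, X ∈ T) {p : E3}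
    {f : Set E3 → ℝ} (hf : ∀ X ∈ F, HasAngle X p (f X)) {ε : ℝ} (hε : 0 < ε)
    (hc : ball p ε ⊆ ⋃ X ∈ F, X) : ∑ X ∈ F, f X = 2 * Real.pi := by
  obtain ⟨r, hr, hr', h⟩ := hT.exists_sum_angle hF hf hε
  have hb := (measure_ball_pos volume p hr).ne'
  have hb' : volume (ball p r) ≠ ⊤ := measure_ball_lt_top.ne
  rw [inter_eq_right.mpr ((ball_subset_ball hr').trans hc)] at h
  have h1 : 1 * volume (ball p r) = _ := (one_mul _).trans h
  rw [ENNReal.mul_left_inj hb hb', eq_comm, ENNReal.ofReal_eq_one] at h1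
  have := Real.pi_pos
  rwa [div_eq_one_iff_eq (by positivity)] at h1

end IsTiling

end Shape

/-! ### Angles of the prototile at points of facets and edges -/

open InnerProductGeometry

namespace Shape

variable (S : Shape)

/-- The outward normals of the facets. -/
noncomputable def nrm : Fin 8 → E3 :=
  ![-S.nS, S.nS, -S.nT, S.nT, S.nZ - S.nT, S.nZ + S.nT, -S.nZ - S.nS, -S.nZ + S.nS]

lemma facet_eq (i : Fin 8) (x : E3) : S.facet i x = ⟪S.nrm i, x⟫ := by
  fin_cases i <;>
    simp [facet, nrm, cs, ct, cz, inner_add_left, inner_sub_left, inner_neg_left]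

lemma nrm_ne (i : Fin 8) : S.nrm i ≠ 0 := by
  intro h
  obtain ⟨x, hx⟩ := S.facet_surjective i 1
  rw [facet_eq, h, inner_zero_left] at hx
  exact zero_ne_one hx

/-- The angle of the prototile at a point lying on one or two facets. -/
lemma hasAngle_tile {q : E3} {i j : Fin 8} (hi : S.facet i q = bound i) (hj : S.facet j q = bound j)
    (h : ∀ k, k ≠ i → k ≠ j → S.facet k q < bound k) (hang : angle (S.nrm i) (S.nrm j) < Real.pi) :
    HasAngle S.tile q (Real.pi - angle (S.nrm i) (S.nrm j)) := by
  refine ⟨by linarith, ?_⟩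
  have hopen : IsOpen {x : E3 | ∀ k, k ≠ i → k ≠ j → S.facet k x < bound k} := by
    have : {x : E3 | ∀ k, k ≠ i → k ≠ j → S.facet k x < bound k} =
        ⋂ k, {x : E3 | k ≠ i → k ≠ j → S.facet k x < bound k} := by ext x; simp
    rw [this]
    refine isOpen_iInter_of_finite fun k => ?_
    by_cases h1 : k = i
    · simp [h1]
    by_cases h2 : k = j
    · simp [h2]
    simp only [ne_eq, h1, h2, not_false_eq_true, true_implies]
    exact isOpen_lt (S.facet k).continuous continuous_const
  obtain ⟨ε, hε, hsub⟩ := Metric.isOpen_iff.mp hopen q h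
  refine ⟨ε, hε, fun r hr hr' => ?_⟩
  have hw := volume_wedge (neg_ne_zero.mpr (S.nrm_ne i)) (neg_ne_zero.mpr (S.nrm_ne j))
    (by rwa [angle_neg_neg]) q hr
  rw [angle_neg_neg] at hw
  rw [← hw]
  congr 1
  ext x
  have key : ∀ k, S.facet k q = bound k → (0 ≤ ⟪-S.nrm k, x - q⟫ ↔ S.facet k x ≤ bound k) := by
    intro k hk
    rw [inner_neg_left, inner_sub_right, ← facet_eq, ← facet_eq, hk]
    constructor <;> intro <;> linarith
  rw [tile_eq]
  simp only [mem_inter_iff, mem_ofPred_eq, key i hi, key j hj]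
  constructor
  · rintro ⟨h1, h2⟩
    exact ⟨h2, h1 i, h1 j⟩
  · rintro ⟨h1, h2, h3⟩
    refine ⟨fun k => ?_, h1⟩
    by_cases hki : k = i
    · rwa [hki]
    by_cases hkj : k = j
    · rwa [hkj]
    exact (hsub (ball_subset_ball hr' h1) k hki hkj).le

/-- A wedge with two equal normals degenerates to a half-space. -/
lemma hasAngle_face {q : E3} {i : Fin 8} (hi : S.facet i q = bound i)
    (h : ∀ k, k ≠ i → S.facet k q < bound k) : HasAngle S.tile q Real.pi := by
  have h0 : angle (S.nrm i) (S.nrm i) = 0 := angle_self (S.nrm_ne i)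
  have := S.hasAngle_tile hi hi (fun k hk _ => h k hk) (by rw [h0]; exact Real.pi_pos)
  rwa [h0, sub_zero] at this

/-! ### Angles of the equilateral prototile -/

/-- The upright triangular facets are equilateral. -/
def Equilateral : Prop := 3 * S.len ^ 2 = 4 * S.ht ^ 2

/-- Half the angle at a ridge of the equilateral prototile. -/
noncomputable def hr : ℝ := Real.arccos (√3 / √(4 - S.c ^ 2))

lemma cos_hr_aux : 0 < √3 / √(4 - S.c ^ 2) ∧ (√3 / √(4 - S.c ^ 2)) ^ 2 = 3 / (4 - S.c ^ 2) := by
  have h := S.c_sq_lt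
  have h1 : 0 < 4 - S.c ^ 2 := by linarith
  refine ⟨by positivity, ?_⟩
  rw [div_pow, Real.sq_sqrt (by norm_num), Real.sq_sqrt h1.le]

lemma cos_hr : Real.cos S.hr = √3 / √(4 - S.c ^ 2) := by
  obtain ⟨h1, h2⟩ := S.cos_hr_aux
  have h := S.c_sq_lt
  refine Real.cos_arccos (by linarith) ?_
  have : 3 / (4 - S.c ^ 2) < 1 := by rw [div_lt_one (by linarith)]; linarith
  nlinarith

lemma cos_hr_pos : 0 < Real.cos S.hr := by rw [cos_hr]; exact S.cos_hr_aux.1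

lemma cos_hr_sq : Real.cos S.hr ^ 2 = 3 / (4 - S.c ^ 2) := by rw [cos_hr]; exact S.cos_hr_aux.2

lemma cos_hr_sq' : Real.cos S.hr ^ 2 * (4 - S.c ^ 2) = 3 := by
  rw [cos_hr_sq]; have := S.c_sq_lt; field_simp [show (4 - S.c ^ 2) ≠ 0 by linarith]

lemma cos_hr_lt : Real.cos S.hr < 1 := by
  by_contra! h
  have : 1 ≤ Real.cos S.hr ^ 2 := one_le_pow₀ h
  nlinarith [S.cos_hr_sq', S.c_sq_lt]

lemma hr_pos : 0 < S.hr := by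
  rw [hr, Real.arccos_pos, ← cos_hr]; exact S.cos_hr_lt

/-- Since `cos hr ^ 2 = 3 / (4 - c ^ 2)` is at least `3 / 4`. The bound keeps the angles left over
in the later edge arguments below a straight angle. -/
lemma hr_le : S.hr ≤ Real.pi / 6 := by
  have h0 : S.hr ≤ Real.pi := Real.arccos_le_pi _
  have h : Real.cos (Real.pi / 6) ≤ Real.cos S.hr := by
    rw [Real.cos_pi_div_six]
    have := S.cos_hr_sq'
    have h3 : √3 ^ 2 = 3 := Real.sq_sqrt (by norm_num)
    have := S.cos_hr_pos
    have : (√3 / 2) ^ 2 ≤ Real.cos S.hr ^ 2 := by nlinarith [sq_nonneg (S.c * Real.cos S.hr)]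
    exact (sq_le_sq₀ (by positivity) (by positivity)).mp this
  exact (Real.strictAntiOn_cos.le_iff_ge ⟨by positivity, by linarith [Real.pi_pos]⟩
    ⟨S.hr_pos.le, h0⟩).mp h

/-- The angle at the slope edge of the facet `tri0` starting in `0`. -/
noncomputable def slope : ℝ := Real.arccos (S.c * Real.cos S.hr)

/-- The smaller one of the angles at the slope edges. -/
noncomputable def sml : ℝ := Real.arccos (|S.c| * Real.cos S.hr)

lemma abs_c_lt : |S.c| < 1 := abs_lt.mpr ⟨S.neg_c_lt, S.c_lt⟩

lemma cos_sml : Real.cos S.sml = |S.c| * Real.cos S.hr :=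
  Real.cos_arccos (by nlinarith [abs_nonneg S.c, S.cos_hr_pos])
    (by nlinarith [abs_nonneg S.c, S.cos_hr_pos, S.cos_hr_lt, S.abs_c_lt])

lemma sml_mem : S.sml ∈ Icc 0 Real.pi := ⟨Real.arccos_nonneg _, Real.arccos_le_pi _⟩

/-- After squaring, `|c| * cos hr < cos (2 * hr)` holds because the difference of the squares equals
`4 * (1 - c ^ 2) ^ 2 / (4 - c ^ 2) ^ 2`. Together with `sml_lt` this puts `sml` strictly between two
consecutive multiples of `hr`, so that ridges alone can never fill the gaps left by wrong gluings.
-/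
lemma two_hr_lt_sml : 2 * S.hr < S.sml := by
  refine (Real.strictAntiOn_cos.lt_iff_gt S.sml_mem
    ⟨by linarith [S.hr_pos], by linarith [S.hr_le, Real.pi_pos]⟩).mp ?_
  rw [cos_sml, Real.cos_two_mul]
  have h1 := S.cos_hr_sq'
  have h2 := S.abs_c_lt
  have h3 := abs_nonneg S.c
  rw [← sq_abs S.c] at h1
  set k := |S.c|
  set C := Real.cos S.hr
  have hC := S.cos_hr_pos
  have h5 : 0 < 2 * C ^ 2 - 1 := by nlinarith
  have h6 : (k * C) ^ 2 < (2 * C ^ 2 - 1) ^ 2 := by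
    have : C ^ 2 = 3 / (4 - k ^ 2) := by
      rw [eq_div_iff (by nlinarith)]; exact h1
    rw [mul_pow, this]
    have h7 : 0 < 4 - k ^ 2 := by nlinarith
    have h8 : (2 * (3 / (4 - k ^ 2)) - 1) ^ 2 - k ^ 2 * (3 / (4 - k ^ 2)) =
        4 * (1 - k ^ 2) ^ 2 / (4 - k ^ 2) ^ 2 := by
      field_simp; ring
    have h9 : 0 < 1 - k ^ 2 := by nlinarith
    have : 0 < 4 * (1 - k ^ 2) ^ 2 / (4 - k ^ 2) ^ 2 := by positivity
    linarith
  exact (sq_lt_sq₀ (by positivity) h5.le).mp h6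

/-- Dividing `|c| * cos hr > cos (3 * hr)` by `cos hr` leaves `4 * cos hr ^ 2 - 3 < |c|`. For `c =
0` the two angles coincide, both being a right angle; this is where the square has to be excluded.
-/
lemma sml_lt (hc : S.c ≠ 0) : S.sml < 3 * S.hr := by
  refine (Real.strictAntiOn_cos.lt_iff_gt
    ⟨by linarith [S.hr_pos], by linarith [S.hr_le, Real.pi_pos]⟩ S.sml_mem).mp ?_
  rw [cos_sml, Real.cos_three_mul]
  have h1 := S.cos_hr_sq'
  have h2 := S.abs_c_lt
  have h3 := abs_pos.mpr hc
  rw [← sq_abs S.c] at h1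
  set k := |S.c|
  set C := Real.cos S.hr
  have hC := S.cos_hr_pos
  have h4 : 4 * C ^ 2 - 3 < k := by
    have : C ^ 2 = 3 / (4 - k ^ 2) := by
      rw [eq_div_iff (by nlinarith)]; exact h1
    have h7 : 0 < 4 - k ^ 2 := by nlinarith
    have h8 : k - (4 * (3 / (4 - k ^ 2)) - 3) = k * (1 - k) * (k + 4) / (4 - k ^ 2) := by
      field_simp; ring
    have h9 : 0 < 1 - k := by linarith
    have : 0 < k * (1 - k) * (k + 4) / (4 - k ^ 2) := by positivity
    linarith
  nlinarith

lemma slope_cases : (0 < S.c → S.slope = S.sml) ∧ (S.c < 0 → S.slope = Real.pi - S.sml) := by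
  constructor
  · intro h; rw [slope, sml, abs_of_pos h]
  · intro h; rw [slope, sml, abs_of_neg h, ← Real.arccos_neg]; congr 1; ring

lemma inner_nrm : ⟪S.nS, S.nS⟫ = 1 / (S.len ^ 2 * (1 - S.c ^ 2)) ∧
    ⟪S.nT, S.nT⟫ = 1 / (S.len ^ 2 * (1 - S.c ^ 2)) ∧
    ⟪S.nS, S.nT⟫ = -S.c / (S.len ^ 2 * (1 - S.c ^ 2)) ∧ ⟪S.nZ, S.nZ⟫ = 1 / (4 * S.ht ^ 2) ∧
    ⟪S.nS, S.nZ⟫ = 0 ∧ ⟪S.nT, S.nZ⟫ = 0 := by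
  have h1 := S.len_ne
  have h2 := S.ht_ne
  have h3 := S.sin_pos.ne'
  rw [← sin_sq]
  simp only [inner_eq_sum, nS, nT, nZ, c]
  refine ⟨?_, ?_, ?_, ?_, ?_, ?_⟩ <;> simp <;> field_simp
  · rw [Real.sin_sq]; ring
  · norm_num

section Equilateral

variable {S}

lemma Equilateral.inner_nZ (hS : S.Equilateral) :
    ⟪S.nZ, S.nZ⟫ = (1 - S.c ^ 2) / 3 * ⟪S.nS, S.nS⟫ := by
  obtain ⟨h1, -, -, h4, -, -⟩ := S.inner_nrm
  have hc := S.c_sq_lt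
  have h5 : (1 - S.c ^ 2) ≠ 0 := by linarith
  have h6 := S.len_ne
  rw [h1, h4, ← hS]
  field_simp

lemma inner_nS_pos : 0 < ⟪S.nS, S.nS⟫ := by
  have hc := S.c_sq_lt
  have h5 : 0 < (1 - S.c ^ 2) := by linarith
  have := S.len_pos
  rw [S.inner_nrm.1]; positivity

lemma inner_nT : ⟪S.nT, S.nT⟫ = ⟪S.nS, S.nS⟫ := by rw [S.inner_nrm.1, S.inner_nrm.2.1]

lemma inner_nST : ⟪S.nS, S.nT⟫ = -S.c * ⟪S.nS, S.nS⟫ := by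
  rw [S.inner_nrm.1, S.inner_nrm.2.2.1]; ring

/-- For equilateral facets the normals have only two lengths, one for the upright facets and one for
the roofs, and the quotient of these lengths is `cos hr`. All angles between an upright facet and a
roof are therefore of this form. -/
lemma angle_of_inner {x y : E3} {k : ℝ} (hx : ⟪x, x⟫ = ⟪S.nS, S.nS⟫)
    (hy : ⟪y, y⟫ = (4 - S.c ^ 2) / 3 * ⟪S.nS, S.nS⟫) (hxy : ⟪x, y⟫ = k * ⟪S.nS, S.nS⟫) :
    angle x y = Real.arccos (k * Real.cos S.hr) := by
  have hp : 0 < ⟪S.nS, S.nS⟫ := S.inner_nS_pos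
  have h1 := S.cos_hr_sq'
  have hC := S.cos_hr_pos
  have hx' : ‖x‖ ^ 2 = ⟪S.nS, S.nS⟫ := by rw [← real_inner_self_eq_norm_sq, hx]
  have hy' : ‖y‖ ^ 2 = (4 - S.c ^ 2) / 3 * ⟪S.nS, S.nS⟫ := by
    rw [← real_inner_self_eq_norm_sq, hy]
  have h2 : ‖x‖ ^ 2 = (‖y‖ * Real.cos S.hr) ^ 2 := by
    rw [mul_pow, hx', hy']
    linear_combination (-⟪S.nS, S.nS⟫ / 3) * h1
  have h3 : ‖x‖ = ‖y‖ * Real.cos S.hr :=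
    (sq_eq_sq₀ (norm_nonneg _) (by positivity)).mp h2
  have hy0 : ‖y‖ ≠ 0 := by
    intro h
    rw [h3, h, zero_mul, zero_pow two_ne_zero] at hx'
    exact hp.ne hx'
  rw [angle]
  congr 1
  rw [hxy, ← hx', h3]
  field_simp

lemma Equilateral.angle_base (hS : S.Equilateral) : angle (S.nrm 0) (S.nrm 6) = S.hr := by
  have h1 : Real.arccos (1 * Real.cos S.hr) = S.hr := by
    rw [one_mul, Real.arccos_cos S.hr_pos.le (by linarith [S.hr_le, Real.pi_pos])]
  rw [← h1]
  obtain ⟨-, -, -, -, h5, h6⟩ := S.inner_nrm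
  have h7 : ⟪S.nZ, S.nS⟫ = 0 := by rw [real_inner_comm, h5]
  refine angle_of_inner ?_ ?_ ?_ <;>
    simp only [nrm, Matrix.cons_val, inner_neg_left, inner_neg_right, inner_sub_left,
      inner_sub_right, h5, h7,
      hS.inner_nZ] <;> ring

lemma Equilateral.angle_slope (hS : S.Equilateral) :
    angle (S.nrm 0) (S.nrm 4) = Real.pi - S.slope := by
  rw [slope, ← Real.arccos_neg, ← neg_mul]
  obtain ⟨-, -, -, -, h5, h6⟩ := S.inner_nrm
  have h7 : ⟪S.nZ, S.nT⟫ = 0 := by rw [real_inner_comm, h6]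
  refine angle_of_inner ?_ ?_ ?_ <;>
    simp only [nrm, Matrix.cons_val, inner_neg_left, inner_neg_right, inner_sub_left,
      inner_sub_right, h5, h6, h7,
      hS.inner_nZ, inner_nT, inner_nST] <;> ring

lemma Equilateral.angle_slope' (hS : S.Equilateral) : angle (S.nrm 0) (S.nrm 5) = S.slope := by
  rw [slope]
  obtain ⟨-, -, -, -, h5, h6⟩ := S.inner_nrm
  have h7 : ⟪S.nZ, S.nT⟫ = 0 := by rw [real_inner_comm, h6]
  refine angle_of_inner ?_ ?_ ?_ <;>
    simp only [nrm, Matrix.cons_val, inner_neg_left, inner_neg_right, inner_add_left,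
      inner_add_right, h5, h6, h7,
      hS.inner_nZ, inner_nT, inner_nST] <;> ring

lemma Equilateral.angle_ridge (hS : S.Equilateral) :
    angle (S.nrm 4) (S.nrm 5) = Real.pi - 2 * S.hr := by
  obtain ⟨-, -, -, -, h5, h6⟩ := S.inner_nrm
  have h7 : ⟪S.nZ, S.nT⟫ = 0 := by rw [real_inner_comm, h6]
  have hp : 0 < ⟪S.nS, S.nS⟫ := S.inner_nS_pos
  have hc := S.c_sq_lt
  have e4 : ⟪S.nrm 4, S.nrm 4⟫ = (4 - S.c ^ 2) / 3 * ⟪S.nS, S.nS⟫ := by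
    simp only [nrm, Matrix.cons_val, inner_sub_left, inner_sub_right, h6, h7, hS.inner_nZ, inner_nT]
    ring
  have e5 : ⟪S.nrm 5, S.nrm 5⟫ = (4 - S.c ^ 2) / 3 * ⟪S.nS, S.nS⟫ := by
    simp only [nrm, Matrix.cons_val, inner_add_left, inner_add_right, h6, h7, hS.inner_nZ, inner_nT]
    ring
  have e45 : ⟪S.nrm 4, S.nrm 5⟫ = ((1 - S.c ^ 2) / 3 - 1) * ⟪S.nS, S.nS⟫ := by
    simp only [nrm, Matrix.cons_val, inner_sub_left, inner_add_right, h6, h7, hS.inner_nZ, inner_nT]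
    ring
  have hn : ‖S.nrm 4‖ = ‖S.nrm 5‖ := by
    rw [← sq_eq_sq₀ (norm_nonneg _) (norm_nonneg _), ← real_inner_self_eq_norm_sq, e4, ← e5,
      real_inner_self_eq_norm_sq]
  rw [angle, ← hn, ← real_inner_self_eq_norm_mul_norm, e4, e45,
    ← Real.arccos_cos (x := Real.pi - 2 * S.hr) (by linarith [S.hr_le, Real.pi_pos])
      (by linarith [S.hr_pos]), Real.cos_pi_sub, Real.cos_two_mul, S.cos_hr_sq]
  congr 1
  have h8 : 4 - S.c ^ 2 ≠ 0 := by linarith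
  field_simp
  ring

lemma Equilateral.hasAngle_base (hS : S.Equilateral) {t : ℝ} (h0 : 0 < t) (h1 : t < 1) :
    HasAngle S.tile (S.pt 0 t 0) (Real.pi - S.hr) := by
  rw [← hS.angle_base]
  refine S.hasAngle_tile ?_ ?_ ?_ ?_
  · simp [facet, bound]
  · simp [facet, bound]
  · intro k hk hk'
    fin_cases k <;> simp [facet, bound] at hk hk' ⊢ <;> linarith
  · rw [hS.angle_base]; linarith [S.hr_le, Real.pi_pos]

lemma Equilateral.hasAngle_slope (hS : S.Equilateral) {t : ℝ} (h0 : 0 < t) (h1 : t < 1 / 2) :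
    HasAngle S.tile (S.pt 0 t t) S.slope := by
  have h := hS.angle_slope
  have hs : 0 < S.slope := by
    rcases eq_or_ne S.slope 0 with h2 | h2
    · rw [slope, Real.arccos_eq_zero] at h2
      nlinarith [S.c_lt, S.cos_hr_lt, S.cos_hr_pos]
    · exact lt_of_le_of_ne (Real.arccos_nonneg _) h2.symm
  have h3 : S.slope = Real.pi - angle (S.nrm 0) (S.nrm 4) := by rw [h]; ring
  rw [h3]
  refine S.hasAngle_tile ?_ ?_ ?_ ?_
  · simp [facet, bound]
  · simp [facet, bound]
  · intro k hk hk'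
    fin_cases k <;> simp [facet, bound] at hk hk' ⊢ <;> linarith
  · rw [h]; linarith

lemma Equilateral.hasAngle_slope' (hS : S.Equilateral) {t : ℝ} (h0 : 0 < t) (h1 : t < 1 / 2) :
    HasAngle S.tile (S.pt 0 (1 - t) t) (Real.pi - S.slope) := by
  have h := hS.angle_slope'
  rw [← h]
  refine S.hasAngle_tile ?_ ?_ ?_ ?_
  · simp [facet, bound]
  · simp [facet, bound]
  · intro k hk hk'
    fin_cases k <;> simp [facet, bound] at hk hk' ⊢ <;> linarith
  · rw [h]
    rcases eq_or_ne S.slope Real.pi with h2 | h2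
    · rw [slope, Real.arccos_eq_pi] at h2
      nlinarith [S.neg_c_lt, S.cos_hr_lt, S.cos_hr_pos]
    · exact lt_of_le_of_ne (Real.arccos_le_pi _) h2

lemma Equilateral.hasAngle_ridge (hS : S.Equilateral) {s : ℝ} (h0 : 0 < s) (h1 : s < 1) :
    HasAngle S.tile (S.pt s (1 / 2) (1 / 2)) (2 * S.hr) := by
  have h := hS.angle_ridge
  have h3 : 2 * S.hr = Real.pi - angle (S.nrm 4) (S.nrm 5) := by rw [h]; ring
  rw [h3]
  refine S.hasAngle_tile ?_ ?_ ?_ ?_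
  · simp [facet, bound]
  · simp [facet, bound]; norm_num
  · intro k hk hk'
    fin_cases k <;> simp [facet, bound] at hk hk' ⊢ <;> linarith
  · rw [h]; linarith [S.hr_pos]

end Equilateral

end Shape

namespace Shape

variable (S : Shape)

/-! ### Motions preserving an upright triangular facet -/

/-- The upper vertex of the facet `tri0`. -/
noncomputable def apex : E3 := S.pt 0 (1 / 2) (1 / 2)

lemma mem_tri0 {x : E3} : x ∈ S.tri0 ↔
    S.cs x = 0 ∧ 0 ≤ S.cz x ∧ S.cz x ≤ S.ct x ∧ S.cz x ≤ 1 - S.ct x := by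
  constructor
  · intro hx
    have hconv : Convex ℝ {x : E3 | S.cs x = 0 ∧ 0 ≤ S.cz x ∧ S.cz x ≤ S.ct x ∧
        S.cz x ≤ 1 - S.ct x} := by
      rintro x ⟨h1, h2, h3, h4⟩ y ⟨k1, k2, k3, k4⟩ u v hu hv huv
      simp only [mem_ofPred_eq, map_add, map_smul, smul_eq_mul]
      refine ⟨by rw [h1, k1]; ring, by positivity, by nlinarith, ?_⟩
      have : (1 : ℝ) = u + v := huv.symm
      nlinarith
    refine convexHull_min ?_ hconv hx
    rintro y (rfl | rfl | rfl) <;> (simp; try norm_num)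
  · rintro ⟨h1, h2, h3, h4⟩
    have k := triangle_combo (convex_convexHull ℝ {0, S.b, S.pt 0 (1 / 2) (1 / 2)})
      (subset_convexHull ℝ _ (mem_insert _ _))
      (subset_convexHull ℝ _ (mem_insert_of_mem _ (mem_insert _ _)))
      (subset_convexHull ℝ _ (mem_insert_of_mem _ (mem_insert_of_mem _ (mem_singleton _))))
      (p := 1 - S.ct x - S.cz x) (q := S.ct x - S.cz x) (r := 2 * S.cz x) (by linarith)
      (by linarith) (by linarith) (by ring)
    have h5 : x = (1 - S.ct x - S.cz x) • (0 : E3) + (S.ct x - S.cz x) • S.b +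
        (2 * S.cz x) • S.pt 0 (1 / 2) (1 / 2) := by
      apply S.ext_coord <;> simp [h1] <;> ring
    rw [h5]; exact k

lemma tri0_subset_tile : S.tri0 ⊆ S.tile := by
  intro x hx
  obtain ⟨h1, h2, h3, h4⟩ := S.mem_tri0.mp hx
  rw [mem_tile, h1]
  refine ⟨⟨le_rfl, zero_le_one⟩, ⟨by linarith, by linarith⟩, ⟨h3, h4⟩, by linarith, by linarith⟩

lemma extremePoints_tri0 : S.tri0.extremePoints ℝ = {0, S.b, S.apex} := by
  apply Subset.antisymm extremePoints_convexHull_subset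
  have comb : ∀ x y z : E3, x ∈ openSegment ℝ y z → ∃ u v : ℝ, 0 < u ∧ 0 < v ∧ u + v = 1 ∧
      S.ct x = u * S.ct y + v * S.ct z ∧ S.cz x = u * S.cz y + v * S.cz z := by
    rintro x y z ⟨u, v, hu, hv, huv, rfl⟩
    exact ⟨u, v, hu, hv, huv, by simp, by simp⟩
  rintro x (rfl | rfl | rfl)
  · refine ⟨S.mem_tri0.mpr (by simp), ?_⟩
    intro y hy z hz h
    obtain ⟨u, v, hu, hv, huv, h1, h2⟩ := comb _ _ _ h
    obtain ⟨a1, a2, a3, a4⟩ := S.mem_tri0.mp hy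
    obtain ⟨b1, b2, b3, b4⟩ := S.mem_tri0.mp hz
    simp only [map_zero] at h1 h2
    have k1 : S.ct y = 0 := by nlinarith
    apply S.ext_coord <;> simp [a1, k1]; linarith
  · refine ⟨S.mem_tri0.mpr (by simp), ?_⟩
    intro y hy z hz h
    obtain ⟨u, v, hu, hv, huv, h1, h2⟩ := comb _ _ _ h
    obtain ⟨a1, a2, a3, a4⟩ := S.mem_tri0.mp hy
    obtain ⟨b1, b2, b3, b4⟩ := S.mem_tri0.mp hz
    simp only [ct_b, cz_b] at h1 h2
    have k1 : S.ct y = 1 := by nlinarith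
    apply S.ext_coord <;> simp [a1, k1]; linarith
  · refine ⟨S.mem_tri0.mpr (by simp; norm_num), ?_⟩
    intro y hy z hz h
    obtain ⟨u, v, hu, hv, huv, h1, h2⟩ := comb _ _ _ h
    obtain ⟨a1, a2, a3, a4⟩ := S.mem_tri0.mp hy
    obtain ⟨b1, b2, b3, b4⟩ := S.mem_tri0.mp hz
    simp only [ct_pt, cz_pt] at h1 h2
    have k1 : S.cz y = 1 / 2 := by nlinarith
    apply S.ext_coord <;> simp [a1, k1]; linarith

lemma b_ne_apex : S.b ≠ S.apex := fun h => by
  have := congrArg S.cz h; simp [apex] at this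

lemma apex_ne : S.apex ≠ 0 := fun h => by
  have := congrArg S.cz h; simp [apex] at this

/-- A motion preserving the facet `tri0` permutes its vertices. -/
lemma tri0_cases {g : E3 ≃ᵃⁱ[ℝ] E3} (h : g '' S.tri0 = S.tri0) :
    (g 0 = 0 ∧ g S.b = S.b ∧ g S.apex = S.apex) ∨ (g 0 = S.b ∧ g S.b = 0 ∧ g S.apex = S.apex) ∨
    (g 0 = 0 ∧ g S.b = S.apex ∧ g S.apex = S.b) ∨ (g 0 = S.apex ∧ g S.b = S.b ∧ g S.apex = 0) ∨
    (g 0 = S.b ∧ g S.b = S.apex ∧ g S.apex = 0) ∨ (g 0 = S.apex ∧ g S.b = 0 ∧ g S.apex = S.b) := by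
  have key : ∀ x ∈ ({0, S.b, S.apex} : Set E3), g x ∈ ({0, S.b, S.apex} : Set E3) := by
    rw [← extremePoints_tri0]; exact fun x hx => map_mem_extremePoints h hx
  have h0 := key 0 (by simp)
  have h1 := key S.b (by simp)
  have h2 := key S.apex (by simp)
  have n0 : g 0 ≠ g S.b := g.injective.ne S.b_ne.symm
  have n1 : g 0 ≠ g S.apex := g.injective.ne S.apex_ne.symm
  have n2 : g S.b ≠ g S.apex := g.injective.ne S.b_ne_apex
  simp only [mem_insert_iff, mem_singleton_iff] at h0 h1 h2
  rcases h0 with h0 | h0 | h0 <;> rcases h1 with h1 | h1 | h1 <;> rcases h2 with h2 | h2 | h2 <;>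
    simp_all

/-- The centroid of the facet `tri0`. -/
noncomputable def cen : E3 := S.pt 0 (1 / 2) (1 / 6)

/-- An affine map that permutes the vertices fixes their barycentre. In this way the centroid
identifies a facet without following its individual vertices. -/
lemma map_cen {g : E3 ≃ᵃⁱ[ℝ] E3} (h : g '' S.tri0 = S.tri0) : g S.cen = S.cen := by
  have e : ∀ g : E3 ≃ᵃⁱ[ℝ] E3, g S.cen = (1 / 3 : ℝ) • (g 0 + g S.b + g S.apex) := by
    intro g
    have h1 : S.cen = (1 / 3 : ℝ) • S.b + (1 / 3 : ℝ) • S.apex := by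
      apply S.ext_coord <;> simp [cen, apex] <;> norm_num
    rw [map_eq_lin g, map_eq_lin g S.b, map_eq_lin g S.apex, h1, map_add, map_smul, map_smul]
    module
  have h1 : S.cen = (1 / 3 : ℝ) • (0 + S.b + S.apex) := e 1
  rw [e, h1]
  congr 1
  rcases S.tri0_cases h with ⟨h0, h1, h2⟩ | ⟨h0, h1, h2⟩ | ⟨h0, h1, h2⟩ | ⟨h0, h1, h2⟩ |
    ⟨h0, h1, h2⟩ | ⟨h0, h1, h2⟩ <;> rw [h0, h1, h2] <;> abel

lemma eq_of_eq_on_vertices {g g' : E3 ≃ᵃⁱ[ℝ] E3} (hg : g ∈ motions) (hg' : g' ∈ motions)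
    (h0 : g 0 = g' 0) (hb : g S.b = g' S.b) (hc : g S.apex = g' S.apex) : g = g' := by
  have : g'⁻¹ * g = 1 := by
    apply S.motion_eq_one (mul_mem (inv_mem hg') hg)
    · change g'⁻¹ (g 0) = 0
      rw [h0, inv_apply_apply]
    · change g'⁻¹ (g S.b) = S.b
      rw [hb, inv_apply_apply]
    · change g'⁻¹ (g S.apex) = S.apex
      rw [hc, inv_apply_apply]
  exact (inv_mul_eq_one.mp this).symm

/-- The half-turn of the facet `tri0` fixing its upper vertex. -/
noncomputable def turnTop : E3 ≃ᵃⁱ[ℝ] E3 := tr (-S.a) * S.turnV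

lemma turnTop_mem : S.turnTop ∈ motions := mul_mem (tr_mem _) S.turnV_mem

lemma turnTop_pt (s t z : ℝ) : S.turnTop (S.pt s t z) = S.pt (-s) (1 - t) z := by
  change -S.a + S.turnV (S.pt s t z) = _
  rw [turnV_pt, ← S.pt_a]
  apply S.ext_coord <;> simp; ring

/-- The half-turn of the facet `tri0` fixing `0`. -/
noncomputable def turnZero : E3 ≃ᵃⁱ[ℝ] E3 := halfTurn 0 (S.b + S.apex)

/-- The half-turn of the facet `tri0` fixing the end point of `b`. -/
noncomputable def turnEnd : E3 ≃ᵃⁱ[ℝ] E3 := halfTurn S.b (S.apex - 2 • S.b)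

lemma b_add_apex : S.b + S.apex = S.pt 0 (3 / 2) (1 / 2) := by
  apply S.ext_coord <;> simp [apex]; norm_num

lemma apex_sub_b : S.apex - 2 • S.b = S.pt 0 (-(3 / 2)) (1 / 2) := by
  apply S.ext_coord <;> simp [apex]; norm_num

lemma turnZero_mem : S.turnZero ∈ motions := halfTurn_mem _ (by
  rw [b_add_apex]; intro h; have := congrArg S.cz h; simp at this)

lemma turnEnd_mem : S.turnEnd ∈ motions := halfTurn_mem _ (by
  rw [apex_sub_b]; intro h; have := congrArg S.cz h; simp at this)

section

variable {S}

lemma Equilateral.turnZero_pt (hS : S.Equilateral) (t z : ℝ) :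
    S.turnZero (S.pt 0 t z) = S.pt 0 ((t + 3 * z) / 2) ((t - z) / 2) := by
  have h := S.len_ne
  rw [turnZero, b_add_apex, ← S.pt_zero, halfTurn_pt, inner_pt, norm_sq_pt, ← hS]
  have : 2 * ((S.len ^ 2 * (0 * (0 - 0) + 3 / 2 * (t - 0) + S.c * (0 * (t - 0) + 3 / 2 * (0 - 0))) +
      3 * S.len ^ 2 * (1 / 2 * (z - 0))) / (S.len ^ 2 * (0 ^ 2 + (3 / 2) ^ 2 +
      2 * S.c * (0 * (3 / 2))) + 3 * S.len ^ 2 * (1 / 2) ^ 2)) = t + z := by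
    field_simp; ring
  rw [this]
  apply S.ext_coord <;> simp <;> ring

lemma Equilateral.turnEnd_pt (hS : S.Equilateral) (t z : ℝ) :
    S.turnEnd (S.pt 0 t z) = S.pt 0 (1 - (1 - t + 3 * z) / 2) ((1 - t - z) / 2) := by
  have h := S.len_ne
  rw [turnEnd, apex_sub_b, ← S.pt_b, halfTurn_pt, inner_pt, norm_sq_pt, ← hS]
  have : 2 * ((S.len ^ 2 * (0 * (0 - 0) + -(3 / 2) * (t - 1) + S.c * (0 * (t - 1) +
      -(3 / 2) * (0 - 0))) + 3 * S.len ^ 2 * (1 / 2 * (z - 0))) /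
      (S.len ^ 2 * (0 ^ 2 + (-(3 / 2)) ^ 2 +
      2 * S.c * (0 * -(3 / 2))) + 3 * S.len ^ 2 * (1 / 2) ^ 2)) = 1 - t + z := by
    field_simp; ring
  rw [this]
  apply S.ext_coord <;> simp <;> ring

/-- The motions preserving the facet `tri0`. -/
lemma motion_tri0_cases {g : E3 ≃ᵃⁱ[ℝ] E3} (hg : g ∈ motions) (h : g '' S.tri0 = S.tri0) :
    g = 1 ∨ g = S.turnTop ∨ S.Equilateral ∧ (g = S.turnZero ∨ g = S.turnEnd ∨
      g = S.turnZero * S.turnTop ∨ g = S.turnTop * S.turnZero) := by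
  have d1 : dist 0 S.b ^ 2 = S.len ^ 2 := by
    rw [dist_zero_left, ← S.pt_b, norm_sq_pt]; ring
  have d2 : dist 0 S.apex ^ 2 = S.len ^ 2 / 4 + S.ht ^ 2 := by
    rw [dist_zero_left, apex, norm_sq_pt]; ring
  have d3 : dist S.b S.apex ^ 2 = S.len ^ 2 / 4 + S.ht ^ 2 := by
    rw [dist_eq_norm, apex, ← S.pt_b, pt_sub, norm_sq_pt]; ring
  have d4 : dist (g 0) (g S.b) = dist 0 S.b := g.dist_map _ _
  have t0 : S.turnTop 0 = S.b := by
    rw [← S.pt_zero, turnTop_pt, ← S.pt_b]; norm_num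
  have t1 : S.turnTop S.b = 0 := by
    rw [← S.pt_zero, ← S.pt_b, turnTop_pt]; norm_num
  have t2 : S.turnTop S.apex = S.apex := by
    rw [apex, turnTop_pt]; norm_num
  have z0 : S.Equilateral → S.turnZero 0 = 0 := fun hS => by
    rw [← S.pt_zero, hS.turnZero_pt]; norm_num
  have z1 : S.Equilateral → S.turnZero S.b = S.apex := fun hS => by
    rw [← S.pt_b, hS.turnZero_pt, apex]; norm_num
  have z2 : S.Equilateral → S.turnZero S.apex = S.b := fun hS => by
    rw [← S.pt_b, apex, hS.turnZero_pt]; norm_num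
  have e0 : S.Equilateral → S.turnEnd 0 = S.apex := fun hS => by
    rw [← S.pt_zero, hS.turnEnd_pt, apex]; norm_num
  have e1 : S.Equilateral → S.turnEnd S.b = S.b := fun hS => by
    rw [← S.pt_b, hS.turnEnd_pt]; norm_num
  have e2 : S.Equilateral → S.turnEnd S.apex = 0 := fun hS => by
    rw [← S.pt_zero, apex, hS.turnEnd_pt]; norm_num
  have hm := mul_mem S.turnZero_mem S.turnTop_mem
  have hm' := mul_mem S.turnTop_mem S.turnZero_mem
  rcases S.tri0_cases h with ⟨h0, h1, h2⟩ | ⟨h0, h1, h2⟩ | ⟨h0, h1, h2⟩ | ⟨h0, h1, h2⟩ |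
    ⟨h0, h1, h2⟩ | ⟨h0, h1, h2⟩
  · exact Or.inl (S.motion_eq_one hg h0 h1 h2)
  · refine Or.inr (Or.inl (S.eq_of_eq_on_vertices hg S.turnTop_mem ?_ ?_ ?_))
    · rw [h0, t0]
    · rw [h1, t1]
    · rw [h2, t2]
  -- The remaining permutations do not fix the upper vertex, so they carry the base edge to a slope
  -- edge, or the other way round; equality of these lengths is the equilateral condition.
  all_goals
    have hS : S.Equilateral := by
      rw [h0, h1] at d4
      unfold Equilateral
      first
        | rw [dist_comm] at d4; rw [d4] at d2; linarith
        | rw [d4] at d2; linarith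
        | rw [d4] at d3; linarith
        | rw [dist_comm] at d4; rw [d4] at d3; linarith
    refine Or.inr (Or.inr ⟨hS, ?_⟩)
    specialize z0 hS; specialize z1 hS; specialize z2 hS
    specialize e0 hS; specialize e1 hS; specialize e2 hS
  · refine Or.inl (S.eq_of_eq_on_vertices hg S.turnZero_mem ?_ ?_ ?_)
    · rw [h0, z0]
    · rw [h1, z1]
    · rw [h2, z2]
  · refine Or.inr (Or.inl (S.eq_of_eq_on_vertices hg S.turnEnd_mem ?_ ?_ ?_))
    · rw [h0, e0]
    · rw [h1, e1]
    · rw [h2, e2]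
  · refine Or.inr (Or.inr (Or.inr (S.eq_of_eq_on_vertices hg hm' ?_ ?_ ?_)))
    · change g 0 = S.turnTop (S.turnZero 0)
      rw [h0, z0, t0]
    · change g S.b = S.turnTop (S.turnZero S.b)
      rw [h1, z1, t2]
    · change g S.apex = S.turnTop (S.turnZero S.apex)
      rw [h2, z2, t1]
  · refine Or.inr (Or.inr (Or.inl (S.eq_of_eq_on_vertices hg hm ?_ ?_ ?_)))
    · change g 0 = S.turnZero (S.turnTop 0)
      rw [h0, t0, z1]
    · change g S.b = S.turnZero (S.turnTop S.b)
      rw [h1, t1, z0]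
    · change g S.apex = S.turnZero (S.turnTop S.apex)
      rw [h2, t2, z2]

/-- Half-turns about axes in the plane of the facet lead to its other side. Products of two of them,
the rotations of order three, keep the side and are therefore no candidates for a neighbour. -/
lemma lin_turnTop_nS : lin S.turnTop S.nS = -S.nS := by
  have h1 : lin S.turnTop = (ℝ ∙ S.e).reflection := by
    rw [turnTop, lin_mul, lin_tr, one_mul, turnV, lin_halfTurn]
  rw [h1, Submodule.reflection_singleton_apply, real_inner_comm]
  have : ⟪S.nS, S.e⟫ = 0 := S.cs_e
  rw [this]; simp

lemma lin_turnZero_nS : lin S.turnZero S.nS = -S.nS := by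
  rw [turnZero, lin_halfTurn, Submodule.reflection_singleton_apply, real_inner_comm]
  have : ⟪S.nS, S.b + S.apex⟫ = 0 := by
    rw [b_add_apex]; exact S.cs_pt _ _ _
  rw [this]; simp

/-- A motion fixing the centroid and the normal of a facet does not lead to a neighbour. -/
lemma IsTiling.eq_of_fix {T : Set (Set E3)} (hT : S.IsTiling T) (h1 : S.tile ∈ T)
    {g : E3 ≃ᵃⁱ[ℝ] E3} (hg : g '' S.tile ∈ T) (hc : g S.cen = S.cen) (hn : lin g S.nS = S.nS) :
    g '' S.tile = S.tile := by
  have hp : 0 < ⟪S.nS, S.nS⟫ := S.inner_nS_pos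
  -- Points slightly inside the tile on the normal through the centroid are fixed by `g`, hence
  -- interior to both the tile and its image.
  have hev : ∀ᶠ ε in 𝓝[>] (0 : ℝ), S.cen + ε • S.nS ∈ interior S.tile := by
    have hcont : ∀ f : E3 →L[ℝ] ℝ, ContinuousAt (fun ε : ℝ => f (S.cen + ε • S.nS)) 0 := by
      intro f; fun_prop
    have lt : ∀ (f : E3 →L[ℝ] ℝ) (r : ℝ), f S.cen < r →
        ∀ᶠ ε in 𝓝[>] (0 : ℝ), f (S.cen + ε • S.nS) < r := by
      intro f r hr
      refine ((hcont f).eventually_lt_const (by simpa using hr)).filter_mono nhdsWithin_le_nhds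
    have l1 := lt S.cs 1 (by simp [cen])
    have l2 := lt (-S.ct) 0 (by simp [cen])
    have l3 := lt S.ct 1 (by simp [cen]; norm_num)
    have l4 := lt (S.cz - S.ct) 0 (by simp [cen]; norm_num)
    have l5 := lt (S.cz + S.ct) 1 (by simp [cen]; norm_num)
    have l6 := lt (-S.cz - S.cs) 0 (by simp [cen])
    have l7 := lt (-S.cz + S.cs) 1 (by simp [cen]; norm_num)
    filter_upwards [l1, l2, l3, l4, l5, l6, l7, self_mem_nhdsWithin] with ε k1 k2 k3 k4 k5 k6 k7 k8
    have k0 : 0 < S.cs (S.cen + ε • S.nS) := by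
      rw [map_add, map_smul]
      have e1 : S.cs S.cen = 0 := by simp [cen]
      have e2 : S.cs S.nS = ⟪S.nS, S.nS⟫ := rfl
      rw [e1, e2, zero_add, smul_eq_mul]
      exact mul_pos k8 hp
    rw [mem_interior_tile]
    simp only [neg_apply, sub_apply, add_apply] at k2 k4 k5 k6 k7
    refine ⟨⟨k0, k1⟩, ⟨by linarith, k3⟩, ⟨by linarith, by linarith⟩, by linarith, by linarith⟩
  obtain ⟨ε, hε⟩ := hev.exists
  have h2 : g (S.cen + ε • S.nS) = S.cen + ε • S.nS := by
    rw [map_add_lin, hc, map_smul, hn]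
  have h3 : S.cen + ε • S.nS ∈ interior (g '' S.tile) := by
    rw [interior_image, ← h2]; exact mem_image_of_mem g hε
  exact hT.eq_of_inter hg h1 h3 (interior_subset hε)

/-- The neighbours across the facet `tri0`. -/
lemma IsTiling.neighbor_cases {T : Set (Set E3)} (hT : S.IsTiling T) (h1 : S.tile ∈ T)
    {g : E3 ≃ᵃⁱ[ℝ] E3} (hm : g ∈ motions) (hg : g '' S.tile ∈ T) (hne : g '' S.tile ≠ S.tile)
    (h : g '' S.tri0 = S.tri0) :
    g = S.turnTop ∨ S.Equilateral ∧ (g = S.turnZero ∨ g = S.turnEnd) := by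
  rcases motion_tri0_cases hm h with rfl | h2 | ⟨hS, h2 | h2 | h2 | h2⟩
  · exact absurd (image_id _) hne
  · exact Or.inl h2
  · exact Or.inr ⟨hS, Or.inl h2⟩
  · exact Or.inr ⟨hS, Or.inr h2⟩
  -- The rotations of order three, written as products of two half-turns, fix the normal.
  all_goals
    refine absurd (hT.eq_of_fix h1 hg (S.map_cen h) ?_) hne
    rw [h2, lin_mul, LinearIsometryEquiv.coe_mul, Function.comp_apply]
    simp only [lin_turnTop_nS, lin_turnZero_nS, map_neg, neg_neg]

end

end Shape

namespace Shape

variable (S : Shape)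

/-! ### Generic points -/

/-- Every facet of a tile through `p` is parallel to `u`. -/
def Generic (T : Set (Set E3)) (p u : E3) : Prop :=
  ∀ g : E3 ≃ᵃⁱ[ℝ] E3, g '' S.tile ∈ T → ∀ i, S.facet i (g⁻¹ p) = bound i →
    S.facet i (lin g⁻¹ u) = 0

variable {S}

/-- There are countably many facet planes in the tiling, and each one that is not parallel to `u`
excludes at most one parameter. -/
lemma IsTiling.exists_generic {T : Set (Set E3)} (hT : S.IsTiling T) (p u : E3) {r r' : ℝ}
    (hr : r < r') : ∃ τ, r < τ ∧ τ < r' ∧ S.Generic T (p + τ • u) u := by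
  have hc : (⋃ g ∈ {g : E3 ≃ᵃⁱ[ℝ] E3 | g '' S.tile ∈ T}, ⋃ i : Fin 8,
      {τ : ℝ | S.facet i (g⁻¹ (p + τ • u)) = bound i ∧ S.facet i (lin g⁻¹ u) ≠ 0}).Countable := by
    refine hT.countable_motions.biUnion fun g _ => countable_iUnion fun i => ?_
    refine Set.Subsingleton.countable ?_
    rintro τ ⟨h1, h2⟩ τ' ⟨h1', -⟩
    rw [map_add_lin, map_smul, map_add, map_smul, smul_eq_mul] at h1 h1'
    have : (τ - τ') * S.facet i (lin g⁻¹ u) = 0 := by linarith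
    rcases mul_eq_zero.mp this with h | h
    · linarith
    · exact absurd h h2
  obtain ⟨τ, hτ, hτ'⟩ := (hc.dense_compl ℝ).exists_mem_open isOpen_Ioo (nonempty_Ioo.mpr hr)
  refine ⟨τ, hτ'.1, hτ'.2, fun g hg i hi => ?_⟩
  by_contra h
  apply hτ
  simp only [mem_iUnion]
  exact ⟨g, hg, i, hi, h⟩

variable (S)

/-- The position of a generic point on the facet `tri0`. -/
def OnTri (q : E3) : Prop :=
  (∃ t, 0 < t ∧ t < 1 ∧ q = S.pt 0 t 0) ∨ (∃ t, 0 < t ∧ t < 1 / 2 ∧ q = S.pt 0 t t) ∨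
  (∃ t, 0 < t ∧ t < 1 / 2 ∧ q = S.pt 0 (1 - t) t) ∨
  (∃ t z, 0 < z ∧ z < t ∧ z < 1 - t ∧ q = S.pt 0 t z)

/-- Every facet of the prototile through `q` is parallel to `v`. -/
def Par (q v : E3) : Prop := ∀ i, S.facet i q = bound i → S.facet i v = 0

variable {S}

lemma par_iff {q v : E3} : S.Par q v ↔ (S.cs q = 0 → S.cs v = 0) ∧ (S.cs q = 1 → S.cs v = 0) ∧
    (S.ct q = 0 → S.ct v = 0) ∧ (S.ct q = 1 → S.ct v = 0) ∧
    (S.cz q = S.ct q → S.cz v = S.ct v) ∧ (S.cz q = 1 - S.ct q → S.cz v = -S.ct v) ∧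
    (S.cz q = -S.cs q → S.cz v = -S.cs v) ∧ (S.cz q = S.cs q - 1 → S.cz v = S.cs v) := by
  have : S.Par q v ↔ ∀ i, (S.facet i q = bound i → S.facet i v = 0) := Iff.rfl
  rw [this]
  simp only [Fin.forall_fin_succ, facet, bound]
  simp only [Fin.succ_zero_eq_one, Fin.succ_one_eq_two, Matrix.cons_val_zero, Matrix.cons_val_succ,
    Matrix.cons_val_fin_one, Matrix.cons_val, neg_apply, sub_apply, add_apply, IsEmpty.forall_iff,
    and_true]
  refine and_congr (by simp) <| and_congr (by simp) <| and_congr (by simp) <| and_congr (by simp) <|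
    and_congr ?_ <| and_congr ?_ <| and_congr ?_ ?_
  all_goals
    refine imp_congr ⟨fun h => by linarith, fun h => by linarith⟩
      ⟨fun h => by linarith, fun h => by linarith⟩

/-- At a vertex of the triangle three facets with independent normals meet, which leaves no nonzero
direction parallel to all of them. A generic point is therefore inside the triangle or inside one of
its edges. -/
lemma Par.onTri {q v : E3} (h : S.Par q v) (hv : v ≠ 0) (hq : q ∈ S.tile) (h0 : S.cs q = 0) :
    S.OnTri q := by
  obtain ⟨a1, -, a3, a4, a5, a6, a7, -⟩ := par_iff.mp h
  obtain ⟨-, ⟨b1, b2⟩, ⟨b3, b4⟩, b5, -⟩ := S.mem_tile.mp hq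
  have hv' : S.cs v = 0 → S.ct v = 0 → S.cz v = 0 → False := fun h1 h2 h3 =>
    hv (by apply S.ext_coord <;> simpa)
  have hq' : q = S.pt 0 (S.ct q) (S.cz q) := by rw [← h0, S.pt_coord]
  rw [h0] at b5
  have hs := a1 h0
  rcases eq_or_lt_of_le (show 0 ≤ S.cz q by linarith) with hz | hz
  · have hz' := a7 (by rw [h0]; linarith)
    left
    refine ⟨S.ct q, ?_, ?_, by rw [← hz] at hq'; exact hq'⟩
    · refine lt_of_le_of_ne b1 fun h2 => hv' hs (a3 h2.symm) (by linarith)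
    · refine lt_of_le_of_ne b2 fun h2 => hv' hs (a4 h2) (by linarith)
  · rcases eq_or_lt_of_le b3 with h3 | h3
    · right; left
      refine ⟨S.ct q, by linarith, ?_, by rw [h3] at hq'; exact hq'⟩
      have h4 := a5 h3
      refine lt_of_le_of_ne (by linarith) fun h2 => ?_
      have h5 := a6 (by linarith)
      exact hv' hs (by linarith) (by linarith)
    · rcases eq_or_lt_of_le b4 with h4 | h4
      · right; right; left
        refine ⟨S.cz q, hz, by linarith, ?_⟩
        rw [h4]; rw [h4] at hq'
        convert hq' using 2; ring
      · right; right; right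
        exact ⟨S.ct q, S.cz q, hz, h3, by linarith, hq'⟩

lemma OnTri.mem {q : E3} (h : S.OnTri q) : q ∈ S.tri0 ∧ q ≠ 0 ∧ q ≠ S.b ∧ q ≠ S.apex := by
  rw [mem_tri0]
  have key : ∀ x : E3, (S.ct x ≠ S.ct q ∨ S.cz x ≠ S.cz q) → q ≠ x := by
    rintro x hx rfl; simp at hx
  have k0 := key 0
  have k1 := key S.b
  have k2 := key S.apex
  rcases h with ⟨t, h1, h2, rfl⟩ | ⟨t, h1, h2, rfl⟩ | ⟨t, h1, h2, rfl⟩ | ⟨t, z, h1, h2, h3, rfl⟩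
  · refine ⟨by simp; constructor <;> linarith, k0 (by left; simp; linarith),
      k1 (by left; simp; linarith), k2 (by right; simp [apex])⟩
  · refine ⟨by simp; constructor <;> linarith, k0 (by left; simp; linarith),
      k1 (by left; simp; linarith), k2 (by left; simp [apex]; linarith)⟩
  · refine ⟨by simp; constructor <;> linarith, k0 (by right; simp; linarith),
      k1 (by right; simp; linarith), k2 (by right; simp [apex]; linarith)⟩
  · refine ⟨by simp; refine ⟨?_, ?_, ?_⟩ <;> linarith, k0 (by right; simp; linarith),
      k1 (by right; simp; linarith), fun h => ?_⟩
    have h4 := congrArg S.ct h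
    have h5 := congrArg S.cz h
    simp [apex] at h4 h5
    linarith

lemma hasAngle_tri {t z : ℝ} (h0 : 0 < z) (h1 : z < t) (h2 : z < 1 - t) :
    HasAngle S.tile (S.pt 0 t z) Real.pi := by
  refine S.hasAngle_face (i := 0) ?_ ?_
  · simp [facet, bound]
  · intro k hk
    fin_cases k <;> simp [facet, bound] at hk ⊢ <;> linarith

lemma par_turnV {q v : E3} (h : S.Par q v) : S.Par (S.turnV q) (lin S.turnV v) := by
  have e1 : ∀ v, S.cs (lin S.turnV v) = -S.cs v ∧ S.ct (lin S.turnV v) = -S.ct v ∧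
      S.cz (lin S.turnV v) = S.cz v := by
    intro v
    have : lin S.turnV v = S.turnV v - S.turnV 0 := by rw [← lin_sub, sub_zero]
    rw [this]
    simp [cs_turnV, ct_turnV, cz_turnV]
  obtain ⟨e1, e2, e3⟩ := e1 v
  rw [par_iff] at *
  rw [e1, e2, e3, cs_turnV, ct_turnV, cz_turnV]
  obtain ⟨h0, h1, h2, h3, h4, h5, h6, h7⟩ := h
  refine ⟨fun h => ?_, fun h => ?_, fun h => ?_, fun h => ?_, fun h => ?_, fun h => ?_, fun h => ?_,
    fun h => ?_⟩
  · rw [h1 (by linarith), neg_zero]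
  · rw [h0 (by linarith), neg_zero]
  · rw [h3 (by linarith), neg_zero]
  · rw [h2 (by linarith), neg_zero]
  · rw [h5 (by linarith)]
  · rw [h4 (by linarith), neg_neg]
  · rw [h7 (by linarith), neg_neg]
  · rw [h6 (by linarith)]

lemma par_turnD {q v : E3} (h : S.Par q v) : S.Par (S.turnD q) (lin S.turnD v) := by
  have e1 : ∀ v, S.cs (lin S.turnD v) = S.ct v ∧ S.ct (lin S.turnD v) = S.cs v ∧
      S.cz (lin S.turnD v) = -S.cz v := by
    intro v
    have : lin S.turnD v = S.turnD v - S.turnD 0 := by rw [← lin_sub, sub_zero]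
    rw [this]
    simp [cs_turnD, ct_turnD, cz_turnD]
  obtain ⟨e1, e2, e3⟩ := e1 v
  rw [par_iff] at *
  rw [e1, e2, e3, cs_turnD, ct_turnD, cz_turnD]
  obtain ⟨h0, h1, h2, h3, h4, h5, h6, h7⟩ := h
  refine ⟨h2, h3, h0, h1, fun h => ?_, fun h => ?_, fun h => ?_, fun h => ?_⟩
  · rw [h6 (by linarith), neg_neg]
  · rw [h7 (by linarith)]
  · rw [h4 (by linarith)]
  · rw [h5 (by linarith), neg_neg]

lemma turnV_mem_tile {q : E3} : S.turnV q ∈ S.tile ↔ q ∈ S.tile := by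
  conv_lhs => rw [← turnV_tile]
  exact S.turnV.injective.mem_set_image

lemma turnD_mem_tile {q : E3} : S.turnD q ∈ S.tile ↔ q ∈ S.tile := by
  conv_lhs => rw [← turnD_tile]
  exact S.turnD.injective.mem_set_image

lemma Equilateral.hasAngle_upper (hS : S.Equilateral) {q : E3}
    (hq : q ∈ S.tile) (h0 : 0 < S.cs q) (h1 : S.cs q < 1) (hz : 0 < S.cz q)
    (hf : S.cz q = S.ct q ∨ S.cz q = 1 - S.ct q) :
    HasAngle S.tile q Real.pi ∨ HasAngle S.tile q (2 * S.hr) := by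
  obtain ⟨-, ⟨b1, b2⟩, ⟨b3, b4⟩, b5, -⟩ := S.mem_tile.mp hq
  rw [← S.pt_coord q]
  set s := S.cs q
  set t := S.ct q
  set z := S.cz q
  rcases eq_or_lt_of_le b3 with h3 | h3
  · rcases eq_or_lt_of_le b4 with h4 | h4
    · right
      have e1 : t = 1 / 2 := by linarith
      rw [h3, e1]; exact hS.hasAngle_ridge h0 h1
    · left
      refine S.hasAngle_face (i := 4) ?_ ?_
      · simp [facet, bound]; linarith
      · intro k hk
        fin_cases k <;> simp [facet, bound] at hk ⊢ <;> linarith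
  · have h4 : z = 1 - t := by rcases hf with h | h <;> linarith
    left
    refine S.hasAngle_face (i := 5) ?_ ?_
    · simp [facet, bound]; linarith
    · intro k hk
      fin_cases k <;> simp [facet, bound] at hk ⊢ <;> linarith

/-- The position of a generic point in the prototile. -/
lemma Equilateral.classify (hS : S.Equilateral) {q v : E3} (h : S.Par q v)
    (hv : v ≠ 0) (hq : q ∈ S.tile) : q ∈ interior S.tile ∨
      (∃ σ ∈ motions, σ '' S.tile = S.tile ∧ S.OnTri (σ⁻¹ q)) ∨
      HasAngle S.tile q Real.pi ∨ HasAngle S.tile q (2 * S.hr) := by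
  have hV : S.turnV⁻¹ = S.turnV := inv_eq_of_mul_eq_one_left (by ext1 x; exact S.turnV_turnV x)
  have hD : S.turnD⁻¹ = S.turnD := inv_eq_of_mul_eq_one_left (by ext1 x; exact S.turnD_turnD x)
  have ne : ∀ (g : E3 ≃ᵃⁱ[ℝ] E3) {v : E3}, v ≠ 0 → lin g v ≠ 0 := fun g v hv h =>
    hv ((lin g).map_eq_zero_iff.mp h)
  have tri : ∀ q v : E3, S.Par q v → v ≠ 0 → q ∈ S.tile → (S.cs q = 0 ∨ S.cs q = 1) →
      ∃ σ ∈ motions, σ '' S.tile = S.tile ∧ S.OnTri (σ⁻¹ q) := by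
    rintro q v h hv hq (h0 | h0)
    · exact ⟨1, one_mem _, image_id _, h.onTri hv hq h0⟩
    · refine ⟨S.turnV, S.turnV_mem, S.turnV_tile, ?_⟩
      rw [hV]
      exact (par_turnV h).onTri (ne _ hv) (turnV_mem_tile.mpr hq) (by rw [cs_turnV, h0, sub_self])
  by_cases h1 : S.cs q = 0 ∨ S.cs q = 1
  · exact Or.inr (Or.inl (tri q v h hv hq h1))
  by_cases h2 : S.ct q = 0 ∨ S.ct q = 1
  · obtain ⟨σ, hσ, h3, h4⟩ := tri (S.turnD q) _ (par_turnD h) (ne _ hv) (turnD_mem_tile.mpr hq)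
      (by rwa [cs_turnD])
    refine Or.inr (Or.inl ⟨S.turnD * σ, mul_mem S.turnD_mem hσ, ?_, ?_⟩)
    · rw [mul_image, h3, turnD_tile]
    · rw [mul_inv_rev, hD]; exact h4
  push Not at h1 h2
  obtain ⟨⟨a1, a2⟩, ⟨b1, b2⟩, ⟨b3, b4⟩, b5, b6⟩ := S.mem_tile.mp hq
  have a1' := lt_of_le_of_ne a1 (Ne.symm h1.1)
  have a2' := lt_of_le_of_ne a2 h1.2
  have b1' := lt_of_le_of_ne b1 (Ne.symm h2.1)
  have b2' := lt_of_le_of_ne b2 h2.2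
  by_cases hu : S.cz q = S.ct q ∨ S.cz q = 1 - S.ct q
  · refine Or.inr (Or.inr (hS.hasAngle_upper hq a1' a2' ?_ hu))
    rcases hu with h | h <;> linarith
  by_cases hl : -S.cz q = S.cs q ∨ -S.cz q = 1 - S.cs q
  · have := hS.hasAngle_upper (turnD_mem_tile.mpr hq)
      (by rwa [cs_turnD]) (by rwa [cs_turnD])
      (by rw [cz_turnD]; rcases hl with h | h <;> linarith) (by rwa [cz_turnD, ct_turnD])
    refine Or.inr (Or.inr (this.imp ?_ ?_)) <;>
    · intro h
      have := h.image S.turnD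
      rwa [turnD_tile, turnD_turnD] at this
  push Not at hu hl
  refine Or.inl (S.mem_interior_tile.mpr ⟨⟨a1', a2'⟩, ⟨b1', b2'⟩,
    ⟨lt_of_le_of_ne b3 hu.1, lt_of_le_of_ne b4 hu.2⟩, lt_of_le_of_ne b5 hl.1,
    lt_of_le_of_ne b6 hl.2⟩)

/-- The angles that occur are `π - hr`, `sml`, `π - sml` and `π`. As `sml < 3 * hr` and `hr ≤ π /
6`, the smallest of them is `sml`. -/
lemma Equilateral.onTri_angle (hS : S.Equilateral) (hc : S.c ≠ 0) {q : E3} (h : S.OnTri q) :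
    ∃ α, HasAngle S.tile q α ∧ S.sml ≤ α := by
  have h1 := S.sml_lt hc
  have h2 := S.hr_le
  have h3 := S.hr_pos
  have h4 := S.slope_cases
  have h5 : S.sml ≤ S.slope ∧ S.sml ≤ Real.pi - S.slope := by
    rcases lt_or_gt_of_ne hc with h | h
    · rw [h4.2 h]; constructor <;> linarith
    · rw [h4.1 h]; constructor <;> linarith
  rcases h with ⟨t, h1, h2, rfl⟩ | ⟨t, h1, h2, rfl⟩ | ⟨t, h1, h2, rfl⟩ | ⟨t, z, h1, h2, h3, rfl⟩
  · exact ⟨_, hS.hasAngle_base h1 h2, by linarith⟩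
  · exact ⟨_, hS.hasAngle_slope h1 h2, h5.1⟩
  · exact ⟨_, hS.hasAngle_slope' h1 h2, h5.2⟩
  · exact ⟨_, hasAngle_tri h1 h2 h3, by linarith⟩

end Shape

/-! ### Tiles meeting at an edge point of an upright facet -/

namespace Shape

variable {S : Shape}

lemma hasAngle_cen : HasAngle S.tile S.cen Real.pi :=
  hasAngle_tri (by norm_num) (by norm_num) (by norm_num)

lemma cen_mem : S.cen ∈ S.tri0 := S.mem_tri0.mpr (by simp [cen]; norm_num)

lemma not_mem_interior_of_hasAngle {X : Set E3} {p : E3} {α : ℝ} (h : HasAngle X p α)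
    (hα : α < 2 * Real.pi) : p ∉ interior X := by
  intro hp
  obtain ⟨h0, ε, hε, h⟩ := h
  obtain ⟨δ, hδ, hsub⟩ := Metric.isOpen_iff.mp isOpen_interior p hp
  have hr : 0 < min ε δ := lt_min hε hδ
  have h1 := h _ hr (min_le_left _ _)
  rw [inter_eq_right.mpr ((ball_subset_ball (min_le_right _ _)).trans
    (hsub.trans interior_subset))] at h1
  have hb := (measure_ball_pos volume p hr).ne'
  have hb' : volume (ball p (min ε δ)) ≠ ⊤ := measure_ball_lt_top.ne
  have h2 : 1 * volume (ball p (min ε δ)) = _ := (one_mul _).trans h1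
  have := Real.pi_pos
  rw [ENNReal.mul_left_inj hb hb', eq_comm, ENNReal.ofReal_eq_one,
    div_eq_one_iff_eq (by positivity)] at h2
  linarith

/-- An equilateral triangle has its side as diameter. This tells upright facets from roof facets,
which have longer diagonals. -/
lemma dist_tri0_le (hS : S.Equilateral) {x y : E3} (hx : x ∈ S.tri0) (hy : y ∈ S.tri0) :
    dist x y ^ 2 ≤ S.len ^ 2 := by
  obtain ⟨a1, a2, a3, a4⟩ := S.mem_tri0.mp hx
  obtain ⟨b1, b2, b3, b4⟩ := S.mem_tri0.mp hy
  rw [dist_eq_norm, ← S.pt_coord (x - y), norm_sq_pt, ← hS, map_sub, map_sub, map_sub, a1, b1]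
  have : (S.ct x - S.ct y) ^ 2 + 3 * (S.cz x - S.cz y) ^ 2 ≤ 1 := by
    have h1 : |S.ct x - S.ct y| + |S.cz x - S.cz y| ≤ 1 := by
      rcases abs_cases (S.ct x - S.ct y) with ⟨h, _⟩ | ⟨h, _⟩ <;>
      rcases abs_cases (S.cz x - S.cz y) with ⟨h', _⟩ | ⟨h', _⟩ <;> rw [h, h'] <;> linarith
    have h2 : |S.cz x - S.cz y| ≤ 1 / 2 := by
      rw [abs_le]; constructor <;> linarith
    rw [← sq_abs (S.ct x - S.ct y), ← sq_abs (S.cz x - S.cz y)]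
    have h3 := abs_nonneg (S.ct x - S.ct y)
    have h4 := abs_nonneg (S.cz x - S.cz y)
    nlinarith
  nlinarith [sq_nonneg S.len]

/-- The image of an upright facet under a symmetry of the prototile spans a facet plane. -/
lemma exists_facet_of_symm {σ : E3 ≃ᵃⁱ[ℝ] E3} (hσ : σ '' S.tile = S.tile) :
    ∃ i, ∀ x ∈ S.tile, S.facet i (σ x) = bound i ↔ x ∈ S.tri0 := by
  have h1 : HasAngle S.tile (σ S.cen) Real.pi := by
    have := hasAngle_cen.image σ (X := S.tile); rwa [hσ] at this
  have h2 : σ S.cen ∈ S.tile := by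
    rw [← hσ]; exact mem_image_of_mem _ (S.tri0_subset_tile cen_mem)
  have h3 := not_mem_interior_of_hasAngle h1 (by linarith [Real.pi_pos])
  -- The image of the centroid also has a flat angle, so it is a boundary point and lies on some
  -- facet plane.
  obtain ⟨i, hi⟩ : ∃ i, S.facet i (σ S.cen) = bound i := by
    by_contra! h
    apply h3
    rw [interior_tile]
    rw [tile_eq] at h2
    exact fun i => lt_of_le_of_ne (h2 i) (h i)
  refine ⟨i, ?_⟩
  set m : E3 := (lin σ).symm (S.nrm i) with hm
  have hmne : m ≠ 0 := fun h => S.nrm_ne i ((lin σ).symm.map_eq_zero_iff.mp h)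
  have hval : ∀ x, S.facet i (σ x) = bound i + ⟪m, x - S.cen⟫ := by
    intro x
    have h4 : σ x = σ S.cen + lin σ (x - S.cen) := by rw [lin_sub]; abel
    rw [h4, map_add, hi, facet_eq, hm, ← LinearIsometryEquiv.inner_map_map (lin σ) ((lin σ).symm _),
      LinearIsometryEquiv.apply_symm_apply]
  -- the tile is a half-space near the centroid
  have hloc : ∃ ε > 0, ∀ d : E3, ‖d‖ < ε → 0 ≤ ⟪S.nS, d⟫ → S.cen + d ∈ S.tile := by
    have hopen : IsOpen {x : E3 | S.cs x < 1 ∧ 0 < S.ct x ∧ S.ct x < 1 ∧ S.cz x < S.ct x ∧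
        S.cz x < 1 - S.ct x ∧ 0 < S.cz x ∧ -S.cz x < 1 - S.cs x} := by
      refine IsOpen.and ?_ <| IsOpen.and ?_ <| IsOpen.and ?_ <| IsOpen.and ?_ <| IsOpen.and ?_ <|
        IsOpen.and ?_ ?_
      all_goals exact isOpen_lt (by fun_prop) (by fun_prop)
    obtain ⟨ε, hε, hsub⟩ := Metric.isOpen_iff.mp hopen S.cen (by simp [cen]; norm_num)
    refine ⟨ε, hε, fun d hd h => ?_⟩
    obtain ⟨k1, k2, k3, k4, k5, k6, k7⟩ := hsub (show S.cen + d ∈ ball S.cen ε by simpa using hd)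
    have k8 : S.cs (S.cen + d) = ⟪S.nS, d⟫ := by
      rw [map_add]; simp [cen]; rfl
    rw [← k8] at h
    rw [mem_tile]
    refine ⟨⟨h, k1.le⟩, ⟨k2.le, k3.le⟩, ⟨k4.le, k5.le⟩, by linarith, by linarith⟩
  obtain ⟨ε, hε, hloc⟩ := hloc
  -- The transported facet inequality holds on a half-ball around the centroid, so its linear part
  -- is nonpositive on a half-space and hence proportional to `nS`.
  have hneg : ∀ d : E3, 0 ≤ ⟪S.nS, d⟫ → ⟪m, d⟫ ≤ 0 := by
    intro d hd
    have hr : 0 < ε / (2 * (‖d‖ + 1)) := by positivity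
    set r := ε / (2 * (‖d‖ + 1)) with hrdef
    have h5 : S.cen + r • d ∈ S.tile := by
      apply hloc
      · rw [norm_smul, Real.norm_of_nonneg hr.le, hrdef, div_mul_eq_mul_div,
          div_lt_iff₀ (by positivity)]
        nlinarith [norm_nonneg d]
      · rw [inner_smul_right]; positivity
    have h6 : σ (S.cen + r • d) ∈ S.tile := by rw [← hσ]; exact mem_image_of_mem _ h5
    rw [tile_eq] at h6
    have h7 := h6 i
    rw [hval, add_sub_cancel_left, inner_smul_right] at h7
    nlinarith
  have hperp : ∀ d : E3, ⟪S.nS, d⟫ = 0 → ⟪m, d⟫ = 0 := by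
    intro d hd
    refine le_antisymm (hneg d hd.ge) ?_
    have := hneg (-d) (by rw [inner_neg_right, hd, neg_zero])
    rw [inner_neg_right] at this
    linarith
  have hp : 0 < ⟪S.nS, S.nS⟫ := S.inner_nS_pos
  obtain ⟨k, hk⟩ : ∃ k : ℝ, ∀ d, ⟪m, d⟫ = k * ⟪S.nS, d⟫ := by
    refine ⟨⟪m, S.nS⟫ / ⟪S.nS, S.nS⟫, fun d => ?_⟩
    have h8 := hperp (d - (⟪S.nS, d⟫ / ⟪S.nS, S.nS⟫) • S.nS) (by
      rw [inner_sub_right, inner_smul_right]; field_simp; ring)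
    rw [inner_sub_right, inner_smul_right] at h8
    rw [sub_eq_zero.mp h8]; ring
  have hk0 : k ≠ 0 := by
    rintro rfl
    have := hk m
    rw [zero_mul, inner_self_eq_zero] at this
    exact hmne this
  intro x hx
  rw [hval, hk, add_eq_left, mul_eq_zero, or_iff_right hk0]
  have h9 : ⟪S.nS, x - S.cen⟫ = S.cs x := by
    rw [inner_sub_right]
    have : ⟪S.nS, S.cen⟫ = 0 := S.cs_pt _ _ _
    rw [this, sub_zero]; rfl
  rw [h9, mem_tri0]
  obtain ⟨-, -, ⟨b3, b4⟩, b5, -⟩ := S.mem_tile.mp hx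
  constructor
  · intro h; refine ⟨h, by linarith, b3, b4⟩
  · exact fun h => h.1

/-- A symmetry of the prototile maps an upright facet to an upright facet. -/
lemma symm_cen_mem (hS : S.Equilateral) {σ : E3 ≃ᵃⁱ[ℝ] E3} (hσ : σ '' S.tile = S.tile) {p : E3}
    (hp : p ∈ S.tri0) (h0 : p ≠ 0) (hb : p ≠ S.b) (hpσ : p ∈ σ '' S.tri0) : σ S.cen ∈ S.tri0 := by
  obtain ⟨i, hi⟩ := exists_facet_of_symm hσ
  have hpi : S.facet i p = bound i := by
    obtain ⟨x, hx, rfl⟩ := hpσ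
    exact (hi x (S.tri0_subset_tile hx)).mpr hx
  have hci := (hi _ (S.tri0_subset_tile cen_mem)).mpr cen_mem
  have hmem : σ S.cen ∈ S.tile := by
    rw [← hσ]; exact mem_image_of_mem _ (S.tri0_subset_tile cen_mem)
  obtain ⟨a1, a2, a3, a4⟩ := S.mem_tri0.mp hp
  have t0 : S.ct p ≠ 0 := fun h => h0 (by
    apply S.ext_coord <;> simp [a1, h]; linarith)
  have t1 : S.ct p ≠ 1 := fun h => hb (by
    apply S.ext_coord <;> simp [a1, h]; linarith)
  have diag : ∀ x ∈ S.tile, ∀ y ∈ S.tile, S.facet i x = bound i → S.facet i y = bound i →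
      dist x y ^ 2 ≤ S.len ^ 2 := by
    intro x hx y hy hxi hyi
    rw [← hσ] at hx hy
    obtain ⟨x, hx, rfl⟩ := hx
    obtain ⟨y, hy, rfl⟩ := hy
    rw [σ.dist_map]
    exact dist_tri0_le hS ((hi x hx).mp hxi) ((hi y hy).mp hyi)
  have big : ∀ s t z s' t' z' : ℝ, S.pt s t z ∈ S.tile → S.pt s' t' z' ∈ S.tile →
      S.facet i (S.pt s t z) = bound i → S.facet i (S.pt s' t' z') = bound i →
      (s - s') ^ 2 + (t - t') ^ 2 + 2 * S.c * ((s - s') * (t - t')) + 3 * (z - z') ^ 2 ≤ 1 := by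
    intro s t z s' t' z' h1 h2 h3 h4
    have := diag _ h1 _ h2 h3 h4
    rw [dist_eq_norm, pt_sub, norm_sq_pt, ← hS] at this
    have h5 := pow_pos S.len_pos 2
    by_contra! h
    nlinarith
  have hc := S.c_lt
  have hc' := S.neg_c_lt
  -- The first facet is the desired one and the next three do not pass through `p`. Each roof facet
  -- contains two points at squared distance `(2 ± c) * len ^ 2`, too far apart for a congruent copy
  -- of the triangle.
  fin_cases i
  · rw [mem_tri0]
    obtain ⟨-, -, ⟨b3, b4⟩, b5, -⟩ := S.mem_tile.mp hmem
    simp [facet, bound] at hci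
    refine ⟨hci, by linarith, b3, b4⟩
  · simp [facet, bound, a1] at hpi
  · simp [facet, bound] at hpi; exact absurd hpi t0
  · simp [facet, bound] at hpi; exact absurd hpi t1
  · have := big 0 0 0 1 (1 / 2) (1 / 2) (by rw [mem_tile]; simp) (by rw [mem_tile]; simp; norm_num)
      (by simp [facet, bound]) (by simp [facet, bound])
    nlinarith
  · have := big 0 1 0 1 (1 / 2) (1 / 2) (by rw [mem_tile]; simp) (by rw [mem_tile]; simp; norm_num)
      (by simp [facet, bound]) (by simp [facet, bound]; norm_num)
    nlinarith
  · have := big 0 0 0 (1 / 2) 1 (-(1 / 2)) (by rw [mem_tile]; simp)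
      (by rw [mem_tile]; simp; norm_num) (by simp [facet, bound]) (by simp [facet, bound])
    nlinarith
  · have := big 1 0 0 (1 / 2) 1 (-(1 / 2)) (by rw [mem_tile]; simp)
      (by rw [mem_tile]; simp; norm_num) (by simp [facet, bound]) (by simp [facet, bound]; norm_num)
    nlinarith

/-- Two tiles with flat angles at a point leave no room for a third one. -/
lemma IsTiling.no_third {T : Set (Set E3)} (hT : S.IsTiling T) {X Y Z : Set E3} (hX : X ∈ T)
    (hY : Y ∈ T) (hZ : Z ∈ T) (hXY : X ≠ Y) (hXZ : X ≠ Z) (hYZ : Y ≠ Z) {p : E3}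
    (aX : HasAngle X p Real.pi) (aY : HasAngle Y p Real.pi) (pZ : p ∈ Z) : False := by
  obtain ⟨-, ε, hε, aX⟩ := aX
  obtain ⟨-, δ, hδ, aY⟩ := aY
  have hr : 0 < min ε δ := lt_min hε hδ
  have h1 := aX _ hr (min_le_left _ _)
  have h2 := aY _ hr (min_le_right _ _)
  obtain ⟨y, hy, hyZ⟩ := hT.exists_interior hZ pZ isOpen_ball (mem_ball_self hr)
  have h3 : 0 < volume (Z ∩ ball p (min ε δ)) :=
    ((isOpen_interior.inter isOpen_ball).measure_pos volume ⟨y, hyZ, hy⟩).trans_le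
      (measure_mono (inter_subset_inter_left _ interior_subset))
  have h4 := hT.volume_inter_ball (F := {X, Y, Z}) (by simp [hX, hY, hZ]) p (min ε δ)
  rw [Finset.sum_insert (by simp [hXY, hXZ]), Finset.sum_pair hYZ, h1, h2, ← add_assoc,
    ← add_mul, ← ENNReal.ofReal_add (by positivity) (by positivity)] at h4
  have h5 : Real.pi / (2 * Real.pi) + Real.pi / (2 * Real.pi) = 1 := by
    have := Real.pi_pos
    field_simp; norm_num
  rw [h5, ENNReal.ofReal_one, one_mul] at h4
  have h6 : volume (ball p (min ε δ)) + volume (Z ∩ ball p (min ε δ)) ≤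
      volume (ball p (min ε δ)) := by
    rw [← h4]; exact measure_mono inter_subset_right
  have h7 := ENNReal.lt_add_right (measure_ball_lt_top (μ := volume) (x := p) (r := min ε δ)).ne
    h3.ne'
  exact absurd h6 (not_le.mpr h7)

/-- A tile meeting two adjacent tiles in a relative interior edge point of their common upright
facet is not adjacent to the first of them across an upright facet through this point. -/
lemma IsTiling.not_adjacent {T : Set (Set E3)} (hT : S.IsTiling T) (hS : S.Equilateral)
    (h1 : S.tile ∈ T) {κ : E3 ≃ᵃⁱ[ℝ] E3} (hκ : κ '' S.tri0 = S.tri0) (hκT : κ '' S.tile ∈ T)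
    (hne : κ '' S.tile ≠ S.tile) {g σ : E3 ≃ᵃⁱ[ℝ] E3} (hg : g '' S.tile ∈ T)
    (hg1 : g '' S.tile ≠ S.tile) (hg2 : g '' S.tile ≠ κ '' S.tile) (hσ : σ '' S.tile = S.tile)
    (hgσ : g '' S.tri0 = σ '' S.tri0) {p : E3} (hp : p ∈ S.tri0) (h0 : p ≠ 0) (hb : p ≠ S.b)
    (hpσ : p ∈ σ '' S.tri0) : False := by
  have hc := symm_cen_mem hS hσ hp h0 hb hpσ
  have e : g S.cen = σ S.cen := by
    have : (σ⁻¹ * g) '' S.tri0 = S.tri0 := by rw [mul_image, hgσ, inv_image]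
    have h2 : σ⁻¹ (g S.cen) = S.cen := S.map_cen this
    rw [← h2, apply_inv_apply, h2]
  have a1 := (hasAngle_cen (S := S)).image σ
  rw [hσ] at a1
  have a2 := (hasAngle_cen (S := S)).image g
  rw [e] at a2
  refine hT.no_third h1 hg hκT hg1.symm hne.symm hg2 a1 a2 ?_
  rw [← hκ] at hc
  exact image_mono S.tri0_subset_tile hc

end Shape

/-! ### Angle sums against the additional gluings of equilateral facets -/

namespace Shape

variable {S : Shape} {T : Set (Set E3)}

lemma lin_ne_zero (g : E3 ≃ᵃⁱ[ℝ] E3) {v : E3} (hv : v ≠ 0) : lin g v ≠ 0 :=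
  fun h => hv ((lin g).map_eq_zero_iff.mp h)

lemma Generic.par {p u : E3} (h : S.Generic T p u) {g : E3 ≃ᵃⁱ[ℝ] E3} (hg : g '' S.tile ∈ T) :
    S.Par (g⁻¹ p) (lin g⁻¹ u) := h g hg

lemma Generic.onTri {p u : E3} (h : S.Generic T p u) (hu : u ≠ 0) {g : E3 ≃ᵃⁱ[ℝ] E3}
    (hg : g '' S.tile ∈ T) (hp : p ∈ g '' S.tri0) : S.OnTri (g⁻¹ p) := by
  rw [mem_image_iff] at hp
  exact (h.par hg).onTri (lin_ne_zero _ hu) (S.tri0_subset_tile hp) (S.mem_tri0.mp hp).1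

/-- If the angle left over beside two adjacent tiles at a generic point is neither a multiple of the
angle at a ridge nor large enough for two tiles adjacent across an upright facet, then there is no
such tiling. -/
lemma IsTiling.false_of_rest (hT : S.IsTiling T) (hS : S.Equilateral) (h1 : S.tile ∈ T)
    {κ : E3 ≃ᵃⁱ[ℝ] E3} (hκ : κ '' S.tri0 = S.tri0) (hκm : κ ∈ motions) (hκT : κ '' S.tile ∈ T)
    (hne : κ '' S.tile ≠ S.tile) {p u : E3} (hu : u ≠ 0) (hgen : S.Generic T p u)
    (hp : p ∈ S.tri0) {x y : ℝ} (hx : HasAngle S.tile p x) (hy : HasAngle (κ '' S.tile) p y)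
    (hrest : 2 * Real.pi - x - y < Real.pi)
    (hk : ∀ k : ℕ, 2 * Real.pi - x - y ≠ k * (2 * S.hr))
    (hpair : ∀ g ∈ motions, ∀ g' ∈ motions, g '' S.tile ∈ T → g' '' S.tile ∈ T →
      g' '' S.tile ≠ g '' S.tile → g' '' S.tri0 = g '' S.tri0 → S.OnTri (g⁻¹ p) →
      S.OnTri (g'⁻¹ p) → ∀ α β, HasAngle (g '' S.tile) p α → HasAngle (g' '' S.tile) p β →
      2 * Real.pi - x - y < α + β) (hc : S.c ≠ 0) : False := by
  classical
  obtain ⟨F, hF, ε, hε, hcov⟩ := hT.exists_star p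
  have hpP : p ∈ S.tile := S.tri0_subset_tile hp
  have hpP' : p ∈ κ '' S.tile := by
    rw [← hκ] at hp; exact image_mono S.tri0_subset_tile hp
  -- The point already belongs to two different tiles.
  have hnot : ∀ X ∈ T, p ∉ interior X := by
    intro X hX hpX
    exact hne ((hT.eq_of_inter hX hκT hpX hpP').symm.trans (hT.eq_of_inter hX h1 hpX hpP))
  have hcls : ∀ g ∈ motions, g '' S.tile ∈ T → p ∈ g '' S.tile →
      (∃ g' ∈ motions, g' '' S.tile = g '' S.tile ∧ S.OnTri (g'⁻¹ p)) ∨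
      HasAngle (g '' S.tile) p Real.pi ∨ HasAngle (g '' S.tile) p (2 * S.hr) := by
    intro g hg hgT hpg
    rw [mem_image_iff] at hpg
    rcases hS.classify (hgen.par hgT) (lin_ne_zero _ hu) hpg with h | ⟨σ, hσ, h2, h3⟩ | h | h
    · refine absurd ?_ (hnot _ hgT)
      rwa [interior_image, mem_image_iff]
    · refine Or.inl ⟨g * σ, mul_mem hg hσ, by rw [mul_image, h2], ?_⟩
      rwa [mul_inv_rev]
    · exact Or.inr (Or.inl h.of_image)
    · exact Or.inr (Or.inr h.of_image)
  have hang : ∀ X ∈ F, ∃ α, HasAngle X p α := by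
    intro X hX
    obtain ⟨hXT, hpX⟩ := (hF X).mp hX
    obtain ⟨g, hg, rfl⟩ := hT.congruent hXT
    rcases hcls g hg hXT hpX with ⟨g', -, h2, h3⟩ | h | h
    · obtain ⟨α, hα, -⟩ := hS.onTri_angle hc h3
      exact ⟨α, h2 ▸ hα.of_image⟩
    · exact ⟨_, h⟩
    · exact ⟨_, h⟩
  choose! f hf using hang
  have mP : S.tile ∈ F := (hF _).mpr ⟨h1, hpP⟩
  have mP' : κ '' S.tile ∈ F := (hF _).mpr ⟨hκT, hpP'⟩
  have fP : f S.tile = x := (hf _ mP).unique hx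
  have fP' : f (κ '' S.tile) = y := (hf _ mP').unique hy
  have hFT : ∀ X ∈ F, X ∈ T := fun X hX => ((hF X).mp hX).1
  have hsub : ∀ G ⊆ F, ∑ X ∈ G, f X ≤ 2 * Real.pi := fun G hG =>
    hT.sum_angle_le (fun X hX => hFT X (hG hX)) (fun X hX => hf X (hG hX))
  obtain ⟨-, n0, nb, na⟩ := (hgen.onTri hu (g := 1)
    (by rwa [show ((1 : E3 ≃ᵃⁱ[ℝ] E3) '' S.tile) = S.tile from image_id _])
    (by rwa [show ((1 : E3 ≃ᵃⁱ[ℝ] E3) '' S.tri0) = S.tri0 from image_id _])).mem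
  change p ≠ 0 at n0
  change p ≠ S.b at nb
  obtain ⟨m0, n0', nb', -⟩ := (hgen.onTri hu hκT (by rwa [hκ])).mem
  -- Every further tile at `p` contributes a ridge. A tile with an upright facet through `p` brings
  -- along its neighbour across this facet, which by `not_adjacent` is none of the two given tiles;
  -- such a pair, or a single flat angle, exceeds the angle that is left.
  have claim : ∀ X ∈ F, X ≠ S.tile → X ≠ κ '' S.tile → f X = 2 * S.hr := by
    intro X hX hX1 hX2
    obtain ⟨hXT, hpX⟩ := (hF X).mp hX
    obtain ⟨g, hg, rfl⟩ := hT.congruent hXT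
    rcases hcls g hg hXT hpX with ⟨g1, hg1, h2, h3⟩ | h | h
    · exfalso
      rw [← h2] at hX hXT hX1 hX2
      obtain ⟨g', hg', hgT', hgne, hgtri⟩ := hT.exists_neighbor hg1 hXT
      have hpg : p ∈ g' '' S.tri0 := by rw [hgtri, mem_image_iff]; exact h3.mem.1
      have hYF : g' '' S.tile ∈ F := (hF _).mpr ⟨hgT', image_mono S.tri0_subset_tile hpg⟩
      by_cases hY1 : g' '' S.tile = S.tile
      · exact hT.not_adjacent hS h1 hκ hκT hne hXT hX1 hX2 hY1 hgtri.symm hp n0 nb hpg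
      by_cases hY2 : g' '' S.tile = κ '' S.tile
      -- The motion `κ⁻¹` exchanges the roles: it carries the second given tile to the prototile.
      · have k1 : (κ⁻¹ : E3 ≃ᵃⁱ[ℝ] E3) '' (κ '' S.tile) = S.tile := inv_image _ _
        refine (hT.map (inv_mem hκm)).not_adjacent hS (κ := κ⁻¹) (g := κ⁻¹ * g1) (σ := κ⁻¹ * g')
          (p := κ⁻¹ p) ?_ ?_ ?_ ?_ ?_ ?_ ?_ ?_ ?_ m0 n0' nb' ?_
        · have := image_mem_mapT (g := κ⁻¹).mpr hκT
          rwa [k1] at this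
        · conv_lhs => rw [← hκ]
          exact inv_image _ _
        · exact image_mem_mapT.mpr h1
        · intro h
          apply hne
          rw [← h, image_inv, h]
        · rw [mul_image]; exact image_mem_mapT.mpr hXT
        · rw [mul_image]
          intro h
          apply hX2
          have := congrArg (fun s => κ '' s) h
          rwa [image_inv] at this
        · rw [mul_image]
          intro h
          exact hX1 ((image_injective.mpr (κ⁻¹ : E3 ≃ᵃⁱ[ℝ] E3).injective) h)
        · rw [mul_image, hY2, k1]
        · rw [mul_image, mul_image, hgtri]
        · rw [mul_image]; exact mem_image_of_mem _ hpg
      have h4 := hpair g1 hg1 g' hg' hXT hgT' hgne hgtri h3 (hgen.onTri hu hgT' hpg) _ _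
        (hf _ hX) (hf _ hYF)
      have h5 := hsub {S.tile, κ '' S.tile, g1 '' S.tile, g' '' S.tile} (by
        intro Z hZ
        simp only [Finset.mem_insert, Finset.mem_singleton] at hZ
        rcases hZ with rfl | rfl | rfl | rfl <;> assumption)
      rw [Finset.sum_insert (by simp [hne.symm, Ne.symm hX1, Ne.symm hY1]),
        Finset.sum_insert (by simp [Ne.symm hX2, Ne.symm hY2]), Finset.sum_pair hgne.symm,
        fP, fP'] at h5
      linarith
    · exfalso
      have h5 := hsub {S.tile, κ '' S.tile, g '' S.tile} (by
        intro Z hZ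
        simp only [Finset.mem_insert, Finset.mem_singleton] at hZ
        rcases hZ with rfl | rfl | rfl <;> assumption)
      rw [Finset.sum_insert (by simp [hne.symm, Ne.symm hX1]), Finset.sum_pair (Ne.symm hX2),
        fP, fP', (hf _ hX).unique h] at h5
      linarith
    · exact (hf _ hX).unique h
  have htot := hT.sum_angle_eq hFT hf hε hcov
  have hsplit : ∑ X ∈ F, f X = x + (y + ∑ X ∈ (F.erase S.tile).erase (κ '' S.tile), f X) := by
    rw [← Finset.add_sum_erase F f mP, ← Finset.add_sum_erase (F.erase S.tile) f
      (Finset.mem_erase.mpr ⟨hne, mP'⟩), fP, fP']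
  have hconst : ∑ X ∈ (F.erase S.tile).erase (κ '' S.tile), f X =
      ∑ X ∈ (F.erase S.tile).erase (κ '' S.tile), 2 * S.hr :=
    Finset.sum_congr rfl fun X hX => by
      simp only [Finset.mem_erase] at hX
      exact claim X hX.2.2 hX.2.1 hX.1
  rw [hconst, Finset.sum_const, nsmul_eq_mul] at hsplit
  exact hk _ (by linarith)

lemma Equilateral.turnZero_tri0 (hS : S.Equilateral) : S.turnZero '' S.tri0 = S.tri0 := by
  rw [tri0, image_convexHull3, ← S.pt_zero, ← S.pt_b, hS.turnZero_pt, hS.turnZero_pt,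
    hS.turnZero_pt]
  congr 1
  norm_num
  rw [pair_comm]

lemma Equilateral.turnEnd_tri0 (hS : S.Equilateral) : S.turnEnd '' S.tri0 = S.tri0 := by
  rw [tri0, image_convexHull3, ← S.pt_zero, ← S.pt_b, hS.turnEnd_pt, hS.turnEnd_pt,
    hS.turnEnd_pt]
  congr 1
  norm_num
  ext x; simp only [mem_insert_iff, mem_singleton_iff]; tauto

lemma Equilateral.turnZero_turnZero (hS : S.Equilateral) : S.turnZero⁻¹ = S.turnZero := by
  apply inv_eq_of_mul_eq_one_left
  apply S.motion_eq_one (mul_mem S.turnZero_mem S.turnZero_mem)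
  · change S.turnZero (S.turnZero 0) = 0
    rw [← S.pt_zero, hS.turnZero_pt, hS.turnZero_pt]; norm_num
  · change S.turnZero (S.turnZero S.b) = S.b
    rw [← S.pt_b, hS.turnZero_pt, hS.turnZero_pt]; norm_num
  · change S.turnZero (S.turnZero _) = _
    rw [hS.turnZero_pt, hS.turnZero_pt]; norm_num

lemma Equilateral.turnEnd_turnEnd (hS : S.Equilateral) : S.turnEnd⁻¹ = S.turnEnd := by
  apply inv_eq_of_mul_eq_one_left
  apply S.motion_eq_one (mul_mem S.turnEnd_mem S.turnEnd_mem)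
  · change S.turnEnd (S.turnEnd 0) = 0
    rw [← S.pt_zero, hS.turnEnd_pt, hS.turnEnd_pt]; norm_num
  · change S.turnEnd (S.turnEnd S.b) = S.b
    rw [← S.pt_b, hS.turnEnd_pt, hS.turnEnd_pt]; norm_num
  · change S.turnEnd (S.turnEnd _) = _
    rw [hS.turnEnd_pt, hS.turnEnd_pt]; norm_num

lemma turnTop_turnTop : S.turnTop⁻¹ = S.turnTop := by
  apply inv_eq_of_mul_eq_one_left
  apply S.motion_eq_one (mul_mem S.turnTop_mem S.turnTop_mem)
  · change S.turnTop (S.turnTop 0) = 0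
    rw [← S.pt_zero, turnTop_pt, turnTop_pt]; norm_num
  · change S.turnTop (S.turnTop S.b) = S.b
    rw [← S.pt_b, turnTop_pt, turnTop_pt]; norm_num
  · change S.turnTop (S.turnTop _) = _
    rw [turnTop_pt, turnTop_pt]; norm_num

/-- The base edge is not glued to the slope edge with the larger angle. -/
lemma IsTiling.not_base_large (hT : S.IsTiling T) (hS : S.Equilateral) (hc : S.c ≠ 0)
    (h1 : S.tile ∈ T) {κ : E3 ≃ᵃⁱ[ℝ] E3} (hκ : κ '' S.tri0 = S.tri0) (hκm : κ ∈ motions)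
    (hne : κ '' S.tile ≠ S.tile)
    (hang : ∀ τ : ℝ, 0 < τ → τ < 1 → HasAngle (κ '' S.tile) (S.pt 0 τ 0) (Real.pi - S.sml)) :
    κ '' S.tile ∉ T := by
  intro hκT
  have h2 := S.two_hr_lt_sml
  have h3 := S.sml_lt hc
  have h4 := S.hr_pos
  have h5 := S.hr_le
  obtain ⟨τ, t0, t1, hgen⟩ := hT.exists_generic 0 S.b (zero_lt_one (α := ℝ))
  have e : (0 : E3) + τ • S.b = S.pt 0 τ 0 := by simp [pt]
  rw [e] at hgen
  refine hT.false_of_rest hS h1 hκ hκm hκT hne S.b_ne hgen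
    (S.mem_tri0.mpr (by simp; constructor <;> linarith)) (hS.hasAngle_base t0 t1)
    (hang τ t0 t1) (by linarith) ?_ ?_ hc
  -- The remaining angle `hr + sml` lies strictly between `3 * hr` and `4 * hr`, hence between `2 *
  -- hr` and twice this value.
  · intro k hk
    have : S.hr + S.sml = k * (2 * S.hr) := by linarith
    have k1 : (1 : ℝ) < k := by nlinarith
    have k2 : (k : ℝ) < 2 := by nlinarith
    have k3 : 1 < k := by exact_mod_cast k1
    have k4 : k < 2 := by exact_mod_cast k2
    omega
  · intro g _ g' _ _ _ _ _ o o' α β hα hβ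
    obtain ⟨α', a1, a2⟩ := hS.onTri_angle hc o
    obtain ⟨β', b1, b2⟩ := hS.onTri_angle hc o'
    rw [hα.unique a1.of_image, hβ.unique b1.of_image]
    linarith

/-- The base edge is not glued to the slope edge with the smaller angle. -/
lemma IsTiling.not_base_small (hT : S.IsTiling T) (hS : S.Equilateral) (hc : S.c ≠ 0)
    (h1 : S.tile ∈ T) {κ : E3 ≃ᵃⁱ[ℝ] E3} (hκ : κ '' S.tri0 = S.tri0) (hκm : κ ∈ motions)
    (hne : κ '' S.tile ≠ S.tile) {p u : E3} (hu : u ≠ 0)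
    (htri : ∀ τ : ℝ, 0 < τ → τ < 1 / 2 → p + τ • u ∈ S.tri0)
    (hang : ∀ τ : ℝ, 0 < τ → τ < 1 / 2 → HasAngle S.tile (p + τ • u) (Real.pi - S.sml))
    (hang' : ∀ τ : ℝ, 0 < τ → τ < 1 / 2 → HasAngle (κ '' S.tile) (p + τ • u) (Real.pi - S.sml))
    (hpair : ∀ T', S.IsTiling T' → S.tile ∈ T' → ∀ g ∈ motions, g '' S.tile ∈ T' →
      g '' S.tile ≠ S.tile → g '' S.tri0 = S.tri0 → ∀ q, S.OnTri q →
      HasAngle S.tile q S.sml → ¬ HasAngle (g '' S.tile) q S.sml) :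
    κ '' S.tile ∉ T := by
  intro hκT
  have h2 := S.two_hr_lt_sml
  have h3 := S.sml_lt hc
  have h4 := S.hr_pos
  have h5 := S.hr_le
  obtain ⟨τ, t0, t1, hgen⟩ := hT.exists_generic p u (one_half_pos (α := ℝ))
  refine hT.false_of_rest hS h1 hκ hκm hκT hne hu hgen (htri τ t0 t1) (hang τ t0 t1)
    (hang' τ t0 t1) (by linarith) ?_ ?_ hc
  -- The remaining angle `2 * sml` lies strictly between `4 * hr` and `6 * hr`.
  · intro k hk
    have : S.sml = k * S.hr := by linarith
    have k1 : (2 : ℝ) < k := by nlinarith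
    have k2 : (k : ℝ) < 3 := by nlinarith
    have k3 : 2 < k := by exact_mod_cast k1
    have k4 : k < 3 := by exact_mod_cast k2
    omega
  · intro g hg g' hg' hgT hgT' hgg htri' o o' α β hα hβ
    obtain ⟨α', a1, a2⟩ := hS.onTri_angle hc o
    obtain ⟨β', b1, b2⟩ := hS.onTri_angle hc o'
    rw [hα.unique a1.of_image, hβ.unique b1.of_image]
    -- Both angles are at least `sml`, so the pair fits only if both are equal to `sml`; this
    -- borderline gluing is what `hpair` forbids.
    by_contra hcon
    have a3 : α' = S.sml := by linarith
    have b3 : β' = S.sml := by linarith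
    rw [a3] at a1
    rw [b3] at b1
    have k1 : (g⁻¹ : E3 ≃ᵃⁱ[ℝ] E3) '' (g '' S.tile) = S.tile := inv_image _ _
    refine hpair _ (hT.map (inv_mem hg)) ?_ (g⁻¹ * g') (mul_mem (inv_mem hg) hg') ?_ ?_ ?_ _ o a1 ?_
    · have := image_mem_mapT (g := g⁻¹).mpr hgT
      rwa [k1] at this
    · rw [mul_image]; exact image_mem_mapT.mpr hgT'
    · rw [mul_image]
      intro h
      apply hgg
      have := congrArg (fun s => g '' s) h
      rwa [image_inv] at this
    · rw [mul_image, htri', inv_image]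
    · rw [mul_image]
      exact (b1.of_image).image g⁻¹

/-- Tiles adjacent across upright facets are translates of each other, in the equilateral case. -/
lemma IsTiling.eq_turnTop_of_equilateral (hT : S.IsTiling T) (hS : S.Equilateral) (hc : S.c ≠ 0)
    (h1 : S.tile ∈ T) {g : E3 ≃ᵃⁱ[ℝ] E3} (hm : g ∈ motions) (hg : g '' S.tile ∈ T)
    (hne : g '' S.tile ≠ S.tile) (h : g '' S.tri0 = S.tri0) : g = S.turnTop := by
  have h3 := S.sml_lt hc
  have h4 := S.hr_pos
  have h5 := S.hr_le
  have h6 := S.two_hr_lt_sml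
  -- points of the image of the tile, for the half-turns
  have hz : ∀ {q : E3} {α : ℝ}, HasAngle S.tile (S.turnZero q) α →
      HasAngle (S.turnZero '' S.tile) q α := fun h => by
    apply HasAngle.of_image; rwa [hS.turnZero_turnZero]
  have he : ∀ {q : E3} {α : ℝ}, HasAngle S.tile (S.turnEnd q) α →
      HasAngle (S.turnEnd '' S.tile) q α := fun h => by
    apply HasAngle.of_image; rwa [hS.turnEnd_turnEnd]
  have ht : ∀ {q : E3} {α : ℝ}, HasAngle (S.turnTop '' S.tile) q α →
      HasAngle S.tile (S.turnTop q) α := fun h => by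
    have := h.image S.turnTop⁻¹
    rwa [inv_image, turnTop_turnTop] at this
  have hz' : ∀ {q : E3} {α : ℝ}, HasAngle (S.turnZero '' S.tile) q α →
      HasAngle S.tile (S.turnZero q) α := fun h => by
    have := h.image S.turnZero⁻¹
    rwa [inv_image, hS.turnZero_turnZero] at this
  have he' : ∀ {q : E3} {α : ℝ}, HasAngle (S.turnEnd '' S.tile) q α →
      HasAngle S.tile (S.turnEnd q) α := fun h => by
    have := h.image S.turnEnd⁻¹
    rwa [inv_image, hS.turnEnd_turnEnd] at this
  have hsl : ∀ t, 0 < t → t < 1 / 2 → HasAngle S.tile (S.pt 0 t t) S.slope := fun t a b =>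
    hS.hasAngle_slope a b
  have hsl' : ∀ t, 1 / 2 < t → t < 1 →
      HasAngle S.tile (S.pt 0 t (1 - t)) (Real.pi - S.slope) := fun t a b => by
    have := hS.hasAngle_slope' (t := 1 - t) (by linarith) (by linarith)
    rwa [sub_sub_cancel] at this
  rcases lt_or_gt_of_ne hc with hc' | hc'
  · have e1 : S.slope = Real.pi - S.sml := S.slope_cases.2 hc'
    rw [e1] at hsl hsl'
    rw [sub_sub_cancel] at hsl'
    -- For `c < 0` this half-turn puts the slope edge `[0, apex]`, with the larger angle `π - sml`,
    -- onto the base edge.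
    have big : ∀ T' : Set (Set E3), S.IsTiling T' → S.tile ∈ T' → S.turnZero '' S.tile ≠ S.tile →
        S.turnZero '' S.tile ∉ T' := by
      intro T' hT' h1 hne
      refine hT'.not_base_large hS hc h1 hS.turnZero_tri0 S.turnZero_mem hne ?_
      intro τ a b
      apply hz
      rw [hS.turnZero_pt]
      convert hsl (τ / 2) (by linarith) (by linarith) using 2 <;> ring
    rcases hT.neighbor_cases h1 hm hg hne h with h | ⟨-, rfl | rfl⟩
    · exact h
    · exact absurd hg (big T hT h1 hne)
    exfalso
    -- The contradiction is found not at the base edge but at the slope edge `[0, apex]`, which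
    -- `turnEnd` reverses: there both tiles have the angle `π - sml`.
    refine hT.not_base_small hS hc h1 hS.turnEnd_tri0 hm hne (p := 0) (u := S.pt 0 1 1) ?_ ?_ ?_ ?_
      ?_ hg
    · intro h; have := congrArg S.ct h; simp at this
    · intro τ a b
      rw [mem_tri0]; simp; constructor <;> linarith
    · intro τ a b
      rw [smul_pt]; simpa using hsl τ a b
    · intro τ a b
      apply he
      rw [smul_pt, zero_add, mul_zero, mul_one, hS.turnEnd_pt]
      convert hsl (1 / 2 - τ) (by linarith) (by linarith) using 2 <;> ring
    · intro T' hT' h1 g hm hg hne h q hq ha hb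
      obtain ⟨t, t0, t1, rfl⟩ : ∃ t, 0 < t ∧ t < 1 / 2 ∧ q = S.pt 0 (1 - t) t := by
        rcases hq with ⟨t, h1, h2, rfl⟩ | ⟨t, h1, h2, rfl⟩ | h | ⟨t, z, h1, h2, h3, rfl⟩
        · have := ha.unique (hS.hasAngle_base h1 h2); linarith
        · have := ha.unique (hsl t h1 h2); linarith
        · exact h
        · have := ha.unique (hasAngle_tri h1 h2 h3); linarith
      -- Opposite an edge with angle `sml`, `turnTop` brings the other slope edge, with angle `π -
      -- sml`, and `turnEnd` brings the base edge, with angle `π - hr`; `turnZero` is already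
      -- excluded.
      rcases hT'.neighbor_cases h1 hm hg hne h with rfl | ⟨-, rfl | rfl⟩
      · have h2 := ht hb
        rw [turnTop_pt] at h2
        have h3 := h2.unique (by convert hsl t t0 t1 using 2 <;> ring)
        linarith
      · exact big T' hT' h1 hne hg
      · have h2 := he' hb
        rw [hS.turnEnd_pt] at h2
        have h3 := h2.unique (by
          convert hS.hasAngle_base (t := 1 - 2 * t) (by linarith) (by linarith) using 2 <;> ring)
        linarith
  -- For `c > 0` the two slope edges, and with them `turnZero` and `turnEnd`, exchange their roles.
  · have e1 : S.slope = S.sml := S.slope_cases.1 hc'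
    rw [e1] at hsl hsl'
    have big : ∀ T' : Set (Set E3), S.IsTiling T' → S.tile ∈ T' → S.turnEnd '' S.tile ≠ S.tile →
        S.turnEnd '' S.tile ∉ T' := by
      intro T' hT' h1 hne
      refine hT'.not_base_large hS hc h1 hS.turnEnd_tri0 S.turnEnd_mem hne ?_
      intro τ a b
      apply he
      rw [hS.turnEnd_pt]
      convert hsl' ((1 + τ) / 2) (by linarith) (by linarith) using 2 <;> ring
    rcases hT.neighbor_cases h1 hm hg hne h with h | ⟨-, rfl | rfl⟩
    · exact h
    swap
    · exact absurd hg (big T hT h1 hne)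
    exfalso
    refine hT.not_base_small hS hc h1 hS.turnZero_tri0 hm hne (p := S.b) (u := S.pt 0 (-1) 1) ?_ ?_
      ?_ ?_ ?_ hg
    · intro h; have := congrArg S.ct h; simp at this
    · intro τ a b
      rw [mem_tri0]; simp; constructor <;> linarith
    · intro τ a b
      rw [smul_pt, ← S.pt_b, pt_add]
      convert hsl' (1 - τ) (by linarith) (by linarith) using 2 <;> ring
    · intro τ a b
      apply hz
      rw [smul_pt, ← S.pt_b, pt_add, mul_zero, add_zero, hS.turnZero_pt]
      convert hsl' (1 / 2 + τ) (by linarith) (by linarith) using 2 <;> ring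
    · intro T' hT' h1 g hm hg hne h q hq ha hb
      obtain ⟨t, t0, t1, rfl⟩ : ∃ t, 0 < t ∧ t < 1 / 2 ∧ q = S.pt 0 t t := by
        rcases hq with ⟨t, h1, h2, rfl⟩ | h | ⟨t, h1, h2, rfl⟩ | ⟨t, z, h1, h2, h3, rfl⟩
        · have := ha.unique (hS.hasAngle_base h1 h2); linarith
        · exact h
        · have := ha.unique (hS.hasAngle_slope' h1 h2); linarith
        · have := ha.unique (hasAngle_tri h1 h2 h3); linarith
      rcases hT'.neighbor_cases h1 hm hg hne h with rfl | ⟨-, rfl | rfl⟩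
      · have h2 := ht hb
        rw [turnTop_pt] at h2
        have h3 := h2.unique (by
          convert hsl' (1 - t) (by linarith) (by linarith) using 2 <;> ring)
        linarith
      · have h2 := hz' hb
        rw [hS.turnZero_pt] at h2
        have h3 := h2.unique (by
          convert hS.hasAngle_base (t := 2 * t) (by linarith) (by linarith) using 2 <;> ring)
        linarith
      · exact big T' hT' h1 hne hg

/-! ### Tiles across upright facets are translates, in general -/

/-- Tiles adjacent across upright facets are translates of each other. -/
lemma IsTiling.eq_turnTop (hT : S.IsTiling T) (hc : S.c ≠ 0)
    (h1 : S.tile ∈ T) {g : E3 ≃ᵃⁱ[ℝ] E3} (hm : g ∈ motions) (hg : g '' S.tile ∈ T)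
    (hne : g '' S.tile ≠ S.tile) (h : g '' S.tri0 = S.tri0) : g = S.turnTop := by
  by_cases hS : S.Equilateral
  · exact hT.eq_turnTop_of_equilateral hS hc h1 hm hg hne h
  · exact (hT.neighbor_cases h1 hm hg hne h).resolve_right fun h => hS h.1

lemma turnTop_tile : S.turnTop '' S.tile = tr (-S.a) '' S.tile := by
  rw [turnTop, mul_image, turnV_tile]

/-- The translates of a tile by the sides of its rhombus are tiles. -/
lemma IsTiling.translate_mem (hT : S.IsTiling T) (hc : S.c ≠ 0) (h1 : S.tile ∈ T) :
    tr S.a '' S.tile ∈ T ∧ tr (-S.a) '' S.tile ∈ T ∧ tr S.b '' S.tile ∈ T ∧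
      tr (-S.b) '' S.tile ∈ T := by
  have key : ∀ T' : Set (Set E3), S.IsTiling T' → S.tile ∈ T' → tr (-S.a) '' S.tile ∈ T' := by
    intro T' hT' h1
    have e : ∀ s : Set E3, (1 : E3 ≃ᵃⁱ[ℝ] E3) '' s = s := fun s => image_id _
    obtain ⟨g, hg, h2, h3, h4⟩ := hT'.exists_neighbor (one_mem _) (by rwa [e])
    rw [e] at h3 h4
    have h5 := hT'.eq_turnTop hc h1 hg h2 h3 h4
    rw [← turnTop_tile, ← h5]; exact h2
  -- The other three triangular facets are treated by conjugating with a symmetry `d` of the tile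
  -- that carries `tri0` to them.
  have conj : ∀ d ∈ motions, d '' S.tile = S.tile → ∀ v, d (d v) = v →
      (∀ x, d (-S.a + d x) = v + x) → tr v '' S.tile ∈ T := by
    intro d hd h2 v hdd h3
    have hm : d⁻¹ ∈ motions := inv_mem hd
    have h4 : (d⁻¹ : E3 ≃ᵃⁱ[ℝ] E3) '' S.tile = S.tile := by
      conv_lhs => rw [← h2]
      exact inv_image _ _
    have h5 : S.tile ∈ mapT d⁻¹ T := by
      have := image_mem_mapT (g := d⁻¹).mpr h1
      rwa [h4] at this
    have h6 := key _ (hT.map hm) h5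
    rw [mem_mapT, ← mul_image] at h6
    have h7 : (d⁻¹⁻¹ * tr (-S.a)) '' S.tile = tr v '' S.tile := by
      conv_lhs => rw [← h2]
      rw [← mul_image]
      congr 1
      funext x
      exact h3 x
    rwa [h7] at h6
  refine ⟨?_, key T hT h1, ?_, ?_⟩
  · refine conj S.turnV S.turnV_mem S.turnV_tile _ (S.turnV_turnV _) fun x => ?_
    apply S.ext_coord <;> simp [cs_turnV, ct_turnV, cz_turnV]
    ring
  · refine conj (S.turnD * S.turnV) (mul_mem S.turnD_mem S.turnV_mem)
      (by rw [mul_image, turnV_tile, turnD_tile]) _ ?_ fun x => ?_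
    · change S.turnD (S.turnV (S.turnD (S.turnV _))) = _
      apply S.ext_coord <;> simp [cs_turnV, ct_turnV, cz_turnV, cs_turnD, ct_turnD, cz_turnD]
    · change S.turnD (S.turnV (_ + S.turnD (S.turnV x))) = _
      apply S.ext_coord <;> simp [cs_turnV, ct_turnV, cz_turnV, cs_turnD, ct_turnD, cz_turnD]
      ring
  · refine conj S.turnD S.turnD_mem S.turnD_tile _ (S.turnD_turnD _) fun x => ?_
    apply S.ext_coord <;> simp [cs_turnD, ct_turnD, cz_turnD]

end Shape

/-! ### The distance to the integers -/

/-- The distance to the nearest integer. -/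
noncomputable def tri (x : ℝ) : ℝ := |x - round x|

lemma tri_nonneg (x : ℝ) : 0 ≤ tri x := abs_nonneg _

lemma tri_le_half (x : ℝ) : tri x ≤ 1 / 2 := abs_sub_round x

lemma tri_eq_min (x : ℝ) : tri x = min (Int.fract x) (1 - Int.fract x) := abs_sub_round_eq_min x

lemma tri_le (x : ℝ) (m : ℤ) : tri x ≤ |x - m| := round_le x m

lemma tri_add_int (x : ℝ) (m : ℤ) : tri (x + m) = tri x := by
  rw [tri_eq_min, tri_eq_min, Int.fract_add_intCast]

lemma tri_sub_int (x : ℝ) (m : ℤ) : tri (x - m) = tri x := by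
  rw [tri_eq_min, tri_eq_min, Int.fract_sub_intCast]

lemma tri_of_mem {x : ℝ} (h0 : 0 ≤ x) (h1 : x ≤ 1) : tri x = min x (1 - x) := by
  rcases eq_or_lt_of_le h1 with rfl | h1
  · rw [tri_eq_min, Int.fract_one]; simp
  · rw [tri_eq_min, Int.fract_eq_self.mpr ⟨h0, h1⟩]

lemma tri_zero : tri 0 = 0 := by rw [tri_of_mem le_rfl zero_le_one]; simp

lemma tri_half : tri (1 / 2) = 1 / 2 := by
  rw [tri_of_mem (by norm_num) (by norm_num)]; norm_num

lemma tri_lipschitz (x y : ℝ) : tri x ≤ tri y + |x - y| := by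
  have h1 := tri_le x (round y)
  have h2 := abs_sub_le x y (round y)
  unfold tri at *
  linarith

lemma continuous_tri : Continuous tri := by
  refine (LipschitzWith.of_dist_le_mul (K := 1) fun x y => ?_).continuous
  rw [NNReal.coe_one, one_mul, Real.dist_eq, Real.dist_eq, abs_le]
  have h1 := tri_lipschitz x y
  have h2 := tri_lipschitz y x
  rw [abs_sub_comm y x] at h2
  constructor <;> linarith

/-- This symmetry of the zigzag profile is the reason why consecutive layers fit together without a
gap: the valleys of one are complementary to the ridges of the next. -/
lemma tri_half_sub (x : ℝ) : tri (1 / 2 - x) = 1 / 2 - tri x := by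
  have hx : x = Int.fract x + ⌊x⌋ := (Int.fract_add_floor x).symm
  have h0 := Int.fract_nonneg x
  have h1 := (Int.fract_lt_one x).le
  set f := Int.fract x
  have e : tri (1 / 2 - x) = tri (1 / 2 - f) := by
    rw [hx, ← sub_sub, tri_sub_int]
  rw [e, hx, tri_add_int, tri_of_mem h0 h1]
  rcases le_total f (1 / 2) with h | h
  · rw [tri_of_mem (by linarith) (by linarith), min_eq_left (by linarith),
      min_eq_left (by linarith)]
  · have : tri (1 / 2 - f) = tri (1 / 2 - f + (1 : ℤ)) := (tri_add_int _ _).symm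
    rw [this, tri_of_mem (by push_cast; linarith) (by push_cast; linarith),
      min_eq_right (by push_cast; linarith), min_eq_right (by linarith)]
    push_cast; ring

lemma exists_int_of_tri_eq_zero {x : ℝ} (h : tri x = 0) : ∃ m : ℤ, x = m :=
  ⟨round x, by rw [tri, abs_eq_zero] at h; linarith⟩

namespace Shape

variable (S : Shape)

/-! ### The lattice of a layer -/

/-- The lattice generated by the sides of the rhombus. -/
noncomputable def lattice : AddSubgroup E3 where
  carrier := {x | ∃ m n : ℤ, x = S.pt m n 0}
  zero_mem' := ⟨0, 0, by simp [pt]⟩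
  add_mem' := by
    rintro _ _ ⟨m, n, rfl⟩ ⟨m', n', rfl⟩
    exact ⟨m + m', n + n', by rw [pt_add]; push_cast; simp⟩
  neg_mem' := by
    rintro _ ⟨m, n, rfl⟩
    exact ⟨-m, -n, by rw [← neg_one_smul ℝ, smul_pt]; push_cast; simp⟩

variable {S}

lemma a_mem_lattice : S.a ∈ S.lattice := ⟨1, 0, by rw [← S.pt_a]; simp⟩

lemma cz_lattice {x : E3} (hx : x ∈ S.lattice) : S.cz x = 0 := by
  obtain ⟨m, n, rfl⟩ := hx; simp

lemma tr_mul (v w : E3) : tr v * tr w = tr (v + w) := by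
  ext1 x; change v + (w + x) = v + w + x; rw [add_assoc]

lemma tr_zero : tr 0 = 1 := by ext1 x; exact zero_add x

lemma tr_inv (v : E3) : (tr v)⁻¹ = tr (-v) :=
  inv_eq_of_mul_eq_one_left (by rw [tr_mul, neg_add_cancel, tr_zero])

lemma mul_tr (g : E3 ≃ᵃⁱ[ℝ] E3) (v : E3) : g * tr v = tr (lin g v) * g := by
  ext1 x
  change g (v + x) = lin g v + g x
  rw [add_comm, map_add_lin, add_comm]

lemma one_image (s : Set E3) : (1 : E3 ≃ᵃⁱ[ℝ] E3) '' s = s := image_id _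

/-- Translates of the prototile by different vectors are different. -/
lemma tr_tile_injective {v w : E3} (h : tr v '' S.tile = tr w '' S.tile) : v = w := by
  -- Equal translates have equal maxima of linear functionals; the three coordinates serve as
  -- functionals.
  have key : ∀ f : E3 →L[ℝ] ℝ, ∀ x ∈ S.tile, (∀ y ∈ S.tile, f y ≤ f x) → ∀ v w : E3,
      tr v '' S.tile = tr w '' S.tile → f v ≤ f w := by
    intro f x hx hmax v w h
    have h1 : tr v x ∈ tr w '' S.tile := h ▸ mem_image_of_mem _ hx
    obtain ⟨y, hy, hxy⟩ := h1
    have h2 := congrArg f hxy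
    rw [tr_apply, tr_apply, map_add, map_add] at h2
    linarith [hmax y hy]
  have key' : ∀ f : E3 →L[ℝ] ℝ, ∀ x ∈ S.tile, (∀ y ∈ S.tile, f y ≤ f x) → f v = f w :=
    fun f x hx hmax => le_antisymm (key f x hx hmax v w h) (key f x hx hmax w v h.symm)
  apply S.ext_coord
  · refine key' S.cs S.a (by rw [mem_tile]; simp) fun y hy => ?_
    rw [cs_a]; exact (S.mem_tile.mp hy).1.2
  · refine key' S.ct S.b (by rw [mem_tile]; simp) fun y hy => ?_
    rw [ct_b]; exact (S.mem_tile.mp hy).2.1.2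
  · refine key' S.cz S.apex (S.tri0_subset_tile (S.mem_tri0.mpr (by simp [apex]; norm_num)))
      fun y hy => ?_
    obtain ⟨-, -, ⟨h1, h2⟩, -⟩ := S.mem_tile.mp hy
    simp [apex]; linarith

lemma IsTiling.map_inv {T : Set (Set E3)} (hT : S.IsTiling T) {g : E3 ≃ᵃⁱ[ℝ] E3}
    (hg : g ∈ motions) (h : g '' S.tile ∈ T) :
    S.IsTiling (mapT g⁻¹ T) ∧ S.tile ∈ mapT g⁻¹ T := by
  refine ⟨hT.map (inv_mem hg), ?_⟩
  have := image_mem_mapT (g := g⁻¹).mpr h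
  rwa [inv_image] at this

lemma mul_image_mem {T : Set (Set E3)} {g k : E3 ≃ᵃⁱ[ℝ] E3} {s : Set E3} :
    k '' s ∈ mapT g⁻¹ T ↔ (g * k) '' s ∈ T := by
  rw [mem_mapT, inv_inv, mul_image]

/-- The lattice translates of a tile are tiles. -/
lemma IsTiling.lattice_mem {T : Set (Set E3)} (hT : S.IsTiling T) (hc : S.c ≠ 0)
    {g : E3 ≃ᵃⁱ[ℝ] E3} (hg : g ∈ motions) (h : g '' S.tile ∈ T) {v : E3} (hv : v ∈ S.lattice) :
    (g * tr v) '' S.tile ∈ T := by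
  have step : ∀ w, (g * tr w) '' S.tile ∈ T → (g * tr (w + S.a)) '' S.tile ∈ T ∧
      (g * tr (w - S.a)) '' S.tile ∈ T ∧ (g * tr (w + S.b)) '' S.tile ∈ T ∧
      (g * tr (w - S.b)) '' S.tile ∈ T := by
    intro w hw
    obtain ⟨h1, h2⟩ := hT.map_inv (mul_mem hg (tr_mem w)) hw
    have := h1.translate_mem hc h2
    simp only [mul_image_mem, mul_assoc, tr_mul] at this
    exact this
  obtain ⟨m, n, rfl⟩ := hv
  have hm : ∀ m : ℤ, (g * tr (S.pt m 0 0)) '' S.tile ∈ T := by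
    intro m
    induction m using Int.induction_on with
    | zero => rw [Int.cast_zero, S.pt_zero, tr_zero, mul_one]; exact h
    | succ i ih =>
      have := (step _ ih).1
      rw [← S.pt_a, pt_add, add_zero] at this
      push_cast at this ⊢
      exact this
    | pred i ih =>
      have := (step _ ih).2.1
      rw [← S.pt_a, pt_sub, sub_zero] at this
      push_cast at this ⊢
      exact this
  induction n using Int.induction_on with
  | zero => rw [Int.cast_zero]; exact hm m
  | succ i ih =>
    have := (step _ ih).2.2.1
    rw [← S.pt_b, pt_add, add_zero, add_zero] at this
    push_cast at this ⊢
    exact this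
  | pred i ih =>
    have := (step _ ih).2.2.2
    rw [← S.pt_b, pt_sub, sub_zero, sub_zero] at this
    push_cast at this ⊢
    exact this

variable (S)

/-! ### Layers -/

/-- The layer of translates of the prototile. -/
def layer : Set E3 := {x | -tri (S.cs x) ≤ S.cz x ∧ S.cz x ≤ tri (S.ct x)}

/-- The open core of the layer. -/
def core : Set E3 := {x | -tri (S.cs x) < S.cz x ∧ S.cz x < tri (S.ct x)}

variable {S}

lemma core_subset_layer : S.core ⊆ S.layer := fun _ hx => ⟨hx.1.le, hx.2.le⟩

lemma isOpen_core : IsOpen S.core := by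
  have h1 : Continuous fun x => tri (S.cs x) := continuous_tri.comp S.cs.continuous
  have h2 : Continuous fun x => tri (S.ct x) := continuous_tri.comp S.ct.continuous
  refine IsOpen.and ?_ ?_
  · exact isOpen_lt h1.neg S.cz.continuous
  · exact isOpen_lt S.cz.continuous h2

/-- Over the unit cell the functions `tri` are the roofs of a single tile, and they are periodic
under the lattice. -/
lemma mem_layer {x : E3} : x ∈ S.layer ↔ ∃ v ∈ S.lattice, x ∈ tr v '' S.tile := by
  constructor
  · rintro ⟨h1, h2⟩
    refine ⟨S.pt ⌊S.cs x⌋ ⌊S.ct x⌋ 0, ⟨_, _, rfl⟩, ?_⟩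
    rw [mem_image_iff, tr_inv, tr_apply, mem_tile]
    rw [tri_eq_min] at h1 h2
    simp only [map_add, map_neg, cs_pt, ct_pt, cz_pt, neg_zero, zero_add]
    have e1 : -(⌊S.cs x⌋ : ℝ) + S.cs x = Int.fract (S.cs x) := by rw [Int.fract]; ring
    have e2 : -(⌊S.ct x⌋ : ℝ) + S.ct x = Int.fract (S.ct x) := by rw [Int.fract]; ring
    rw [e1, e2]
    have := min_le_left (Int.fract (S.cs x)) (1 - Int.fract (S.cs x))
    have := min_le_right (Int.fract (S.cs x)) (1 - Int.fract (S.cs x))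
    have := min_le_left (Int.fract (S.ct x)) (1 - Int.fract (S.ct x))
    have := min_le_right (Int.fract (S.ct x)) (1 - Int.fract (S.ct x))
    refine ⟨⟨Int.fract_nonneg _, (Int.fract_lt_one _).le⟩, ⟨Int.fract_nonneg _,
      (Int.fract_lt_one _).le⟩, ⟨by linarith, by linarith⟩, by linarith, by linarith⟩
  · rintro ⟨_, ⟨m, n, rfl⟩, y, hy, rfl⟩
    obtain ⟨⟨h1, h2⟩, ⟨h3, h4⟩, ⟨h5, h6⟩, h7, h8⟩ := S.mem_tile.mp hy
    have e1 : S.cs (tr (S.pt m n 0) y) = S.cs y + m := by rw [tr_apply, map_add, cs_pt, add_comm]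
    have e2 : S.ct (tr (S.pt m n 0) y) = S.ct y + n := by rw [tr_apply, map_add, ct_pt, add_comm]
    have e3 : S.cz (tr (S.pt m n 0) y) = S.cz y := by rw [tr_apply, map_add, cz_pt, zero_add]
    change -tri _ ≤ _ ∧ _ ≤ tri _
    rw [e1, e2, e3, tri_add_int, tri_add_int, tri_of_mem h1 h2, tri_of_mem h3 h4]
    exact ⟨by linarith [le_min h7 h8], le_min h5 h6⟩

lemma tile_subset_layer : S.tile ⊆ S.layer := fun x hx =>
  mem_layer.mpr ⟨0, zero_mem _, by rw [tr_zero, one_image]; exact hx⟩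

/-- Overlapping layers share a tile. -/
lemma IsTiling.exists_common {T : Set (Set E3)} (hT : S.IsTiling T) (hc : S.c ≠ 0)
    {g g' : E3 ≃ᵃⁱ[ℝ] E3} (hg : g ∈ motions) (hgT : g '' S.tile ∈ T) (hg' : g' ∈ motions)
    (hgT' : g' '' S.tile ∈ T) {x : E3} (hx : x ∈ g '' S.core) (hx' : x ∈ g' '' S.layer) :
    ∃ v ∈ S.lattice, ∃ w ∈ S.lattice, (g * tr v) '' S.tile = (g' * tr w) '' S.tile := by
  rw [mem_image_iff, mem_layer] at hx'
  obtain ⟨w, hw, hx'⟩ := hx'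
  rw [← mem_image_iff, ← mul_image] at hx'
  have hwT := hT.lattice_mem hc hg' hgT' hw
  obtain ⟨y, hy, hy'⟩ := hT.exists_interior hwT hx'
    ((g.toHomeomorph.isOpenMap) _ isOpen_core) hx
  have hy1 : y ∈ g '' S.layer := image_mono core_subset_layer hy
  rw [mem_image_iff, mem_layer] at hy1
  obtain ⟨v, hv, hy1⟩ := hy1
  rw [← mem_image_iff, ← mul_image] at hy1
  exact ⟨v, hv, w, hw, (hT.eq_of_inter hwT (hT.lattice_mem hc hg hgT hv) hy' hy1).symm⟩

/-- A symmetry of a tile maps the first side of the rhombus to a lattice vector. -/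
lemma IsTiling.symm_a {T : Set (Set E3)} (hT : S.IsTiling T) (hc : S.c ≠ 0) (h1 : S.tile ∈ T)
    {σ : E3 ≃ᵃⁱ[ℝ] E3} (hm : σ ∈ motions) (hσ : σ '' S.tile = S.tile) :
    lin σ S.a ∈ S.lattice := by
  set v := lin σ S.a with hv
  have hvT : tr v '' S.tile ∈ T := by
    have := hT.lattice_mem hc hm (hσ.symm ▸ h1) a_mem_lattice
    rwa [mul_tr, mul_image, hσ] at this
  -- If the translate by `v` overlaps the layer, both share a tile, and `v` is a difference of
  -- lattice vectors.
  have hshare : ∀ x : E3, x ∈ S.core → x - v ∈ S.layer → v ∈ S.lattice := by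
    intro x hx hx'
    obtain ⟨u, hu, w, hw, h⟩ := hT.exists_common hc (one_mem _) (by rwa [one_image]) (tr_mem v)
      hvT (x := x) (by rwa [one_image]) (by rw [mem_image_iff, tr_inv, tr_apply, neg_add_eq_sub]
                                            exact hx')
    rw [one_mul, tr_mul] at h
    have := tr_tile_injective h
    have e : v = u - w := by rw [this]; abel
    rw [e]; exact sub_mem hu hw
  have hmem : ∀ x ∈ S.tile, σ x ∈ S.tile := fun x hx => hσ ▸ mem_image_of_mem _ hx
  have hz : ∀ x ∈ S.tile, -(1 / 2) ≤ S.cz x ∧ S.cz x ≤ 1 / 2 := by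
    intro x hx
    obtain ⟨-, -, ⟨h5, h6⟩, h7, h8⟩ := S.mem_tile.mp hx
    constructor <;> linarith
  have h00 : (0 : E3) ∈ S.tile := by rw [mem_tile]; simp
  have haa : S.a ∈ S.tile := by rw [mem_tile]; simp
  have hb0 : S.b ∈ S.tile := by rw [mem_tile]; simp
  have hba : S.b + S.a ∈ S.tile := by rw [mem_tile]; simp
  have hp0 : S.apex ∈ S.tile := by rw [mem_tile]; simp [apex]; norm_num
  have hpa : S.apex + S.a ∈ S.tile := by rw [mem_tile]; simp [apex]; norm_num
  have hva : σ S.a = σ 0 + v := by rw [hv, ← map_add_lin, zero_add]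
  by_cases hz0 : |S.cz v| < 1
  · rw [abs_lt] at hz0
    -- The witness is chosen at half the height of `v`, on a ridge line of both layers in the
    -- horizontal projection, where each reaches `1 / 2` towards the other.
    rcases lt_trichotomy (S.cz v) 0 with h | h | h
    · refine hshare (S.pt (1 / 2) (1 / 2 + S.ct v) (S.cz v / 2)) ?_ ?_
      · change -tri _ < _ ∧ _ < tri _
        simp only [cs_pt, ct_pt, cz_pt, tri_half]
        exact ⟨by linarith, by linarith [tri_nonneg (1 / 2 + S.ct v)]⟩
      · change -tri _ ≤ _ ∧ _ ≤ tri _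
        simp only [map_sub, cs_pt, ct_pt, cz_pt, add_sub_cancel_right, tri_half]
        exact ⟨by linarith [tri_nonneg (1 / 2 - S.cs v)], by linarith⟩
    · refine hshare (S.pt (1 / 2) (1 / 2) 0) ?_ ?_
      · change -tri _ < _ ∧ _ < tri _
        simp only [cs_pt, ct_pt, cz_pt, tri_half]
        norm_num
      · change -tri _ ≤ _ ∧ _ ≤ tri _
        simp only [map_sub, cz_pt, h, sub_zero]
        exact ⟨neg_nonpos.mpr (tri_nonneg _), tri_nonneg _⟩
    · refine hshare (S.pt (1 / 2 + S.cs v) (1 / 2) (S.cz v / 2)) ?_ ?_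
      · change -tri _ < _ ∧ _ < tri _
        simp only [cs_pt, ct_pt, cz_pt, tri_half]
        exact ⟨by linarith [tri_nonneg (1 / 2 + S.cs v)], by linarith⟩
      · change -tri _ ≤ _ ∧ _ ≤ tri _
        simp only [map_sub, cs_pt, ct_pt, cz_pt, add_sub_cancel_right, tri_half]
        exact ⟨by linarith, by linarith [tri_nonneg (1 / 2 - S.ct v)]⟩
  -- The tile has total height `1` in the coordinate `z`. A shift by at least `1` would force the
  -- images of `0`, `b` and `apex` onto a single ridge, although these points are not collinear.
  · exfalso
    have hadd : ∀ x ∈ S.tile, x + S.a ∈ S.tile → S.cz (σ (x + S.a)) = S.cz (σ x) + S.cz v ∧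
        -(1 / 2) ≤ S.cz (σ x) ∧ S.cz (σ x) ≤ 1 / 2 ∧ -(1 / 2) ≤ S.cz (σ x) + S.cz v ∧
        S.cz (σ x) + S.cz v ≤ 1 / 2 := by
      intro x hx hxa
      have e : S.cz (σ (x + S.a)) = S.cz (σ x) + S.cz v := by rw [map_add_lin, map_add]
      have h2 := hz _ (hmem x hx)
      have h3 := hz _ (hmem _ hxa)
      rw [e] at h3
      exact ⟨e, h2.1, h2.2, h3.1, h3.2⟩
    obtain ⟨-, a1, a2, a3, a4⟩ := hadd 0 h00 (by rwa [zero_add])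
    obtain ⟨-, b1, b2, b3, b4⟩ := hadd _ hb0 hba
    obtain ⟨-, c1, c2, c3, c4⟩ := hadd _ hp0 hpa
    have hcol : ∀ (w : E3) (α β : ℝ), lin σ S.b = α • w → lin σ S.apex = β • w → False := by
      intro w α β h2 h3
      have h4 : lin σ (β • S.b) = lin σ (α • S.apex) := by
        rw [map_smul, map_smul, h2, h3, smul_comm]
      have h5 := congrArg S.cz ((lin σ).injective h4)
      simp [apex] at h5
      rw [h5, zero_smul] at h2
      exact lin_ne_zero σ S.b_ne h2
    have hb' : lin σ S.b = σ S.b - σ 0 := by rw [← lin_sub, sub_zero]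
    have hp' : lin σ S.apex = σ S.apex - σ 0 := by rw [← lin_sub, sub_zero]
    have hup : ∀ x ∈ S.tile, S.cz x = 1 / 2 → S.ct x = 1 / 2 := by
      intro x hx h
      obtain ⟨-, -, ⟨h5, h6⟩, -⟩ := S.mem_tile.mp hx
      linarith
    have hlo : ∀ x ∈ S.tile, S.cz x = -(1 / 2) → S.cs x = 1 / 2 := by
      intro x hx h
      obtain ⟨-, -, -, h7, h8⟩ := S.mem_tile.mp hx
      linarith
    rcases le_abs.mp (not_lt.mp hz0) with h | h
    · have z0 : S.cz (σ 0) = -(1 / 2) := by linarith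
      have z1 : S.cz (σ S.b) = -(1 / 2) := by linarith
      have z2 : S.cz (σ S.apex) = -(1 / 2) := by linarith
      refine hcol S.b (S.ct (σ S.b - σ 0)) (S.ct (σ S.apex - σ 0)) ?_ ?_
      · rw [hb']
        apply S.ext_coord <;>
          simp [z0, z1, hlo _ (hmem _ h00) z0, hlo _ (hmem _ hb0) z1]
      · rw [hp']
        apply S.ext_coord <;>
          simp [z0, z2, hlo _ (hmem _ h00) z0, hlo _ (hmem _ hp0) z2]
    · have z0 : S.cz (σ 0) = 1 / 2 := by linarith
      have z1 : S.cz (σ S.b) = 1 / 2 := by linarith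
      have z2 : S.cz (σ S.apex) = 1 / 2 := by linarith
      refine hcol S.a (S.cs (σ S.b - σ 0)) (S.cs (σ S.apex - σ 0)) ?_ ?_
      · rw [hb']
        apply S.ext_coord <;>
          simp [z0, z1, hup _ (hmem _ h00) z0, hup _ (hmem _ hb0) z1]
      · rw [hp']
        apply S.ext_coord <;>
          simp [z0, z2, hup _ (hmem _ h00) z0, hup _ (hmem _ hp0) z2]

lemma lin_turnD_pt (s t z : ℝ) : lin S.turnD (S.pt s t z) = S.pt t s (-z) := by
  have : lin S.turnD (S.pt s t z) = S.turnD (S.pt s t z) - S.turnD 0 := by rw [← lin_sub, sub_zero]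
  rw [this, turnD_pt, ← S.pt_zero, turnD_pt, pt_sub]; simp

/-- A symmetry of a tile preserves the lattice of its layer. -/
lemma IsTiling.symm_lattice {T : Set (Set E3)} (hT : S.IsTiling T) (hc : S.c ≠ 0)
    (h1 : S.tile ∈ T) {σ : E3 ≃ᵃⁱ[ℝ] E3} (hm : σ ∈ motions) (hσ : σ '' S.tile = S.tile) {v : E3}
    (hv : v ∈ S.lattice) : lin σ v ∈ S.lattice := by
  have ha := hT.symm_a hc h1 hm hσ
  have hb : lin σ S.b ∈ S.lattice := by
    have h2 := hT.symm_a hc h1 (mul_mem hm S.turnD_mem) (by rw [mul_image, turnD_tile, hσ])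
    rw [lin_mul, LinearIsometryEquiv.coe_mul, Function.comp_apply, ← S.pt_a, lin_turnD_pt,
      neg_zero, S.pt_b] at h2
    exact h2
  obtain ⟨m, n, rfl⟩ := hv
  have : lin σ (S.pt m n 0) = m • lin σ S.a + n • lin σ S.b := by
    simp [pt, Int.cast_smul_eq_zsmul]
  rw [this]
  exact add_mem (zsmul_mem ha _) (zsmul_mem hb _)

/-- Layers sharing a tile have the same lattice. -/
lemma IsTiling.lattice_eq {T : Set (Set E3)} (hT : S.IsTiling T) (hc : S.c ≠ 0)
    {g g' : E3 ≃ᵃⁱ[ℝ] E3} (hg : g ∈ motions) (hgT : g '' S.tile ∈ T) (hg' : g' ∈ motions)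
    (h : g '' S.tile = g' '' S.tile) {v : E3} (hv : v ∈ S.lattice) :
    ∃ w ∈ S.lattice, lin g v = lin g' w := by
  obtain ⟨h1, h2⟩ := hT.map_inv hg' (h ▸ hgT)
  refine ⟨lin (g'⁻¹ * g) v, h1.symm_lattice hc h2 (mul_mem (inv_mem hg') hg) ?_ hv, ?_⟩
  · rw [mul_image, h, inv_image]
  · rw [lin_mul, lin_inv]
    change _ = lin g' ((lin g')⁻¹ (lin g v))
    exact ((lin g').apply_symm_apply _).symm

/-- The tiles of a layer are determined by one of them. -/
lemma IsTiling.layer_eq {T : Set (Set E3)} (hT : S.IsTiling T) (hc : S.c ≠ 0)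
    {g g' : E3 ≃ᵃⁱ[ℝ] E3} (hg : g ∈ motions) (hgT : g '' S.tile ∈ T) (hg' : g' ∈ motions)
    {v w : E3} (hv : v ∈ S.lattice) (hw : w ∈ S.lattice)
    (h : (g * tr v) '' S.tile = (g' * tr w) '' S.tile) :
    ∃ u ∈ S.lattice, g '' S.tile = (g' * tr u) '' S.tile := by
  obtain ⟨u, hu, h2⟩ := hT.lattice_eq hc (mul_mem hg (tr_mem v)) (hT.lattice_mem hc hg hgT hv)
    (mul_mem hg' (tr_mem w)) h (neg_mem hv)
  refine ⟨w + u, add_mem hw hu, ?_⟩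
  have e1 : g = tr (lin (g * tr v) (-v)) * (g * tr v) := by
    rw [← mul_tr, mul_assoc, tr_mul, add_neg_cancel, tr_zero, mul_one]
  rw [e1, mul_image, h, h2, ← mul_image, ← mul_tr, mul_assoc, tr_mul]

end Shape

namespace Shape

variable {S : Shape} {T : Set (Set E3)}

/-! ### The position of a layer -/

/-- A common point of a core and a layer yields a common tile, and then the layers coincide. Core
and layer appear in both orders, because a layer has points where its thickness on one side
vanishes. -/
lemma IsTiling.separate (hT : S.IsTiling T) (hc : S.c ≠ 0) (h1 : S.tile ∈ T)
    {g : E3 ≃ᵃⁱ[ℝ] E3} (hg : g ∈ motions) (hgT : g '' S.tile ∈ T)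
    (hns : ∀ v ∈ S.lattice, g '' S.tile ≠ tr v '' S.tile) :
    (∀ x ∈ S.core, g x ∉ S.layer) ∧ ∀ x ∈ S.layer, g x ∉ S.core := by
  have h1' : (1 : E3 ≃ᵃⁱ[ℝ] E3) '' S.tile ∈ T := by rwa [one_image]
  constructor
  · intro x hx hx'
    obtain ⟨v, hv, w, hw, h⟩ := hT.exists_common hc hg hgT (one_mem _) h1'
      (mem_image_of_mem g hx) (by rwa [one_image])
    obtain ⟨u, hu, h⟩ := hT.layer_eq hc hg hgT (one_mem _) hv hw h
    exact hns u hu (by rwa [one_mul] at h)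
  · intro x hx hx'
    obtain ⟨v, hv, w, hw, h⟩ := hT.exists_common hc (one_mem _) h1' hg hgT (by rwa [one_image])
      (mem_image_of_mem g hx)
    obtain ⟨u, hu, h⟩ := hT.layer_eq hc hg hgT (one_mem _) hw hv h.symm
    exact hns u hu (by rwa [one_mul] at h)

/-- An isometry preserving the vertical direction. -/
def Upright (S : Shape) (g : E3 ≃ᵃⁱ[ℝ] E3) : Prop := lin g S.e = S.e

lemma e_eq : S.e = (4 * S.ht ^ 2) • S.nZ := by
  have := S.ht_ne
  ext i
  fin_cases i <;> simp [e, nZ]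
  field_simp; ring

lemma cz_eq (x : E3) : S.cz x = ⟪S.e, x⟫ / (4 * S.ht ^ 2) := by
  have := S.ht_ne
  rw [e_eq, real_inner_smul_left, mul_div_cancel_left₀ _ (by positivity)]
  rfl

lemma Upright.cz_lin {g : E3 ≃ᵃⁱ[ℝ] E3} (hg : S.Upright g) (x : E3) : S.cz (lin g x) = S.cz x := by
  have h : lin g S.e = S.e := hg
  rw [cz_eq, cz_eq]
  conv_lhs => rw [← h]
  rw [LinearIsometryEquiv.inner_map_map]

lemma Upright.cz_map {g : E3 ≃ᵃⁱ[ℝ] E3} (hg : S.Upright g) (x : E3) :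
    S.cz (g x) = S.cz x + S.cz (g 0) := by
  rw [map_eq_lin, map_add, hg.cz_lin]

lemma Upright.mul {g k : E3 ≃ᵃⁱ[ℝ] E3} (hg : S.Upright g) (hk : S.Upright k) :
    S.Upright (g * k) := by
  have h1 : lin g S.e = S.e := hg
  have h2 : lin k S.e = S.e := hk
  change lin g (lin k S.e) = S.e
  rw [h2, h1]

lemma Upright.inv {g : E3 ≃ᵃⁱ[ℝ] E3} (hg : S.Upright g) : S.Upright g⁻¹ := by
  have h1 : lin g S.e = S.e := hg
  change (lin g).symm S.e = S.e
  rw [LinearIsometryEquiv.symm_apply_eq, h1]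

/-- Separated layers are parallel. -/
lemma upright_of_separate {g : E3 ≃ᵃⁱ[ℝ] E3} (h : ∀ x ∈ S.core, g x ∉ S.layer) :
    S.Upright g ∨ S.Upright (g * S.turnD) := by
  have hlayer : ∀ x : E3, S.cz x = 0 → x ∈ S.layer := by
    intro x hx
    change -tri _ ≤ _ ∧ _ ≤ tri _
    rw [hx]
    exact ⟨neg_nonpos.mpr (tri_nonneg _), tri_nonneg _⟩
  -- The image of a full line in the core must not cross the plane `z = 0`, which is part of the
  -- layer. The core contains such lines parallel to `a`, above the plane, and parallel to `b`,
  -- below it.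
  have line : ∀ p v : E3, (∀ r : ℝ, p + r • v ∈ S.core) → S.cz (lin g v) = 0 := by
    intro p v hr
    by_contra hne
    refine h _ (hr (-(S.cz (g p)) / S.cz (lin g v))) (hlayer _ ?_)
    rw [map_add_lin, map_smul, map_add, map_smul, smul_eq_mul, div_mul_cancel₀ _ hne]
    ring
  have ha : S.cz (lin g S.a) = 0 := by
    refine line (S.pt 0 (1 / 2) (1 / 4)) S.a fun r => ?_
    rw [← S.pt_a, smul_pt, pt_add]
    change -tri _ < _ ∧ _ < tri _
    simp only [cs_pt, ct_pt, cz_pt, mul_zero, add_zero, tri_half]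
    exact ⟨by linarith [tri_nonneg (0 + r * 1)], by norm_num⟩
  have hb : S.cz (lin g S.b) = 0 := by
    refine line (S.pt (1 / 2) 0 (-(1 / 4))) S.b fun r => ?_
    rw [← S.pt_b, smul_pt, pt_add]
    change -tri _ < _ ∧ _ < tri _
    simp only [cs_pt, ct_pt, cz_pt, mul_zero, add_zero, tri_half]
    exact ⟨by norm_num, by linarith [tri_nonneg (0 + r * 1)]⟩
  set k := S.cz (lin g S.e) with hk
  have hn : (lin g).symm S.nZ = k • S.nZ := by
    refine ext_inner_right ℝ fun x => ?_
    have h1 : ⟪(lin g).symm S.nZ, x⟫ = S.cz (lin g x) := by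
      rw [← LinearIsometryEquiv.inner_map_map (lin g), LinearIsometryEquiv.apply_symm_apply]; rfl
    have h2 : ⟪S.nZ, x⟫ = S.cz x := rfl
    rw [h1, real_inner_smul_left, h2]
    conv_lhs => rw [← S.pt_coord x]
    simp only [pt, map_add, map_smul, ha, hb, smul_eq_mul]
    rw [← hk]; ring
  have hnZ : S.nZ ≠ 0 := fun h => S.e_ne (by rw [e_eq, h, smul_zero])
  have hk1 : |k| = 1 := by
    have := congrArg norm hn
    rw [LinearIsometryEquiv.norm_map, norm_smul, Real.norm_eq_abs] at this
    have h0 := norm_ne_zero_iff.mpr hnZ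
    exact mul_right_cancel₀ h0 (by rw [← this, one_mul])
  have he : S.e = k • lin g S.e := by
    have h3 : S.nZ = k • lin g S.nZ := by
      rw [← map_smul, ← hn, LinearIsometryEquiv.apply_symm_apply]
    rw [e_eq, map_smul, smul_comm, ← h3]
  rcases (abs_eq zero_le_one).mp hk1 with h1 | h1
  · left
    rw [h1, one_smul] at he
    exact he.symm
  · right
    rw [h1, neg_one_smul] at he
    change lin g (lin S.turnD S.e) = S.e
    have h2 : lin S.turnD S.e = -S.e := by
      rw [← S.pt_e, lin_turnD_pt, ← neg_one_smul ℝ (S.pt 0 0 1), smul_pt]; simp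
    rw [h2, map_neg, ← he]

/-- On a vertical line two parallel layers are intervals `[-l, u] + w` and `[-l', u']`. If neither
meets the interior of the other and `w > 0`, one lies entirely above the other. Both hypotheses are
required because an interval may degenerate on either side of `0`. -/
lemma column_bound {l u l' u' w : ℝ} (hl : 0 ≤ l) (hu : 0 ≤ u) (hl' : 0 ≤ l') (hu' : 0 ≤ u')
    (hw : 0 < w) (h1 : ∀ z, -l < z → z < u → ¬ (-l' ≤ z + w ∧ z + w ≤ u'))
    (h2 : ∀ z, -l ≤ z → z ≤ u → ¬ (-l' < z + w ∧ z + w < u')) : u' + l ≤ w := by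
  by_contra! h
  by_cases h3 : -l' < w - l
  · exact h2 (-l) le_rfl (by linarith) ⟨by linarith, by linarith⟩
  · push Not at h3
    rcases eq_or_lt_of_le hu' with h4 | h4
    · exact h1 (-w) (by linarith) (by linarith) ⟨by linarith, by linarith⟩
    · have h5 : 0 < min w u' := lt_min hw h4
      have h6 := min_le_left w u'
      have h7 := min_le_right w u'
      exact h2 (min w u' / 2 - w) (by linarith) (by linarith) ⟨by linarith, by linarith⟩

/-- The gap between two parallel layers. -/
lemma Upright.gap {g : E3 ≃ᵃⁱ[ℝ] E3} (hg : S.Upright g)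
    (h : (∀ x ∈ S.core, g x ∉ S.layer) ∧ ∀ x ∈ S.layer, g x ∉ S.core) (hw : 0 < S.cz (g 0))
    (x : E3) : tri (S.ct (g x)) + tri (S.cs x) ≤ S.cz (g 0) := by
  have he : lin g S.e = S.e := hg
  have e1 : ∀ z, S.cs (x + (z - S.cz x) • S.e) = S.cs x ∧ S.ct (x + (z - S.cz x) • S.e) = S.ct x ∧
      S.cz (x + (z - S.cz x) • S.e) = z := fun z => by simp
  have e2 : ∀ z, S.cs (g (x + (z - S.cz x) • S.e)) = S.cs (g x) ∧
      S.ct (g (x + (z - S.cz x) • S.e)) = S.ct (g x) ∧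
      S.cz (g (x + (z - S.cz x) • S.e)) = z + S.cz (g 0) := fun z => by
    refine ⟨?_, ?_, ?_⟩
    · rw [map_add_lin, map_smul, he]; simp
    · rw [map_add_lin, map_smul, he]; simp
    · rw [hg.cz_map, (e1 z).2.2]
  refine column_bound (tri_nonneg _) (tri_nonneg (S.ct x)) (tri_nonneg (S.cs (g x))) (tri_nonneg _)
    hw ?_ ?_
  · intro z hz1 hz2 hz
    obtain ⟨a1, a2, a3⟩ := e1 z
    obtain ⟨b1, b2, b3⟩ := e2 z
    refine h.1 (x + (z - S.cz x) • S.e) ?_ ?_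
    · change -tri _ < _ ∧ _ < tri _
      rw [a1, a2, a3]; exact ⟨hz1, hz2⟩
    · change -tri _ ≤ _ ∧ _ ≤ tri _
      rw [b1, b2, b3]; exact hz
  · intro z hz1 hz2 hz
    obtain ⟨a1, a2, a3⟩ := e1 z
    obtain ⟨b1, b2, b3⟩ := e2 z
    refine h.2 (x + (z - S.cz x) • S.e) ?_ ?_
    · change -tri _ ≤ _ ∧ _ ≤ tri _
      rw [a1, a2, a3]; exact ⟨hz1, hz2⟩
    · change -tri _ < _ ∧ _ < tri _
      rw [b1, b2, b3]; exact hz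

/-! ### The step to the next layer -/

variable (S)

/-- The rotation about the vertical axis mapping `b` to `a`. -/
noncomputable def rot : E3 ≃ᵃⁱ[ℝ] E3 := halfTurn 0 S.a * S.turnD

/-- The step from a layer to the next one. -/
noncomputable def step (w : ℝ) : E3 ≃ᵃⁱ[ℝ] E3 := tr (S.pt w (1 / 2) (1 / 2)) * S.rot

lemma rot_pt (s t z : ℝ) : S.rot (S.pt s t z) = S.pt (t + 2 * S.c * s) (-s) z := by
  have := S.len_ne
  change halfTurn 0 S.a (S.turnD (S.pt s t z)) = _
  rw [turnD_pt, ← S.pt_a, ← S.pt_zero, halfTurn_pt, inner_pt, norm_sq_pt]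
  have : 2 * ((S.len ^ 2 * (1 * (t - 0) + 0 * (s - 0) + S.c * (1 * (s - 0) + 0 * (t - 0))) +
      4 * S.ht ^ 2 * (0 * (-z - 0))) / (S.len ^ 2 * (1 ^ 2 + 0 ^ 2 + 2 * S.c * (1 * 0)) +
      4 * S.ht ^ 2 * 0 ^ 2)) = 2 * (t + S.c * s) := by
    field_simp; ring
  rw [this]
  apply S.ext_coord <;> simp
  ring

lemma rot_mem : S.rot ∈ motions := mul_mem (halfTurn_mem _ S.a_ne) S.turnD_mem

lemma step_mem (w : ℝ) : S.step w ∈ motions := mul_mem (tr_mem _) S.rot_mem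

lemma lin_rot (x : E3) : lin S.rot x = S.rot x := by
  have h : S.rot 0 = 0 := by rw [← S.pt_zero, rot_pt]; simp
  rw [map_eq_lin S.rot x, h, add_zero]

lemma step_pt (w s t z : ℝ) :
    S.step w (S.pt s t z) = S.pt (w + t + 2 * S.c * s) (1 / 2 - s) (1 / 2 + z) := by
  change _ + S.rot _ = _
  rw [rot_pt, pt_add]
  congr 1
  ring

lemma lin_step (w : ℝ) : lin (S.step w) = lin S.rot := by
  rw [step, lin_mul, lin_tr, one_mul]

variable {S}

lemma upright_turnV : S.Upright S.turnV := by
  have : lin S.turnV S.e = S.turnV S.e - S.turnV 0 := by rw [← lin_sub, sub_zero]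
  change lin S.turnV S.e = S.e
  rw [this, ← S.pt_e, turnV_pt, ← S.pt_zero, turnV_pt, pt_sub]; simp

lemma lin_turnV_b : lin S.turnV S.b = -S.b := by
  have : lin S.turnV S.b = S.turnV S.b - S.turnV 0 := by rw [← lin_sub, sub_zero]
  rw [this, ← S.pt_b, turnV_pt, ← S.pt_zero, turnV_pt, pt_sub, ← neg_one_smul ℝ, smul_pt]; simp

/-- The layer covering a point just above a vertex of a rhombus. -/
lemma IsTiling.exists_above (hT : S.IsTiling T) (hc : S.c ≠ 0) (h1 : S.tile ∈ T) {δ : ℝ}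
    (hδ : 0 < δ) (hδ' : δ < 1 / 2) :
    ∃ g ∈ motions, g '' S.tile ∈ T ∧ lin g = lin S.rot ∧ S.Upright g ∧ 1 / 2 ≤ S.cz (g 0) ∧
      S.cz (g 0) ≤ 1 / 2 + δ ∧ tri (S.ct (g 0) - 1 / 2) ≤ S.cz (g 0) - 1 / 2 := by
  obtain ⟨g, hg, hgT, hx⟩ := hT.exists_motion (S.pt 0 0 δ)
  have hns : ∀ v ∈ S.lattice, g '' S.tile ≠ tr v '' S.tile := by
    intro v hv h
    rw [h] at hx
    obtain ⟨-, h3⟩ := mem_layer.mpr ⟨v, hv, hx⟩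
    simp only [ct_pt, cz_pt, tri_zero] at h3
    linarith
  have hsep := hT.separate hc h1 hg hgT hns
  obtain ⟨g, hg, hgT, hx, hns, hsep, hup⟩ : ∃ g ∈ motions, g '' S.tile ∈ T ∧
      S.pt 0 0 δ ∈ g '' S.tile ∧ (∀ v ∈ S.lattice, g '' S.tile ≠ tr v '' S.tile) ∧
      ((∀ x ∈ S.core, g x ∉ S.layer) ∧ ∀ x ∈ S.layer, g x ∉ S.core) ∧ S.Upright g := by
    rcases upright_of_separate hsep.1 with h | h
    · exact ⟨g, hg, hgT, hx, hns, hsep, h⟩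
    · have e : (g * S.turnD) '' S.tile = g '' S.tile := by rw [mul_image, turnD_tile]
      have hns' : ∀ v ∈ S.lattice, (g * S.turnD) '' S.tile ≠ tr v '' S.tile := by rwa [e]
      refine ⟨g * S.turnD, mul_mem hg S.turnD_mem, by rwa [e], by rwa [e], hns', ?_, h⟩
      exact hT.separate hc h1 (mul_mem hg S.turnD_mem) (by rwa [e]) hns'
  rw [mem_image_iff] at hx
  obtain ⟨hl1, hl2⟩ := tile_subset_layer hx
  set x := g⁻¹ (S.pt 0 0 δ) with hxdef
  have hgx : g x = S.pt 0 0 δ := apply_inv_apply _ _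
  have hcz : S.cz x = δ - S.cz (g 0) := by
    have := hup.cz_map x
    rw [hgx, cz_pt] at this; linarith
  -- From below no layer can reach a point above a vertex, since the given layer has thickness zero
  -- over it; at equal height the two layers would overlap.
  have hw : 0 < S.cz (g 0) := by
    rcases lt_trichotomy (S.cz (g 0)) 0 with h | h | h
    · exfalso
      have hsep' : (∀ x ∈ S.core, g⁻¹ x ∉ S.layer) ∧ ∀ x ∈ S.layer, g⁻¹ x ∉ S.core :=
        ⟨fun x hx hx' => hsep.2 _ hx' (by rwa [apply_inv_apply]),
          fun x hx hx' => hsep.1 _ hx' (by rwa [apply_inv_apply])⟩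
      have h0 : S.cz (g⁻¹ 0) = -S.cz (g 0) := by
        have := hup.cz_map (g⁻¹ 0)
        rw [apply_inv_apply, map_zero] at this; linarith
      have := hup.inv.gap hsep' (by rw [h0]; linarith) (S.pt 0 0 δ)
      rw [h0, ← hxdef, cs_pt, tri_zero] at this
      linarith
    · exfalso
      refine hsep.1 (S.pt (1 / 2) (1 / 2) 0) ?_ ?_
      · change -tri _ < _ ∧ _ < tri _
        simp only [cs_pt, ct_pt, cz_pt, tri_half]; norm_num
      · change -tri _ ≤ _ ∧ _ ≤ tri _
        rw [hup.cz_map, h, cz_pt, add_zero]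
        exact ⟨neg_nonpos.mpr (tri_nonneg _), tri_nonneg _⟩
    · exact h
  have hle : S.cz (g 0) ≤ 1 / 2 + δ := by linarith [tri_le_half (S.cs x)]
  have hgap := hup.gap hsep hw
  have hline : ∀ τ : ℝ, tri (S.ct (g (S.pt (1 / 2) τ 0))) ≤ S.cz (g 0) - 1 / 2 := by
    intro τ
    have := hgap (S.pt (1 / 2) τ 0)
    rw [cs_pt, tri_half] at this; linarith
  -- Otherwise `t` would take the value `1 / 2` somewhere on the image of the line over `s = 1 / 2`,
  -- where two ridges would cross and the height would have to be at least `1`.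
  have hb0 : S.ct (lin g S.b) = 0 := by
    by_contra hne
    have h2 := hline ((1 / 2 - S.ct (g (S.pt (1 / 2) 0 0))) / S.ct (lin g S.b))
    have e : ∀ τ : ℝ, S.pt (1 / 2) τ 0 = S.pt (1 / 2) 0 0 + τ • S.b := by
      intro τ; rw [← S.pt_b, smul_pt, pt_add]; simp
    rw [e, map_add_lin, map_smul, map_add, map_smul, smul_eq_mul, div_mul_cancel₀ _ hne,
      add_sub_cancel, tri_half] at h2
    linarith
  have hbz : S.cz (lin g S.b) = 0 := by rw [hup.cz_lin, cz_b]
  have hba : lin g S.b = S.cs (lin g S.b) • S.a := by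
    apply S.ext_coord <;> simp [hb0, hbz]
  have hk : |S.cs (lin g S.b)| = 1 := by
    have h2 := congrArg norm hba
    have h3 : ‖S.a‖ ^ 2 = ‖S.b‖ ^ 2 := by
      rw [← real_inner_self_eq_norm_sq, ← real_inner_self_eq_norm_sq, inner_aa, inner_bb]
    rw [sq_eq_sq₀ (norm_nonneg _) (norm_nonneg _)] at h3
    rw [LinearIsometryEquiv.norm_map, norm_smul, Real.norm_eq_abs, h3] at h2
    exact mul_right_cancel₀ (norm_ne_zero_iff.mpr S.b_ne) (by rw [← h2, one_mul])
  have hrot : ∀ g ∈ motions, S.Upright g → lin g S.b = S.a → lin g = lin S.rot := by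
    intro g hg hup hb
    have h2 : lin (S.rot⁻¹ * g) = 1 := by
      have hi : ∀ x y, lin S.rot x = y → lin S.rot⁻¹ y = x := fun x y h =>
        (LinearIsometryEquiv.symm_apply_eq _).mpr h.symm
      apply S.eq_one_of_fix (mul_mem (inv_mem S.rot_mem) hg)
      · change lin S.rot⁻¹ (lin g S.b) = _
        rw [hb]
        apply hi
        rw [lin_rot, ← S.pt_b, rot_pt, ← S.pt_a]; simp
      · change lin S.rot⁻¹ (lin g S.e) = _
        rw [show lin g S.e = S.e from hup]
        apply hi
        rw [lin_rot, ← S.pt_e, rot_pt]; simp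
    rw [lin_mul, lin_inv] at h2
    exact (inv_mul_eq_one.mp h2).symm
  have h0 : 1 / 2 ≤ S.cz (g 0) := by linarith [hline 0, tri_nonneg (S.ct (g (S.pt (1 / 2) 0 0)))]
  rcases (abs_eq zero_le_one).mp hk with h2 | h2
  · rw [h2, one_smul] at hba
    have hlin := hrot g hg hup hba
    refine ⟨g, hg, hgT, hlin, hup, h0, hle, ?_⟩
    have h3 := hline 0
    rw [map_eq_lin, hlin, lin_rot, rot_pt, map_add, ct_pt] at h3
    convert h3 using 2; ring
  -- If `b` goes to `-a`, composing with the half-turn about the vertical axis of the tile changes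
  -- the sign without changing the tile.
  · rw [h2, neg_one_smul] at hba
    have e : (g * S.turnV) '' S.tile = g '' S.tile := by rw [mul_image, turnV_tile]
    have hlin := hrot (g * S.turnV) (mul_mem hg S.turnV_mem) (hup.mul upright_turnV) (by
      change lin g (lin S.turnV S.b) = S.a
      rw [lin_turnV_b, map_neg, hba, neg_neg])
    have hV : ∀ s t z, (g * S.turnV) (S.pt s t z) = g (S.pt (1 - s) (1 - t) z) := by
      intro s t z; change g (S.turnV _) = _; rw [turnV_pt]
    have h4 : S.cz ((g * S.turnV) 0) = S.cz (g 0) := by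
      rw [← S.pt_zero, hV, hup.cz_map, cz_pt, zero_add, S.pt_zero]
    refine ⟨g * S.turnV, mul_mem hg S.turnV_mem, by rwa [e], hlin, hup.mul upright_turnV, ?_⟩
    rw [h4]
    refine ⟨h0, hle, ?_⟩
    have h3 := hline 1
    have h5 : g (S.pt (1 / 2) 1 0) = (g * S.turnV) (S.pt (1 / 2) 0 0) := by rw [hV]; norm_num
    rw [h5, map_eq_lin, hlin, lin_rot, rot_pt, map_add, ct_pt] at h3
    convert h3 using 2; ring

lemma upright_rot : S.Upright S.rot := by
  change lin S.rot S.e = S.e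
  rw [lin_rot, ← S.pt_e, rot_pt]; simp

lemma upright_step (w : ℝ) : S.Upright (S.step w) := by
  change lin (S.step w) S.e = S.e
  rw [lin_step]; exact upright_rot

/-- Above every layer there is a layer obtained by a step. -/
lemma IsTiling.exists_step (hT : S.IsTiling T) (hc : S.c ≠ 0) (h1 : S.tile ∈ T) :
    ∃ w, S.step w '' S.tile ∈ T := by
  obtain ⟨g, hg, hgT, hlin, hup, hw, hw', htri⟩ :=
    hT.exists_above hc h1 (δ := 1 / 4) (by norm_num) (by norm_num)
  have hhalf : S.cz (g 0) = 1 / 2 := by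
    by_contra hne
    have hlt := lt_of_le_of_ne hw (Ne.symm hne)
    -- A height above `1 / 2` leaves room for a point below that layer, covered by another layer at
    -- a strictly smaller height. Both have the same linear part, so they differ by a translation
    -- whose height lies between `0` and `1 / 2`, which is less than the gap over `t = 1 / 2`
    -- requires.
    obtain ⟨g', hg', hgT', hlin', hup', hv, hv', -⟩ :=
      hT.exists_above hc h1 (δ := (S.cz (g 0) - 1 / 2) / 2) (by linarith) (by linarith)
    obtain ⟨hT', h1'⟩ := hT.map_inv hg' hgT'
    set k := g'⁻¹ * g with hk
    have hk1 : lin k = 1 := by rw [hk, lin_mul, lin_inv, hlin, hlin', inv_mul_cancel]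
    have hktr : k = tr (k 0) := by
      ext1 x
      rw [map_eq_lin, hk1, tr_apply, add_comm]; rfl
    have hkT : k '' S.tile ∈ mapT g'⁻¹ T := by
      rw [mul_image_mem, hk, mul_inv_cancel_left]; exact hgT
    have hkup : S.Upright k := hup'.inv.mul hup
    have hk0 : S.cz (k 0) = S.cz (g 0) - S.cz (g' 0) := by
      have h2 := hup'.inv.cz_map (g 0)
      have h3 := hup'.cz_map (g'⁻¹ 0)
      rw [apply_inv_apply, map_zero] at h3
      change S.cz (g'⁻¹ (g 0)) = _
      linarith
    have hns : ∀ v ∈ S.lattice, k '' S.tile ≠ tr v '' S.tile := by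
      intro v hv h
      rw [hktr] at h
      have := tr_tile_injective h
      rw [this, cz_lattice hv] at hk0
      linarith
    have hgap := hkup.gap (hT'.separate hc h1' (mul_mem (inv_mem hg') hg) hkT hns)
      (by linarith) (k⁻¹ (S.pt 0 (1 / 2) 0))
    rw [apply_inv_apply, ct_pt, tri_half, hk0] at hgap
    linarith [tri_nonneg (S.cs (k⁻¹ (S.pt 0 (1 / 2) 0)))]
  rw [hhalf, sub_self] at htri
  obtain ⟨m, hm⟩ := exists_int_of_tri_eq_zero (le_antisymm htri (tri_nonneg _))
  have hmem : S.pt m 0 0 ∈ S.lattice := ⟨m, 0, by simp⟩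
  have hT2 := hT.lattice_mem hc hg hgT hmem
  -- The coordinate `t` of `g 0` is `1 / 2 + m`. Moving on by the lattice vector `m • a` of the
  -- upper layer, whose rotated image has the coordinates `(2 * c * m, -m)`, normalises it to `1 /
  -- 2`.
  refine ⟨S.cs (g 0) + 2 * S.c * m, ?_⟩
  suffices e : S.step (S.cs (g 0) + 2 * S.c * m) = g * tr (S.pt m 0 0) by rwa [e]
  ext1 x
  change S.step (S.cs (g 0) + 2 * S.c * m) x = g (S.pt m 0 0 + x)
  have h0 : g 0 = S.pt (S.cs (g 0)) (1 / 2 + m) (1 / 2) := by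
    apply S.ext_coord <;> simp only [cs_pt, ct_pt, cz_pt]
    · linarith
    · exact hhalf
  have hx : ∀ y, g y = S.rot y + S.pt (S.cs (g 0)) (1 / 2 + m) (1 / 2) := fun y => by
    rw [← h0, map_eq_lin, hlin, lin_rot]
  rw [hx (S.pt m 0 0 + x)]
  generalize S.cs (g 0) = u
  rw [← S.pt_coord x, pt_add, rot_pt, step_pt, pt_add]
  congr 1 <;> ring

/-- Below every layer there is a layer obtained by an inverse step. -/
lemma IsTiling.exists_step_inv (hT : S.IsTiling T) (hc : S.c ≠ 0) (h1 : S.tile ∈ T) :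
    ∃ w, ((S.step w)⁻¹ : E3 ≃ᵃⁱ[ℝ] E3) '' S.tile ∈ T := by
  have hD : S.turnD⁻¹ = S.turnD := inv_eq_of_mul_eq_one_left (by ext1 x; exact S.turnD_turnD x)
  obtain ⟨hT', h1'⟩ := hT.map_inv S.turnD_mem (by rwa [turnD_tile])
  obtain ⟨w, hw⟩ := hT'.exists_step hc h1'
  -- Turning the tiling upside down by `turnD` exchanges the steps up and down; comparison of
  -- coordinates gives the slide of the reversed step.
  refine ⟨-w - S.c, ?_⟩
  rw [mul_image_mem] at hw
  have e : (S.step (-w - S.c))⁻¹ = S.turnD * S.step w * S.turnD := by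
    have hx : ∀ x, S.step (-w - S.c) (S.turnD (S.step w (S.turnD x))) = x := fun x => by
      rw [← S.pt_coord x, turnD_pt, step_pt, turnD_pt, step_pt]
      congr 1 <;> ring
    refine AffineIsometryEquiv.ext fun x => (S.step (-w - S.c)).injective ?_
    have h3 : ∀ f g k : E3 ≃ᵃⁱ[ℝ] E3, (f * g * k) x = f (g (k x)) := fun _ _ _ => rfl
    rw [apply_inv_apply, h3, hx]
  rwa [e, mul_image, turnD_tile]

/-! ### Towers of layers -/

/-- A sequence of layers, each one a step above the preceding one. -/
structure IsTower (S : Shape) (T : Set (Set E3)) (G : ℤ → E3 ≃ᵃⁱ[ℝ] E3) (w : ℤ → ℝ) : Prop where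
  mem : ∀ n, G n ∈ motions
  tile_mem : ∀ n, G n '' S.tile ∈ T
  step : ∀ n, G (n + 1) = G n * S.step (w n)

lemma IsTiling.exists_tower (hT : S.IsTiling T) (hc : S.c ≠ 0) :
    ∃ G w, S.IsTower T G w := by
  let A := {g : E3 ≃ᵃⁱ[ℝ] E3 // g ∈ motions ∧ g '' S.tile ∈ T}
  have up : ∀ g : A, ∃ g' : A, ∃ w, g'.1 = g.1 * S.step w := by
    rintro ⟨g, hg, hgT⟩
    obtain ⟨hT', h1⟩ := hT.map_inv hg hgT
    obtain ⟨w, hw⟩ := hT'.exists_step hc h1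
    rw [mul_image_mem] at hw
    exact ⟨⟨g * S.step w, mul_mem hg (S.step_mem w), hw⟩, w, rfl⟩
  have down : ∀ g : A, ∃ g' : A, ∃ w, g.1 = g'.1 * S.step w := by
    rintro ⟨g, hg, hgT⟩
    obtain ⟨hT', h1⟩ := hT.map_inv hg hgT
    obtain ⟨w, hw⟩ := hT'.exists_step_inv hc h1
    rw [mul_image_mem] at hw
    exact ⟨⟨g * (S.step w)⁻¹, mul_mem hg (inv_mem (S.step_mem w)), hw⟩, w, by simp⟩
  choose u hu using up
  choose d hd using down
  obtain ⟨g0, hg0, hg0T, -⟩ := hT.exists_motion 0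
  let a0 : A := ⟨g0, hg0, hg0T⟩
  let G : ℤ → A := fun n => match n with
    | Int.ofNat k => u^[k] a0
    | Int.negSucc k => d^[k + 1] a0
  have hG : ∀ n, ∃ w, (G (n + 1)).1 = (G n).1 * S.step w := by
    intro n
    match n with
    | Int.ofNat k =>
      have : G (Int.ofNat k + 1) = u (G (Int.ofNat k)) := Function.iterate_succ_apply' u k a0
      rw [this]; exact hu _
    | Int.negSucc 0 => exact hd a0
    | Int.negSucc (k + 1) =>
      have : G (Int.negSucc (k + 1)) = d (G (Int.negSucc (k + 1) + 1)) :=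
        Function.iterate_succ_apply' d (k + 1) a0
      rw [this]; exact hd _
  choose w hw using hG
  exact ⟨fun n => (G n).1, w, fun n => (G n).2.1, fun n => (G n).2.2, hw⟩

namespace IsTower

variable {G : ℤ → E3 ≃ᵃⁱ[ℝ] E3} {w : ℤ → ℝ}

lemma cz_succ (h : S.IsTower T G w) (n : ℤ) (x : E3) :
    S.cz ((G (n + 1))⁻¹ x) = S.cz ((G n)⁻¹ x) - 1 / 2 := by
  rw [h.step, mul_inv_rev]
  change S.cz ((S.step (w n))⁻¹ ((G n)⁻¹ x)) = _
  have h1 := (upright_step (S := S) (w n)).cz_map ((S.step (w n))⁻¹ ((G n)⁻¹ x))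
  rw [apply_inv_apply, ← S.pt_zero, step_pt, cz_pt] at h1
  linarith

lemma cz_inv (h : S.IsTower T G w) (n : ℤ) (x : E3) :
    S.cz ((G n)⁻¹ x) = S.cz ((G 0)⁻¹ x) - n / 2 := by
  induction n using Int.induction_on with
  | zero => simp
  | succ i ih => rw [h.cz_succ, ih]; push_cast; ring
  | pred i ih =>
    have := h.cz_succ (-(i : ℤ) - 1) x
    rw [sub_add_cancel, ih] at this
    push_cast at this ⊢
    linarith

lemma lin_succ (h : S.IsTower T G w) (n : ℤ) : lin (G (n + 1)) = lin (G n) * lin S.rot := by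
  rw [h.step, lin_mul, lin_step]

lemma lin_eq (h : S.IsTower T G w) (n : ℤ) : lin (G n) = lin (G 0) * lin S.rot ^ n := by
  induction n using Int.induction_on with
  | zero => simp
  | succ i ih => rw [h.lin_succ, ih, mul_assoc, zpow_add_one]
  | pred i ih =>
    have := h.lin_succ (-(i : ℤ) - 1)
    rw [sub_add_cancel, ih, zpow_sub_one] at *
    rw [← mul_assoc, this]; simp

/-- The layers of a tower cover space. -/
lemma exists_mem_layer (h : S.IsTower T G w) (x : E3) : ∃ n, x ∈ G n '' S.layer := by
  set n : ℤ := ⌊2 * S.cz ((G 0)⁻¹ x)⌋ with hn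
  have h1 : (n : ℝ) ≤ 2 * S.cz ((G 0)⁻¹ x) := Int.floor_le _
  have h2 : 2 * S.cz ((G 0)⁻¹ x) < n + 1 := Int.lt_floor_add_one _
  have h3 := h.cz_inv n x
  set y := (G n)⁻¹ x with hy
  by_cases hle : S.cz y ≤ tri (S.ct y)
  -- By the choice of `n`, the height over layer `n` is in `[0, 1 / 2)`. A point above the upper
  -- roof of this layer is above the lower roof of layer `n + 1`, because the two roofs coincide by
  -- `tri_half_sub`.
  · refine ⟨n, (mem_image_iff _ _ _).mpr ⟨?_, hle⟩⟩
    change -tri (S.cs y) ≤ S.cz y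
    linarith [tri_nonneg (S.cs y)]
  · refine ⟨n + 1, (mem_image_iff _ _ _).mpr ?_⟩
    have h4 := h.cz_succ n x
    rw [← hy] at h4
    have h5 : S.cs ((G (n + 1))⁻¹ x) = 1 / 2 - S.ct y := by
      have h6 : y = S.step (w n) ((G (n + 1))⁻¹ x) := by
        rw [h.step, mul_inv_rev]
        exact (apply_inv_apply _ _).symm
      rw [← S.pt_coord ((G (n + 1))⁻¹ x), step_pt] at h6
      rw [h6, ct_pt]; ring
    change -tri _ ≤ _ ∧ _ ≤ tri _
    rw [h5, h4, tri_half_sub]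
    exact ⟨by linarith, by linarith [tri_nonneg (S.ct ((G (n + 1))⁻¹ x))]⟩

/-- The tiles are the lattice translates of the tiles of the tower. -/
lemma exists_of_mem (h : S.IsTower T G w) (hT : S.IsTiling T) (hc : S.c ≠ 0) {X : Set E3}
    (hX : X ∈ T) : ∃ n, ∃ v ∈ S.lattice, X = (G n * tr v) '' S.tile := by
  obtain ⟨x, hx⟩ := hT.interior_nonempty hX
  obtain ⟨n, hn⟩ := h.exists_mem_layer x
  rw [mem_image_iff, mem_layer] at hn
  obtain ⟨v, hv, hn⟩ := hn
  rw [← mem_image_iff, ← mul_image] at hn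
  exact ⟨n, v, hv, hT.eq_of_inter hX (hT.lattice_mem hc (h.mem n) (h.tile_mem n) hv) hx hn⟩

end IsTower

end Shape

/-! ### Vectors common to the lattices of consecutive layers -/

namespace Shape

variable (S : Shape)

/-- The horizontal vectors whose images under the first powers of `rot` are lattice vectors. -/
noncomputable def coincidence (N : ℕ) : AddSubgroup E3 where
  carrier := {v | ∀ j : ℤ, |j| ≤ N → (lin S.rot ^ j) v ∈ S.lattice}
  add_mem' hv hw j hj := by rw [map_add]; exact add_mem (hv j hj) (hw j hj)
  zero_mem' j _ := by rw [map_zero]; exact zero_mem _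
  neg_mem' hv j hj := by rw [map_neg]; exact neg_mem (hv j hj)

lemma coincidence_subset_lattice {N : ℕ} {v : E3} (hv : v ∈ S.coincidence N) :
    v ∈ S.lattice := by
  simpa using hv 0 (by simp)

/-- One nonzero vector of the next order thus provides two independent vectors of order `N`, so the
coincidence lattice has full rank in the plane. -/
lemma coincidence_rot {N : ℕ} {v : E3} (hv : v ∈ S.coincidence (N + 1)) :
    v ∈ S.coincidence N ∧ lin S.rot v ∈ S.coincidence N := by
  constructor
  · intro j hj
    exact hv j (hj.trans (by push_cast; linarith))
  · intro j hj
    have : (lin S.rot ^ j) (lin S.rot v) = (lin S.rot ^ (j + 1)) v := by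
      rw [zpow_add_one]; rfl
    rw [this]
    refine hv _ ((abs_add_le _ _).trans ?_)
    push_cast
    simpa using hj

variable {S} {T : Set (Set E3)}

lemma cz_lin_rot (x : E3) : S.cz (lin S.rot x) = S.cz x := upright_rot.cz_lin x

lemma cz_lin_rot_zpow (j : ℤ) (x : E3) : S.cz ((lin S.rot ^ j) x) = S.cz x := by
  induction j using Int.induction_on with
  | zero => simp
  | succ i ih =>
    rw [add_comm, zpow_add, zpow_one]
    exact (cz_lin_rot _).trans ih
  | pred i ih =>
    rw [← ih, sub_eq_add_neg, add_comm, zpow_add, zpow_neg_one]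
    refine (cz_lin_rot _).symm.trans (congrArg _ ?_)
    exact (lin S.rot).apply_symm_apply _

lemma abs_cz_le (x : E3) : 2 * S.ht * |S.cz x| ≤ ‖x‖ := by
  have h := S.ht_pos
  have h1 : ‖S.e‖ = 2 * S.ht := by
    rw [← sq_eq_sq₀ (norm_nonneg _) (by linarith), ← real_inner_self_eq_norm_sq, inner_ee]; ring
  have h2 := abs_real_inner_le_norm S.e x
  rw [cz_eq, abs_div, abs_of_pos (show 0 < 4 * S.ht ^ 2 by positivity), mul_div_assoc',
    div_le_iff₀ (by positivity)]
  rw [h1] at h2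
  nlinarith

lemma inv_map_add_lin (g : E3 ≃ᵃⁱ[ℝ] E3) (x y : E3) : g⁻¹ (x + lin g y) = g⁻¹ x + y := by
  apply g.injective
  rw [apply_inv_apply, map_add_lin, apply_inv_apply]

namespace IsTower

variable {G : ℤ → E3 ≃ᵃⁱ[ℝ] E3} {w : ℤ → ℝ}

lemma lin_apply (h : S.IsTower T G w) (n m : ℤ) (v : E3) :
    lin (G n) v = lin (G m) ((lin S.rot ^ (n - m)) v) := by
  have : lin (G n) = lin (G m) * lin S.rot ^ (n - m) := by
    rw [h.lin_eq n, h.lin_eq m, mul_assoc, ← zpow_add]; congr 2; ring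
  rw [this]; rfl

lemma abs_height_le (h : S.IsTower T G w) {n : ℤ} {v y : E3} (hv : v ∈ S.lattice)
    (hy : y ∈ (G n * tr v) '' S.tile) : |2 * S.cz ((G 0)⁻¹ y) - n| ≤ 1 := by
  rw [mul_image, mem_image_iff] at hy
  have h1 : (G n)⁻¹ y ∈ S.layer := S.mem_layer.mpr ⟨v, hv, hy⟩
  have h2 := h.cz_inv n y
  have h3 := tri_le_half (S.cs ((G n)⁻¹ y))
  have h4 := tri_le_half (S.ct ((G n)⁻¹ y))
  have h5 := h1.1
  have h6 := h1.2
  rw [abs_le]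
  constructor <;> linarith

lemma image_shift (n m : ℤ) (h : S.IsTower T G w) (u v : E3) :
    tr (lin (G n) v) '' ((G m * tr u) '' S.tile) =
      (G m * tr (u + (lin S.rot ^ (n - m)) v)) '' S.tile := by
  rw [← mul_image, h.lin_apply n m, ← mul_assoc, ← mul_tr, mul_assoc, tr_mul, add_comm]

/-- Shifts by coincidence vectors preserve the tiles in a slab. -/
lemma shift_mem (h : S.IsTower T G w) (hT : S.IsTiling T) (hc : S.c ≠ 0) {N : ℕ} {v : E3}
    (hv : v ∈ S.coincidence N) {n : ℤ} {X : Set E3} (hX : X ∈ T) {y : E3} (hy : y ∈ X)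
    (hn : |2 * S.cz ((G 0)⁻¹ y) - n| + 1 ≤ N) : tr (lin (G n) v) '' X ∈ T := by
  obtain ⟨m, u, hu, rfl⟩ := h.exists_of_mem hT hc hX
  rw [h.image_shift]
  refine hT.lattice_mem hc (h.mem m) (h.tile_mem m) (add_mem hu (hv _ ?_))
  have h1 := h.abs_height_le hu hy
  have h2 : |(n : ℝ) - m| ≤ N := by
    rw [abs_le] at *
    have h3 := abs_le.mp (show |2 * S.cz ((G 0)⁻¹ y) - n| ≤ N - 1 by linarith)
    constructor <;> linarith
  exact_mod_cast h2

/-- A tile is mapped to a tile of the same height only by a lattice translation. -/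
lemma lattice_of_shift (h : S.IsTower T G w) (hT : S.IsTiling T) (hc : S.c ≠ 0) {m : ℤ} {u v : E3}
    (hu : u ∈ S.lattice) (hv : S.cz v = 0) (hX : (G m * tr (u + v)) '' S.tile ∈ T) :
    v ∈ S.lattice := by
  obtain ⟨m', v', hv', e⟩ := h.exists_of_mem hT hc hX
  have hz : ∀ y, S.cz ((G 0)⁻¹ ((G m * tr (u + v)) y)) = S.cz y + m / 2 := fun y => by
    have h1 := h.cz_inv m ((G m * tr (u + v)) y)
    have h2 : (G m)⁻¹ ((G m * tr (u + v)) y) = u + v + y := inv_apply_apply _ _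
    rw [h2, map_add, map_add, S.cz_lattice hu, hv] at h1
    linarith
  have key : ∀ y ∈ S.tile, |2 * S.cz y + m - m'| ≤ 1 := fun y hy => by
    have h1 := h.abs_height_le hv' (e ▸ mem_image_of_mem _ hy)
    rw [hz] at h1
    convert h1 using 2; ring
  -- The highest and the lowest points of the tile together leave only one possible layer.
  have k1 := key (S.pt (1 / 2) (1 / 2) (1 / 2)) (by rw [mem_tile]; simp; norm_num)
  have k2 := key (S.pt (1 / 2) (1 / 2) (-(1 / 2))) (by rw [mem_tile]; simp; norm_num)
  rw [cz_pt, abs_le] at k1 k2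
  have hm : m = m' := by
    have : (m : ℝ) = m' := by linarith
    exact_mod_cast this
  subst hm
  rw [mul_image, mul_image] at e
  have := S.tr_tile_injective ((G m).injective.image_injective e)
  rw [← add_sub_cancel_left u v, this]
  exact sub_mem hv' hu

/-- The vertical projection of `p` to the plane `z = 0` of layer `m` lies in this layer;
neighbouring planes have distance `ht`. -/
lemma exists_tile_at (h : S.IsTower T G w) (hT : S.IsTiling T) (hc : S.c ≠ 0) (m : ℤ) (p : E3) :
    ∃ u ∈ S.lattice, (G m * tr u) '' S.tile ∈ T ∧
      ((G m * tr u) '' S.tile ∩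
        closedBall p (S.ht * |2 * S.cz ((G 0)⁻¹ p) - m|)).Nonempty := by
  set q := p + lin (G 0) ((m / 2 - S.cz ((G 0)⁻¹ p)) • S.e) with hq
  have h1 : S.cz ((G m)⁻¹ q) = 0 := by
    rw [h.cz_inv, hq, inv_map_add_lin, map_add, map_smul, cz_e, smul_eq_mul]; ring
  have h2 : (G m)⁻¹ q ∈ S.layer := by
    constructor
    · rw [h1]; linarith [tri_nonneg (S.cs ((G m)⁻¹ q))]
    · rw [h1]; exact tri_nonneg _
  obtain ⟨u, hu, hqu⟩ := S.mem_layer.mp h2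
  refine ⟨u, hu, hT.lattice_mem hc (h.mem m) (h.tile_mem m) hu, q, ?_, ?_⟩
  · rwa [mul_image, mem_image_iff]
  · have h3 : ‖S.e‖ = 2 * S.ht := by
      rw [← sq_eq_sq₀ (norm_nonneg _) (by linarith [S.ht_pos]), ← real_inner_self_eq_norm_sq,
        inner_ee]; ring
    rw [mem_closedBall, dist_eq_norm, hq, add_sub_cancel_left, LinearIsometryEquiv.norm_map,
      norm_smul, h3, Real.norm_eq_abs]
    have h4 : |2 * S.cz ((G 0)⁻¹ p) - m| = 2 * |(m : ℝ) / 2 - S.cz ((G 0)⁻¹ p)| := by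
      rw [abs_sub_comm, ← abs_two, ← abs_mul, abs_two]; congr 1; ring
    rw [h4]; linarith

/-- In a repetitive tiling the lattices of neighbouring layers have common vectors. -/
lemma exists_coincidence (h : S.IsTower T G w) (hT : S.IsTiling T) (hc : S.c ≠ 0)
    (hrep : IsRepetitive T) (N : ℕ) : ∃ v ∈ S.coincidence N, v ≠ 0 := by
  set x₀ := G 0 0 with hx₀
  have hpos := S.ht_pos
  have hlen := S.len_pos
  -- Large enough to reach all layers with index at most `N` from the index of the base tile; the
  -- summand `1` allows for the position of the centre within the thickness of its layer.
  set ρ := S.ht * (N + 1) with hρ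
  obtain ⟨R, hR⟩ := hrep x₀ ρ
  have hna : ‖S.a‖ = S.len := by
    rw [← sq_eq_sq₀ (norm_nonneg _) hlen.le, ← real_inner_self_eq_norm_sq, inner_aa]
  -- With this spacing the test points `y i` are more than `2 * R` apart, so that different test
  -- points cannot share an occurrence of the patch.
  set D := (2 * |R| + 1) / S.len with hD
  have hDl : D * S.len = 2 * |R| + 1 := div_mul_cancel₀ _ hlen.ne'
  let y : ℕ → E3 := fun i => x₀ + lin (G 0) ((i * D) • S.a)
  choose g hg hdist hpatch using fun i => hR (y i)
  have hRnn : 0 ≤ R := dist_nonneg.trans (hdist 0)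
  have hρ0 : 0 ≤ ρ := by positivity
  have h0 : (0 : E3) ∈ S.tile := by rw [← S.pt_zero, mem_tile]; simp
  have hpatch' : ∀ i, ∀ X ∈ tilesMeeting T (closedBall x₀ ρ), g i '' X ∈ T := fun i X hX => by
    have : g i '' X ∈ tilesMeeting T (closedBall (g i x₀) ρ) := by
      rw [hpatch]; exact mem_image_of_mem _ hX
    exact this.1
  have hbase : ∀ i, (g i * G 0) '' S.tile ∈ T := fun i => by
    rw [mul_image]
    exact hpatch' i _ ⟨h.tile_mem 0, x₀, mem_image_of_mem _ h0, mem_closedBall_self hρ0⟩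
  choose n v hv hX using fun i => h.exists_of_mem hT hc (hbase i)
  let σ : ℕ → E3 ≃ᵃⁱ[ℝ] E3 := fun i => (G (n i) * tr (v i))⁻¹ * (g i * G 0)
  have hσ : ∀ i, σ i '' S.tile = S.tile := fun i => by
    change ((G (n i) * tr (v i))⁻¹ * (g i * G 0)) '' S.tile = S.tile
    rw [mul_image, hX, inv_image]
  have hheight : ∀ i, |2 * S.cz ((G 0)⁻¹ (g i x₀)) - n i| ≤ 1 := fun i =>
    h.abs_height_le (hv i) (by rw [← hX]; exact ⟨0, h0, rfl⟩)
  have hxz : (G 0)⁻¹ x₀ = 0 := inv_apply_apply _ _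
  obtain ⟨M, hM⟩ := exists_nat_ge (R / S.ht + 1)
  have hnM : ∀ i, n i ∈ Icc (-(M : ℤ)) M := fun i => by
    have h1 : S.cz ((G 0)⁻¹ (y i)) = 0 := by
      rw [inv_map_add_lin, hxz]; simp
    have h2 : S.ht * |2 * S.cz ((G 0)⁻¹ (g i x₀))| ≤ R := by
      have h3 := abs_cz_le (S := S) ((G 0)⁻¹ (g i x₀) - (G 0)⁻¹ (y i))
      rw [map_sub, h1, sub_zero, ← dist_eq_norm, (G 0)⁻¹.dist_map] at h3
      rw [abs_mul, abs_two]
      linarith [hdist i]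
    have h4 : |2 * S.cz ((G 0)⁻¹ (g i x₀))| ≤ R / S.ht := by
      rw [le_div_iff₀ hpos]; linarith
    have h5 := hheight i
    rw [abs_le] at h4 h5
    have h6 : -(M : ℝ) ≤ n i ∧ (n i : ℝ) ≤ M := ⟨by linarith, by linarith⟩
    exact ⟨by exact_mod_cast h6.1, by exact_mod_cast h6.2⟩
  -- The copies of the base tile lie in finitely many layers and in finitely many orientations
  -- relative to them, so two occurrences differ by a lattice translation of one layer.
  obtain ⟨i, -, k, -, hik, e⟩ := infinite_univ.exists_ne_map_eq_of_mapsTo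
    (f := fun i => (n i, σ i)) (t := Icc (-(M : ℤ)) M ×ˢ {g : E3 ≃ᵃⁱ[ℝ] E3 | g '' S.tile = S.tile})
    (fun i _ => ⟨hnM i, hσ i⟩) ((finite_Icc _ _).prod S.finite_symm)
  obtain ⟨en, eσ⟩ := Prod.mk.inj e
  have hgk : g k = tr (lin (G (n i)) (v k - v i)) * g i := by
    have h1 : g i * G 0 = G (n i) * tr (v i) * σ i := (mul_inv_cancel_left _ _).symm
    have h2 : g k * G 0 = G (n i) * tr (v k) * σ i := by
      rw [eσ, en]; exact (mul_inv_cancel_left _ _).symm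
    have h3 : ∀ τ : E3 ≃ᵃⁱ[ℝ] E3, G (n i) * tr (v k) * τ =
        tr (lin (G (n i)) (v k - v i)) * (G (n i) * tr (v i) * τ) := fun τ => by
      rw [← mul_assoc, ← mul_assoc, ← mul_tr, mul_assoc (G _) (tr (v k - v i)), tr_mul,
        sub_add_cancel]
    exact mul_right_cancel (b := G 0) (by rw [h2, h3, ← h1, mul_assoc])
  have hu : v k - v i ∈ S.lattice := sub_mem (hv k) (hv i)
  refine ⟨v k - v i, fun j hj => ?_, fun hzero => ?_⟩
  · have hj' : |(j : ℝ)| ≤ N := by exact_mod_cast hj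
    -- The translation maps a tile of layer `n i - j` within the patch to a tile of the same height,
    -- which makes it a lattice vector of that layer too.
    obtain ⟨u, hul, huT, huX⟩ := h.exists_tile_at hT hc (n i - j) (g i x₀)
    have hsub : closedBall (g i x₀) (S.ht * |2 * S.cz ((G 0)⁻¹ (g i x₀)) - (n i - j : ℤ)|) ⊆
        closedBall (g i x₀) ρ := by
      apply closedBall_subset_closedBall
      rw [hρ]
      gcongr
      have := hheight i
      push_cast
      rw [abs_le] at *
      constructor <;> linarith
    have hmem : (G (n i - j) * tr u) '' S.tile ∈ tilesMeeting T (closedBall (g i x₀) ρ) :=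
      ⟨huT, huX.mono (inter_subset_inter_right _ hsub)⟩
    rw [hpatch] at hmem
    obtain ⟨X₀, hX₀, e₀⟩ := hmem
    have hk := hpatch' k X₀ hX₀
    simp only at e₀
    rw [hgk, mul_image, e₀, h.image_shift, sub_sub_cancel] at hk
    exact h.lattice_of_shift hT hc hul (by rw [cz_lin_rot_zpow, S.cz_lattice hu]) hk
  · rw [hzero, map_zero, tr_zero, one_mul] at hgk
    have h1 : dist (y i) (y k) ≤ 2 * R := by
      have h2 := hdist i
      have h3 := hdist k
      rw [hgk] at h3
      have := dist_triangle_left (y i) (y k) (g i x₀)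
      linarith
    have h4 : dist (y i) (y k) = |(i : ℝ) - k| * (D * S.len) := by
      have h5 : y i - y k = lin (G 0) (((i - k : ℝ) * D) • S.a) := by
        change x₀ + _ - (x₀ + _) = _
        rw [add_sub_add_left_eq_sub, ← map_sub, ← sub_smul, sub_mul]
      rw [dist_eq_norm, h5, LinearIsometryEquiv.norm_map, norm_smul, hna, Real.norm_eq_abs,
        abs_mul, abs_of_nonneg (show 0 ≤ D by positivity), mul_assoc]
    have h6 : (1 : ℝ) ≤ |(i : ℝ) - k| := by
      have : (1 : ℤ) ≤ |(i : ℤ) - k| := Int.one_le_abs (sub_ne_zero.mpr (by exact_mod_cast hik))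
      exact_mod_cast this
    rw [h4, hDl, abs_of_nonneg hRnn] at h1
    nlinarith

end IsTower

end Shape

/-! ### Slab-wise invariance of derived point sets -/

lemma isDelone_iff {Λ : Set E3} : IsDelone Λ ↔
    (∃ r > 0, ∀ x ∈ Λ, ∀ y ∈ Λ, dist x y ≤ r → x = y) ∧ ∃ R, ∀ z, ∃ x ∈ Λ, dist z x ≤ R := by
  constructor
  · rintro ⟨D, rfl⟩
    refine ⟨⟨D.packingRadius, D.packingRadius_pos, fun x hx y hy h => ?_⟩, D.coveringRadius,
      D.exists_dist_le_coveringRadius⟩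
    by_contra hne
    exact absurd h (not_le.mpr (D.packingRadius_lt_dist_of_mem_ne hx hy hne))
  · rintro ⟨⟨r, hr, hsep⟩, R, hcov⟩
    refine ⟨⟨Λ, r.toNNReal, Real.toNNReal_pos.mpr hr, fun x hx y hy hne => ?_,
      R.toNNReal + 1, by positivity, fun z _ => ?_⟩, rfl⟩
    · change ENNReal.ofReal r < edist x y
      rw [edist_dist, ENNReal.ofReal_lt_ofReal_iff (dist_pos.mpr hne)]
      by_contra! h
      exact hne (hsep x hx y hy h)
    · obtain ⟨x, hx, h⟩ := hcov z
      refine ⟨x, hx, ?_⟩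
      change edist z x ≤ ((R.toNNReal + 1 : NNReal) : ENNReal)
      rw [edist_dist, ENNReal.ofReal_le_iff_le_toReal ENNReal.coe_ne_top, ENNReal.coe_toReal]
      push_cast
      linarith [Real.le_coe_toNNReal R]

namespace Shape

variable {S : Shape} {T : Set (Set E3)} {G : ℤ → E3 ≃ᵃⁱ[ℝ] E3} {w : ℤ → ℝ} {Λ : Set E3}

namespace IsTower

lemma cz_add_lin (h : S.IsTower T G w) {v : E3} (hv : S.cz v = 0) (n : ℤ) (x : E3) :
    S.cz ((G 0)⁻¹ (x + lin (G n) v)) = S.cz ((G 0)⁻¹ x) := by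
  rw [h.lin_apply n 0, inv_map_add_lin, map_add, cz_lin_rot_zpow, hv, add_zero]

/-- A point set derivable from the tiling is invariant, within each slab, under coincidence
vectors of sufficiently high order. -/
lemma add_lin_mem (h : S.IsTower T G w) (hT : S.IsTiling T) (hc : S.c ≠ 0)
    (hΛ : PointsDerivableFromTiling Λ T) : ∃ N, ∀ v ∈ S.coincidence N, ∀ (n : ℤ) (x : E3),
      |2 * S.cz ((G 0)⁻¹ x) - n| ≤ 1 → x ∈ Λ → x + lin (G n) v ∈ Λ := by
  obtain ⟨K, hK, -, hder⟩ := hΛ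
  have hpos := S.ht_pos
  obtain ⟨r, hr⟩ := hK.isBounded.subset_closedBall 0
  -- Within the window the doubled height varies by at most `r / ht`; the summand `2` pays for the
  -- deviation of `x` from its layer index and for the thickness of a tile in `shift_mem`.
  obtain ⟨N, hN⟩ := exists_nat_ge (r / S.ht + 2)
  refine ⟨N, fun v hv n x hx hxΛ => ?_⟩
  have key : ∀ v ∈ S.coincidence N, ∀ x, |2 * S.cz ((G 0)⁻¹ x) - n| ≤ 1 →
      tilePatch T K x ⊆ tilePatch T K (x + lin (G n) v) := by
    rintro v hv x hx _ ⟨s, ⟨hs, q, hq, hqK⟩, rfl⟩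
    obtain ⟨k, hk, rfl⟩ := hqK
    change x + k ∈ s at hq
    have h1 : S.ht * |2 * S.cz ((G 0)⁻¹ (x + k)) - 2 * S.cz ((G 0)⁻¹ x)| ≤ r := by
      have h2 := abs_cz_le (S := S) ((G 0)⁻¹ (x + k) - (G 0)⁻¹ x)
      rw [← dist_eq_norm, (G 0)⁻¹.dist_map, dist_self_add_left, map_sub] at h2
      have h3 := hr hk
      rw [mem_closedBall_zero_iff] at h3
      rw [← mul_sub, abs_mul, abs_two]
      linarith
    have h4 : |2 * S.cz ((G 0)⁻¹ (x + k)) - 2 * S.cz ((G 0)⁻¹ x)| ≤ r / S.ht := by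
      rw [le_div_iff₀ hpos]; linarith
    have h5 := h.shift_mem hT hc hv hs hq (n := n) (by
      have := abs_sub_le (2 * S.cz ((G 0)⁻¹ (x + k))) (2 * S.cz ((G 0)⁻¹ x)) n
      linarith)
    refine ⟨_, ⟨h5, lin (G n) v + (x + k), mem_image_of_mem _ hq, k, hk, ?_⟩, ?_⟩
    · change x + lin (G n) v + k = _
      abel
    · change -(x + lin (G n) v) +ᵥ (lin (G n) v +ᵥ s) = -x +ᵥ s
      rw [vadd_vadd]
      congr 1
      abel
  have h0 := S.cz_lattice (S.coincidence_subset_lattice hv)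
  have e : tilePatch T K x = tilePatch T K (x + lin (G n) v) := by
    refine (key v hv x hx).antisymm ?_
    have := key (-v) (neg_mem hv) (x + lin (G n) v) (by rwa [h.cz_add_lin h0])
    rwa [map_neg, add_neg_cancel_right] at this
  have e' := hder _ _ e
  have hmem : (0 : E3) ∈ pointPatch Λ {0} x := ⟨⟨x, hxΛ, neg_add_cancel x⟩, rfl⟩
  rw [e'] at hmem
  obtain ⟨⟨y, hy, hy'⟩, -⟩ := hmem
  rwa [← neg_add_eq_zero.mp hy'] at hy

end IsTower

variable (S) in
/-- The point set `Λ` is slab-wise invariant under rotated copies of the coincidence lattice of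
order `N`, where the slabs are perpendicular to the image of the vertical under `B`. -/
def IsLayered (N : ℕ) (B : E3 ≃ₗᵢ[ℝ] E3) (Λ : Set E3) : Prop :=
  ∀ q ∈ Λ, ∃ m : ℤ, |2 * ⟪B S.nZ, q⟫ - m| ≤ 2 ∧
    ∀ v ∈ S.coincidence N, q + B ((lin S.rot ^ m) v) ∈ Λ

lemma IsTower.exists_isLayered (h : S.IsTower T G w) {N : ℕ}
    (hN : ∀ v ∈ S.coincidence N, ∀ (n : ℤ) (x : E3),
      |2 * S.cz ((G 0)⁻¹ x) - n| ≤ 1 → x ∈ Λ → x + lin (G n) v ∈ Λ) (g : E3 ≃ᵃⁱ[ℝ] E3) :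
    ∃ B, S.IsLayered N B (g '' Λ) := by
  set f := g * G 0 with hf
  -- The indices are recentred at the layer nearest to the origin. Heights are then measured by a
  -- linear functional up to a bounded error, and the data surviving in the limit are a linear
  -- isometry and bounded integers.
  set n₀ := round (2 * S.cz (f⁻¹ 0)) with hn₀
  refine ⟨lin g * lin (G n₀), ?_⟩
  rintro _ ⟨x, hx, rfl⟩
  have hz : S.cz ((G 0)⁻¹ x) = ⟪(lin g * lin (G n₀)) S.nZ, g x⟫ + S.cz (f⁻¹ 0) := by
    have h1 : (G 0)⁻¹ x = (lin f)⁻¹ (g x) + f⁻¹ 0 := by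
      rw [← lin_inv, ← map_eq_lin, hf, mul_inv_rev]
      exact congrArg ((G 0)⁻¹ : E3 ≃ᵃⁱ[ℝ] E3) (inv_apply_apply g x).symm
    have h2 : ⟪(lin g * lin (G n₀)) S.nZ, g x⟫ = S.cz ((lin g * lin (G n₀))⁻¹ (g x)) := by
      conv_lhs => rw [← (lin g * lin (G n₀)).apply_symm_apply (g x),
        LinearIsometryEquiv.inner_map_map]
      rfl
    rw [h2, h1, map_add]
    congr 1
    have h3 : (lin f)⁻¹ (g x) = (lin S.rot ^ n₀) ((lin g * lin (G n₀))⁻¹ (g x)) := by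
      have : (lin f)⁻¹ = lin S.rot ^ n₀ * (lin g * lin (G n₀))⁻¹ := by
        rw [h.lin_eq n₀, hf, lin_mul]; group
      rw [this]; rfl
    rw [h3, cz_lin_rot_zpow]
  set n := round (2 * S.cz ((G 0)⁻¹ x)) with hn
  have e1 := abs_sub_round (2 * S.cz ((G 0)⁻¹ x))
  have e2 := abs_sub_round (2 * S.cz (f⁻¹ 0))
  refine ⟨n - n₀, ?_, fun v hv => ⟨_, hN v hv n x (by linarith) hx, ?_⟩⟩
  · rw [← hn] at e1
    rw [← hn₀] at e2
    rw [abs_le] at *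
    push_cast
    constructor <;> linarith
  · rw [map_add_lin, h.lin_apply n n₀]
    rfl

/-- Layered Delone sets are closed under limits in the rubber topology. -/
lemma exists_isLayered_of_tendsto {N : ℕ} {Λ' : Set E3} (hΛ' : IsDelone Λ')
    (hlim : ∀ ε > 0, ∃ Λ B, S.IsLayered N B Λ ∧ RubberClose ε Λ Λ') :
    ∃ B, S.IsLayered N B Λ' := by
  choose Λ B hB hclose using fun k : ℕ => hlim (1 / (k + 1)) (by positivity)
  -- Along a free ultrafilter the isometries converge by compactness, and the layer indices
  -- belonging to a given point, being confined to a finite set, are eventually constant.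
  let F : Ultrafilter ℕ := Filter.hyperfilter ℕ
  have hF : (F : Filter ℕ) ≤ Filter.atTop := Nat.hyperfilter_le_atTop
  have hε : Filter.Tendsto (fun k : ℕ => (1 : ℝ) / (k + 1)) F (𝓝 0) :=
    tendsto_one_div_add_atTop_nhds_zero_nat.mono_left hF
  have hball : ∀ p : E3, ∀ᶠ k : ℕ in (F : Filter ℕ),
      p ∈ ball (0 : E3) (1 / (1 / ((k : ℝ) + 1))) := by
    intro p
    refine hF ?_
    filter_upwards [Filter.eventually_gt_atTop ⌈‖p‖⌉₊] with k hk
    rw [mem_ball_zero_iff, one_div_one_div]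
    linarith [Nat.lt_of_ceil_lt hk]
  let L : ℕ → E3 →L[ℝ] E3 := fun k => ((B k : E3 ≃L[ℝ] E3) : E3 →L[ℝ] E3)
  have hL : ∀ k, L k ∈ closedBall (0 : E3 →L[ℝ] E3) 1 := fun k => by
    rw [mem_closedBall_zero_iff]
    refine ContinuousLinearMap.opNorm_le_bound _ zero_le_one fun x => ?_
    rw [one_mul]
    exact ((B k).norm_map x).le
  obtain ⟨A, -, hA⟩ := (isCompact_closedBall (0 : E3 →L[ℝ] E3) 1).ultrafilter_le_nhds'
    (F.map L) (Filter.mem_map.mpr (Filter.Eventually.of_forall hL))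
  have hA' : Filter.Tendsto L F (𝓝 A) := hA
  have happ : ∀ x, Filter.Tendsto (fun k => B k x) F (𝓝 (A x)) := fun x =>
    ((ContinuousLinearMap.apply ℝ E3 x).continuous.tendsto A).comp hA'
  have hnorm : ∀ x, ‖A x‖ = ‖x‖ := fun x =>
    tendsto_nhds_unique (happ x).norm (by simp)
  let A' : E3 ≃ₗᵢ[ℝ] E3 := LinearIsometry.toLinearIsometryEquiv ⟨A, hnorm⟩ rfl
  refine ⟨A', fun p hp => ?_⟩
  have hq : ∀ k : ℕ, ∃ q, p ∈ ball (0 : E3) (1 / (1 / ((k : ℝ) + 1))) →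
      q ∈ Λ k ∧ dist q p ≤ 1 / (k + 1) := fun k => by
    by_cases h : p ∈ ball (0 : E3) (1 / (1 / ((k : ℝ) + 1)))
    · obtain ⟨q, h1, h2⟩ := (hclose k).2 p ⟨hp, h⟩
      exact ⟨q, fun _ => ⟨h1, h2⟩⟩
    · exact ⟨0, fun h' => absurd h' h⟩
  choose q hq using hq
  have hqev : ∀ᶠ k in (F : Filter ℕ), q k ∈ Λ k ∧ dist (q k) p ≤ 1 / (k + 1) :=
    (hball p).mono hq
  have hqlim : Filter.Tendsto q F (𝓝 p) := by
    rw [tendsto_iff_dist_tendsto_zero]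
    exact squeeze_zero' (Filter.Eventually.of_forall fun _ => dist_nonneg)
      (hqev.mono fun _ h => h.2) hε
  have hm : ∀ k, ∃ m : ℤ, q k ∈ Λ k → |2 * ⟪B k S.nZ, q k⟫ - m| ≤ 2 ∧
      ∀ v ∈ S.coincidence N, q k + B k ((lin S.rot ^ m) v) ∈ Λ k := fun k => by
    by_cases h : q k ∈ Λ k
    · obtain ⟨m, hm⟩ := hB k _ h
      exact ⟨m, fun _ => hm⟩
    · exact ⟨0, fun h' => absurd h' h⟩
  choose m hm using hm
  have hinner : Filter.Tendsto (fun k => 2 * ⟪B k S.nZ, q k⟫) F (𝓝 (2 * ⟪A' S.nZ, p⟫)) :=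
    ((happ _).inner hqlim).const_mul 2
  set I := 2 * ⟪A' S.nZ, p⟫ with hI
  have hbd : ∀ᶠ k in (F : Filter ℕ), ∃ i ∈ Icc (⌊I⌋ - 3) (⌊I⌋ + 4), m k = i := by
    filter_upwards [hqev, hinner.eventually (ball_mem_nhds I one_pos)] with k h1 h2
    refine ⟨m k, ?_, rfl⟩
    have h3 := (hm k h1.1).1
    rw [Real.dist_eq, abs_lt] at h2
    rw [abs_le] at h3
    have h4 := Int.floor_le I
    have h5 := Int.lt_floor_add_one I
    have h6 : ((⌊I⌋ - 4 : ℤ) : ℝ) < m k := by push_cast; linarith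
    have h7 : (m k : ℝ) < ((⌊I⌋ + 5 : ℤ) : ℝ) := by push_cast; linarith
    rw [Int.cast_lt] at h6 h7
    exact ⟨by omega, by omega⟩
  obtain ⟨i, -, hi⟩ := (Ultrafilter.eventually_exists_mem_iff (finite_Icc _ _)).mp hbd
  refine ⟨i, ?_, fun v hv => ?_⟩
  · refine le_of_tendsto (hinner.sub_const (i : ℝ)).abs ?_
    filter_upwards [hqev, hi] with k h1 h2
    rw [← h2]
    exact (hm k h1.1).1
  · obtain ⟨⟨r, hr, hsep⟩, -⟩ := isDelone_iff.mp hΛ'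
    set y := p + A' ((lin S.rot ^ i) v) with hy
    have hylim : Filter.Tendsto (fun k => q k + B k ((lin S.rot ^ i) v)) F (𝓝 y) :=
      hqlim.add (happ _)
    have hyball : ∀ᶠ k : ℕ in (F : Filter ℕ), q k + B k ((lin S.rot ^ i) v) ∈
        ball (0 : E3) (1 / (1 / ((k : ℝ) + 1))) := by
      have h1 := (hylim.norm).eventually (gt_mem_nhds (lt_add_one ‖y‖))
      have h2 : ∀ᶠ k : ℕ in (F : Filter ℕ), ⌈‖y‖ + 1⌉₊ < k :=
        hF (Filter.eventually_gt_atTop _)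
      filter_upwards [h1, h2] with k h3 h4
      rw [mem_ball_zero_iff, one_div_one_div]
      linarith [Nat.lt_of_ceil_lt h4]
    have hclosed : ∀ δ > 0, ∃ z ∈ Λ', dist y z < δ := fun δ hδ => by
      obtain ⟨k, h1, h2, h3, h4, h5⟩ := ((hylim.eventually (ball_mem_nhds y (half_pos hδ))).and
        (hqev.and (hi.and ((hε.eventually (gt_mem_nhds (half_pos hδ))).and
          hyball))) ).exists
      rw [← h3] at h1 h5
      obtain ⟨z, hz, hd⟩ := (hclose k).1 _ ⟨(hm k h2.1).2 v hv, h5⟩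
      refine ⟨z, hz, ?_⟩
      rw [dist_comm] at h1
      linarith [dist_triangle y (q k + B k ((lin S.rot ^ m k) v)) z]
    -- The limit point `y` is approximated by points of the uniformly discrete set arbitrarily well,
    -- hence belongs to it.
    obtain ⟨z, hz, hyz⟩ := hclosed (r / 2) (half_pos hr)
    by_contra hyΛ
    have hpos : 0 < dist y z := dist_pos.mpr fun h => hyΛ (h ▸ hz)
    obtain ⟨z', hz', hyz'⟩ := hclosed (dist y z) hpos
    have := hsep z hz z' hz' (by linarith [dist_triangle_left z z' y])
    exact hyz'.ne' (by rw [this])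

end Shape

/-! ### Periods of layered Delone sets -/

/-- A separated set has only finitely many points in a ball. -/
lemma finite_inter_closedBall {Λ : Set E3} {r : ℝ} (hr : 0 < r)
    (hsep : ∀ x ∈ Λ, ∀ y ∈ Λ, dist x y ≤ r → x = y) (p : E3) (ρ : ℝ) :
    (Λ ∩ closedBall p ρ).Finite := by
  obtain ⟨c, -, hc, hcov⟩ := (isCompact_closedBall p ρ).finite_cover_balls (half_pos hr)
  have hex : ∀ x, ∃ z, x ∈ closedBall p ρ → z ∈ c ∧ dist x z < r / 2 := fun x => by
    by_cases hx : x ∈ closedBall p ρ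
    · obtain ⟨z, hz, hxz⟩ := mem_iUnion₂.mp (hcov hx)
      exact ⟨z, fun _ => ⟨hz, hxz⟩⟩
    · exact ⟨0, fun h => absurd h hx⟩
  choose f hf using hex
  refine Finite.of_finite_image (f := f) (hc.subset ?_) ?_
  · rintro _ ⟨x, hx, rfl⟩
    exact (hf x hx.2).1
  · intro x hx y hy hxy
    refine hsep x hx.1 y hy.1 ?_
    have h1 := (hf x hx.2).2
    have h2 := (hf y hy.2).2
    rw [← hxy] at h2
    linarith [dist_triangle_right x y (f x)]

lemma infinite_of_forall_exists {M : Set ℤ} {c C : ℝ} (hc : c ≠ 0)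
    (h : ∀ k : ℕ, ∃ m ∈ M, |c * k - m| ≤ C) : M.Infinite := by
  intro hM
  obtain ⟨b, hb⟩ := (hM.image (fun m : ℤ => |(m : ℝ)|)).bddAbove
  obtain ⟨k, hk⟩ := exists_nat_gt ((b + C) / |c|)
  obtain ⟨m, hm, hkm⟩ := h k
  have h1 := hb (mem_image_of_mem _ hm)
  rw [div_lt_iff₀ (abs_pos.mpr hc)] at hk
  have h2 := abs_sub_abs_le_abs_sub (c * k) m
  rw [abs_mul, Nat.abs_cast] at h2
  linarith

namespace Shape

variable (S : Shape)

/-- The horizontal component of a vector as a complex number. -/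
noncomputable def planar (x : E3) : ℂ := S.cs x + S.ct x * Complex.exp (S.ang * Complex.I)

/-- With the rhombus placed in the complex plane the rotation is multiplication by a number of
modulus one, and its powers can be compared through the complex exponential function. -/
lemma planar_rot (x : E3) :
    S.planar (lin S.rot x) = Complex.exp (-(S.ang * Complex.I)) * S.planar x := by
  have h1 : Complex.exp (-(S.ang * Complex.I)) * Complex.exp (S.ang * Complex.I) = 1 := by
    rw [← Complex.exp_add, neg_add_cancel, Complex.exp_zero]
  have h2 : (2 * S.c : ℂ) = Complex.exp (S.ang * Complex.I) +
      Complex.exp (-(S.ang * Complex.I)) := by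
    rw [c, Complex.ofReal_cos, Complex.two_cos, neg_mul]
  rw [planar, planar, lin_rot, ← S.pt_coord x, rot_pt, cs_pt, ct_pt, cs_pt, ct_pt]
  push_cast
  rw [h2]
  linear_combination (-(S.ct x : ℂ)) * h1

lemma planar_rot_zpow (j : ℤ) (x : E3) : S.planar ((lin S.rot ^ j) x) =
    Complex.exp (-(S.ang * Complex.I)) ^ j * S.planar x := by
  have h0 := Complex.exp_ne_zero (-(S.ang * Complex.I))
  induction j using Int.induction_on with
  | zero => simp
  | succ i ih =>
    have : (lin S.rot ^ ((i : ℤ) + 1)) x = lin S.rot ((lin S.rot ^ (i : ℤ)) x) := by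
      rw [add_comm, zpow_add, zpow_one]; rfl
    rw [this, planar_rot, ih, zpow_add₀ h0, zpow_one]; ring
  | pred i ih =>
    have : lin S.rot ((lin S.rot ^ (-(i : ℤ) - 1)) x) = (lin S.rot ^ (-(i : ℤ))) x := by
      rw [show -(i : ℤ) = 1 + (-(i : ℤ) - 1) by ring, zpow_add, zpow_one]; simp
    rw [← this, planar_rot] at ih
    rw [zpow_sub₀ h0, zpow_one]
    field_simp
    rw [← ih]; ring

lemma planar_ne_zero {x : E3} (hx : x ≠ 0) (hz : S.cz x = 0) : S.planar x ≠ 0 := by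
  intro h
  have him := congrArg Complex.im h
  have hre := congrArg Complex.re h
  have hs := S.sin_pos
  simp [planar, Complex.exp_ofReal_mul_I_im, Complex.exp_ofReal_mul_I_re] at him hre
  have ht : S.ct x = 0 := by
    rcases him with h | h
    · exact h
    · exact absurd h hs.ne'
  rw [ht] at hre
  apply hx
  apply S.ext_coord
  · simpa using hre
  · simpa using ht
  · simpa using hz

/-- Rotations of incommensurate angle have infinite order. -/
lemma rot_zpow_injective (hinc : IsIncommensurate S.ang) {x : E3} (hx : x ≠ 0)
    (hz : S.cz x = 0) : Function.Injective fun j : ℤ => (lin S.rot ^ j) x := by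
  intro m k hmk
  have h1 := congrArg S.planar hmk
  simp only [planar_rot_zpow] at h1
  have h2 := mul_right_cancel₀ (S.planar_ne_zero hx hz) h1
  rw [← Complex.exp_int_mul, ← Complex.exp_int_mul, Complex.exp_eq_exp_iff_exists_int] at h2
  obtain ⟨n, hn⟩ := h2
  have h3 : ((k - m : ℤ) : ℝ) * S.ang = 2 * Real.pi * n := by
    have h4 : (((k - m : ℤ) : ℝ) * S.ang : ℂ) * Complex.I = (2 * Real.pi * n : ℂ) * Complex.I := by
      push_cast
      linear_combination hn
    have h5 := mul_right_cancel₀ Complex.I_ne_zero h4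
    exact_mod_cast h5
  by_contra hne
  have h6 : ((k - m : ℤ) : ℝ) ≠ 0 := by
    exact_mod_cast sub_ne_zero.mpr (Ne.symm hne)
  apply hinc (2 * n / (k - m : ℤ))
  push_cast at h3 h6 ⊢
  field_simp
  linarith

/-- A vector and its rotated image span the plane: their determinant in the coordinates is, up to
sign, the quadratic form `s ^ 2 + t ^ 2 + 2 * c * s * t`, which is definite. -/
lemma exists_combination {v x : E3} (hv : v ≠ 0) (hvz : S.cz v = 0) (hxz : S.cz x = 0) :
    ∃ α β : ℝ, x = α • v + β • lin S.rot v := by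
  set s := S.cs v
  set t := S.ct v
  have hv' : v = S.pt s t 0 := by rw [← hvz, pt_coord]
  have hdet : s ^ 2 + t ^ 2 + 2 * S.c * (s * t) ≠ 0 := fun h => by
    apply hv
    rw [← norm_eq_zero, ← sq_eq_zero_iff, hv', norm_sq_pt, h]; ring
  refine ⟨(S.cs x * s + (2 * S.c * s + t) * S.ct x) / (s ^ 2 + t ^ 2 + 2 * S.c * (s * t)),
    (t * S.cs x - s * S.ct x) / (s ^ 2 + t ^ 2 + 2 * S.c * (s * t)), ?_⟩
  rw [lin_rot, hv', rot_pt, smul_pt, smul_pt, pt_add, ← S.pt_coord x, hxz, cs_pt, ct_pt]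
  congr 1
  · rw [div_mul_eq_mul_div, div_mul_eq_mul_div, ← add_div, eq_div_iff hdet]; ring
  · rw [div_mul_eq_mul_div, div_mul_eq_mul_div, ← add_div, eq_div_iff hdet]; ring
  · ring

lemma finite_lattice_inter (ρ : ℝ) : {x ∈ S.lattice | ‖x‖ ≤ ρ}.Finite := by
  obtain ⟨n, hn⟩ := exists_nat_ge (‖S.nS‖ * ρ)
  obtain ⟨k, hk⟩ := exists_nat_ge (‖S.nT‖ * ρ)
  refine ((finite_Icc (-(n : ℤ)) n).image2 (fun i j : ℤ => S.pt i j 0)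
    (finite_Icc (-(k : ℤ)) k)).subset ?_
  rintro x ⟨⟨i, j, rfl⟩, hx⟩
  refine ⟨i, ?_, j, ?_, rfl⟩
  · have h1 : |S.cs (S.pt i j 0)| ≤ ‖S.nS‖ * ‖S.pt i j 0‖ :=
      abs_real_inner_le_norm S.nS _
    rw [cs_pt] at h1
    have h2 : |(i : ℝ)| ≤ n :=
      (h1.trans (mul_le_mul_of_nonneg_left hx (norm_nonneg _))).trans hn
    rw [mem_Icc, ← abs_le]
    exact_mod_cast h2
  · have h1 : |S.ct (S.pt i j 0)| ≤ ‖S.nT‖ * ‖S.pt i j 0‖ :=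
      abs_real_inner_le_norm S.nT _
    rw [ct_pt] at h1
    have h2 : |(j : ℝ)| ≤ k :=
      (h1.trans (mul_le_mul_of_nonneg_left hx (norm_nonneg _))).trans hk
    rw [mem_Icc, ← abs_le]
    exact_mod_cast h2

/-- A vector spanning, together with a plane lattice, a subgroup that is separated has a bounded
multiple in the lattice. -/
lemma exists_smul_mem {v : E3} (hv : v ≠ 0) (hvz : S.cz v = 0) {r : ℝ} (hr : 0 < r) :
    ∃ J : ℕ, ∀ (C : AddSubgroup E3), v ∈ C → lin S.rot v ∈ C → ∀ s, S.cz s = 0 →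
      (∀ (j : ℤ), ∀ u ∈ C, ‖j • s + u‖ ≤ r → j • s + u = 0) →
      ∃ j : ℕ, 1 ≤ j ∧ j ≤ J ∧ j • s ∈ C := by
  obtain ⟨c, -, hc, hcov⟩ :=
    (isCompact_closedBall (0 : E3) (2 * ‖v‖)).finite_cover_balls (half_pos hr)
  -- The bound is the number of small balls covering a fixed region, so it depends on `v` and `r`
  -- only, not on the subgroup or on `s`.
  refine ⟨hc.toFinset.card, fun C hv1 hv2 s hs hsep => ?_⟩
  obtain ⟨α, β, e⟩ := S.exists_combination hv hvz hs
  -- Reduces the multiples `j • s` modulo the lattice spanned by `v` and its rotated image. Two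
  -- reduced multiples in the same small ball differ by less than `r`, hence coincide, and the
  -- difference of their orders is the desired multiple.
  let u : ℕ → E3 := fun j => -(⌊j * α⌋ • v + ⌊j * β⌋ • lin S.rot v)
  have hu : ∀ j, u j ∈ C := fun j =>
    neg_mem (add_mem (zsmul_mem hv1 _) (zsmul_mem hv2 _))
  have hmem : ∀ j : ℕ, ∃ z ∈ c, dist ((j : ℤ) • s + u j) z < r / 2 := fun j => by
    have h1 : (j : ℤ) • s + u j ∈ closedBall (0 : E3) (2 * ‖v‖) := by
      have h2 : (j : ℤ) • s + u j =
          Int.fract (j * α) • v + Int.fract (j * β) • lin S.rot v := by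
        change _ + -(_ + _) = _
        rw [← Int.cast_smul_eq_zsmul ℝ, ← Int.cast_smul_eq_zsmul ℝ, ← Int.cast_smul_eq_zsmul ℝ,
          Int.fract, Int.fract, e]
        push_cast
        module
      rw [mem_closedBall_zero_iff, h2]
      refine (norm_add_le _ _).trans ?_
      rw [norm_smul, norm_smul, LinearIsometryEquiv.norm_map, Real.norm_eq_abs, Real.norm_eq_abs,
        abs_of_nonneg (Int.fract_nonneg _), abs_of_nonneg (Int.fract_nonneg _)]
      have h3 := (Int.fract_lt_one (j * α)).le
      have h4 := (Int.fract_lt_one (j * β)).le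
      nlinarith [norm_nonneg v]
    obtain ⟨z, hz, hd⟩ := mem_iUnion₂.mp (hcov h1)
    exact ⟨z, hz, hd⟩
  choose f hf hfd using hmem
  obtain ⟨i, hi, k, hk, hik, hfik⟩ := Finset.exists_ne_map_eq_of_card_lt_of_maps_to
    (s := Finset.range (hc.toFinset.card + 1)) (t := hc.toFinset) (by simp) (f := f)
    (fun j _ => hc.mem_toFinset.mpr (hf j))
  wlog hlt : i < k generalizing i k
  · exact this k hk i hi hik.symm hfik.symm (lt_of_le_of_ne (not_lt.mp hlt) hik.symm)
  rw [Finset.mem_range] at hk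
  refine ⟨k - i, by omega, by omega, ?_⟩
  have hdist := dist_triangle_right ((k : ℤ) • s + u k) ((i : ℤ) • s + u i) (f k)
  have hi' := hfd i
  rw [hfik] at hi'
  have hsum : (k : ℤ) • s + u k - ((i : ℤ) • s + u i) =
      ((k : ℤ) - i) • s + (u k - u i) := by
    rw [sub_smul]; abel
  rw [dist_eq_norm, hsum] at hdist
  have h0 := hsep _ _ (sub_mem (hu k) (hu i)) (hdist.trans (by linarith [hfd k]))
  rw [← natCast_zsmul, Nat.cast_sub hlt.le, eq_neg_of_add_eq_zero_left h0]
  exact neg_mem (sub_mem (hu k) (hu i))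

variable {S}

/-- Layered Delone sets are non-periodic. -/
lemma IsLayered.eq_zero_of_period (hinc : IsIncommensurate S.ang) {N : ℕ}
    {B : E3 ≃ₗᵢ[ℝ] E3} {Λ : Set E3} (hB : S.IsLayered N B Λ) (hΛ : IsDelone Λ)
    {v : E3} (hv : v ∈ S.coincidence (N + 1)) (hv0 : v ≠ 0) {t : E3} (ht : t +ᵥ Λ = Λ) :
    t = 0 := by
  by_contra ht0
  obtain ⟨⟨r, hr, hsep⟩, R, hcov⟩ := isDelone_iff.mp hΛ
  have hvz := S.cz_lattice (S.coincidence_subset_lattice hv)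
  obtain ⟨hv1, hv2⟩ := S.coincidence_rot hv
  have hper : ∀ j : ℤ, ∀ p ∈ Λ, p + j • t ∈ Λ := fun j p hp => by
    have h1 : j • t ∈ AddAction.stabilizer E3 Λ := zsmul_mem (AddAction.mem_stabilizer_iff.mpr ht) j
    rw [← AddAction.mem_stabilizer_iff.mp h1, add_comm]
    exact vadd_mem_vadd_set hp
  -- A horizontal period is looked at in the rotated frames of all layers; `s m` is the period in
  -- the frame of layer `m`.
  by_cases hI : ⟪B S.nZ, t⟫ = 0
  · let s : ℤ → E3 := fun m => (lin S.rot ^ (-m)) (B.symm t)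
    have hsz0 : S.cz (B.symm t) = 0 := by
      rw [← hI, ← B.apply_symm_apply t, LinearIsometryEquiv.inner_map_map, B.symm_apply_apply]
      rfl
    have hsz : ∀ m, S.cz (s m) = 0 := fun m => by
      change S.cz ((lin S.rot ^ (-m)) _) = 0
      rw [cz_lin_rot_zpow, hsz0]
    have hBs : ∀ m, B ((lin S.rot ^ m) (s m)) = t := fun m => by
      have : (lin S.rot ^ m) (s m) = B.symm t := by
        change (lin S.rot ^ m * lin S.rot ^ (-m)) _ = _
        rw [← zpow_add, add_neg_cancel, zpow_zero]; rfl
      rw [this, B.apply_symm_apply]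
    have hsnorm : ∀ m, ‖s m‖ = ‖t‖ := fun m => by
      change ‖(lin S.rot ^ (-m)) (B.symm t)‖ = _
      rw [LinearIsometryEquiv.norm_map, LinearIsometryEquiv.norm_map]
    have hsinj : Function.Injective s := fun m k hmk => by
      have h1 : B.symm t ≠ 0 := by simpa using ht0
      exact neg_injective (S.rot_zpow_injective hinc h1 hsz0 hmk)
    let M : Set ℤ := {m | ∃ q ∈ Λ, ∀ u ∈ S.coincidence N, q + B ((lin S.rot ^ m) u) ∈ Λ}
    have hM : M.Infinite := by
      refine infinite_of_forall_exists (c := 2) (C := 2 * (‖S.nZ‖ * R) + 2) two_ne_zero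
        fun k => ?_
      obtain ⟨q, hq, hqd⟩ := hcov (B ((k : ℝ) • S.e))
      obtain ⟨m, hm, hu⟩ := hB q hq
      refine ⟨m, ⟨q, hq, hu⟩, ?_⟩
      have h1 : ⟪B S.nZ, B ((k : ℝ) • S.e)⟫ = k := by
        rw [LinearIsometryEquiv.inner_map_map]
        change S.cz _ = _
        rw [map_smul, cz_e, smul_eq_mul, mul_one]
      have h2 := abs_real_inner_le_norm (B S.nZ) (B ((k : ℝ) • S.e) - q)
      rw [inner_sub_right, h1, LinearIsometryEquiv.norm_map, ← dist_eq_norm] at h2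
      have h3 := h2.trans (mul_le_mul_of_nonneg_left hqd (norm_nonneg _))
      rw [abs_le] at *
      constructor <;> linarith
    -- The pairwise different vectors `s m`, for the infinitely many occurring `m`, have multiples
    -- of order at most `J` among the lattice vectors of norm at most `J * ‖t‖`, which are finite in
    -- number.
    obtain ⟨J, hJ⟩ := S.exists_smul_mem hv0 hvz hr
    have hfin : (⋃ j ∈ Icc 1 J, {x : E3 | j • x ∈ {x ∈ S.lattice | ‖x‖ ≤ J * ‖t‖}}).Finite := by
      refine (finite_Icc 1 J).biUnion fun j hj => ?_
      refine (S.finite_lattice_inter _).preimage fun x _ y _ hxy => ?_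
      have hj0 : (j : ℝ) ≠ 0 := Nat.cast_ne_zero.mpr (Nat.one_le_iff_ne_zero.mp hj.1)
      apply smul_right_injective E3 hj0
      simpa only [Nat.cast_smul_eq_nsmul] using hxy
    refine (hM.image hsinj.injOn) (hfin.subset ?_)
    rintro _ ⟨m, ⟨q, hq, hqu⟩, rfl⟩
    obtain ⟨j, hj1, hjJ, hjm⟩ := hJ (S.coincidence N) hv1 hv2 (s m) (hsz m) fun j u hu hle => by
      have h1 := hper j _ (hqu u hu)
      have h2 : q + B ((lin S.rot ^ m) u) + j • t = q + B ((lin S.rot ^ m) (j • s m + u)) := by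
        rw [map_add, map_add, map_zsmul, map_zsmul, hBs]; abel
      rw [h2] at h1
      have h3 := hsep _ h1 q hq (by
        rw [dist_self_add_left, LinearIsometryEquiv.norm_map, LinearIsometryEquiv.norm_map]
        exact hle)
      rwa [add_eq_left, ← norm_eq_zero, LinearIsometryEquiv.norm_map, LinearIsometryEquiv.norm_map,
        norm_eq_zero] at h3
    refine mem_iUnion₂.mpr ⟨j, ⟨hj1, hjJ⟩, S.coincidence_subset_lattice hjm, ?_⟩
    rw [← Nat.cast_smul_eq_nsmul ℝ, norm_smul, hsnorm, Real.norm_natCast]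
    gcongr
  -- A period with a vertical component: moving `p` by `k • t`, shifting there by the coincidence
  -- vector of that slab and moving back puts points at distance `‖v‖` from `p` in infinitely many
  -- directions.
  · obtain ⟨p, hp, -⟩ := hcov 0
    let M : Set ℤ := {m | p + B ((lin S.rot ^ m) v) ∈ Λ}
    have hM : M.Infinite := by
      refine infinite_of_forall_exists (c := 2 * ⟪B S.nZ, t⟫) (C := 2 + |2 * ⟪B S.nZ, p⟫|)
        (mul_ne_zero two_ne_zero hI) fun k => ?_
      obtain ⟨m, hm, hu⟩ := hB _ (hper k p hp)
      refine ⟨m, ?_, ?_⟩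
      · have h1 := hper (-k) _ (hu v hv1)
        have h2 : p + (k : ℤ) • t + B ((lin S.rot ^ m) v) + (-(k : ℤ)) • t =
            p + B ((lin S.rot ^ m) v) := by rw [neg_smul]; abel
        rwa [h2] at h1
      · rw [inner_add_right, ← Int.cast_smul_eq_zsmul ℝ, real_inner_smul_right] at hm
        push_cast at hm
        have h1 := le_abs_self (2 * ⟪B S.nZ, p⟫)
        have h2 := neg_abs_le (2 * ⟪B S.nZ, p⟫)
        rw [abs_le] at hm ⊢
        constructor <;> linarith
    refine (hM.image (f := fun m => p + B ((lin S.rot ^ m) v)) ?_)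
      ((finite_inter_closedBall hr hsep p ‖v‖).subset ?_)
    · intro m _ k _ hmk
      exact S.rot_zpow_injective hinc hv0 hvz (B.injective (add_left_cancel hmk))
    · rintro _ ⟨m, hm, rfl⟩
      refine ⟨hm, ?_⟩
      rw [mem_closedBall, dist_self_add_left, LinearIsometryEquiv.norm_map,
        LinearIsometryEquiv.norm_map]

end Shape

/-! ### The two hulls and the conclusion -/

lemma LocalClose.rubberClose {ε : ℝ} {Λ Λ' : Set E3} {x : E3} (hε : 0 ≤ ε)
    (h : LocalClose ε (x +ᵥ Λ) Λ') : ∃ t : E3, RubberClose ε (tr t '' Λ) Λ' := by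
  obtain ⟨t, -, h⟩ := h
  rw [vadd_vadd] at h
  refine ⟨t + x, fun p hp => ⟨p, ?_, by rwa [dist_self]⟩, fun p hp => ⟨p, ?_, by rwa [dist_self]⟩⟩
  · exact (h.ge hp).1
  · exact (h.le hp).1

/-- On every ball an element of the hull agrees exactly with a translate, so both Delone radii are
inherited. -/
lemma isDelone_of_mem_hull {Λ Λ' : Set E3} (hΛ : IsDelone Λ) (h : Λ' ∈ hull Λ) :
    IsDelone Λ' := by
  obtain ⟨⟨r, hr, hsep⟩, R, hcov⟩ := isDelone_iff.mp hΛ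
  have hagree : ∀ ρ > 0, ∃ t : E3, Λ' ∩ ball 0 ρ = (t +ᵥ Λ) ∩ ball 0 ρ := fun ρ hρ => by
    obtain ⟨x, t, -, e⟩ := h (1 / ρ) (by positivity)
    rw [vadd_vadd, one_div_one_div] at e
    exact ⟨_, e⟩
  refine isDelone_iff.mpr ⟨⟨r, hr, fun x hx y hy hxy => ?_⟩, R, fun z => ?_⟩
  · obtain ⟨t, e⟩ := hagree (max ‖x‖ ‖y‖ + 1) (by positivity)
    have hx' : x ∈ Λ' ∩ ball 0 (max ‖x‖ ‖y‖ + 1) :=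
      ⟨hx, mem_ball_zero_iff.mpr (by linarith [le_max_left ‖x‖ ‖y‖])⟩
    have hy' : y ∈ Λ' ∩ ball 0 (max ‖x‖ ‖y‖ + 1) :=
      ⟨hy, mem_ball_zero_iff.mpr (by linarith [le_max_right ‖x‖ ‖y‖])⟩
    obtain ⟨⟨x', hx₀, rfl⟩, -⟩ := e.le hx'
    obtain ⟨⟨y', hy₀, rfl⟩, -⟩ := e.le hy'
    rw [hsep x' hx₀ y' hy₀ (by simpa [vadd_eq_add] using hxy)]
  · have hR : 0 ≤ R := by
      obtain ⟨x, -, hx⟩ := hcov 0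
      exact dist_nonneg.trans hx
    obtain ⟨t, e⟩ := hagree (‖z‖ + R + 1) (by positivity)
    obtain ⟨x, hx, hd⟩ := hcov (-t + z)
    have hd' : dist z (t + x) ≤ R := by
      rw [dist_eq_norm] at hd ⊢
      convert hd using 2; abel
    refine ⟨t + x, (e.ge ⟨vadd_mem_vadd_set hx, mem_ball_zero_iff.mpr ?_⟩).1, hd'⟩
    rw [dist_comm, dist_eq_norm] at hd'
    have := norm_add_le (t + x - z) z
    rw [sub_add_cancel] at this
    change ‖t + x‖ < _
    linarith

lemma hull_subset_euclideanHull {Λ : Set E3} (hΛ : IsDelone Λ) : hull Λ ⊆ euclideanHull Λ := by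
  refine fun Λ' h => ⟨isDelone_of_mem_hull hΛ h, fun ε hε => ?_⟩
  obtain ⟨x, hx⟩ := h ε hε
  obtain ⟨t, ht⟩ := hx.rubberClose hε.le
  exact ⟨tr t, tr_mem t, ht⟩

/-- A zero of the cosine is a rational multiple of `π`; in particular the rhombus is not a square.
-/
lemma IsIncommensurate.cos_ne_zero {φ : ℝ} (h : IsIncommensurate φ) : Real.cos φ ≠ 0 := by
  intro h0
  obtain ⟨k, hk⟩ := Real.cos_eq_zero_iff.mp h0
  apply h ((2 * k + 1) / 2)
  rw [hk]
  push_cast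
  ring

/-- The elements of the Euclidean hull of a point set derived from a repetitive, incommensurate SCD
tiling are non-periodic. -/
lemma Shape.isNonperiodic_of_mem_euclideanHull {S : Shape} (hinc : IsIncommensurate S.ang)
    {T : Set (Set E3)} (hT : S.IsTiling T) (hrep : IsRepetitive T) {Λ Λ' : Set E3}
    (hΛ : PointsDerivableFromTiling Λ T) (hΛ' : Λ' ∈ euclideanHull Λ) : IsNonperiodic Λ' := by
  have hc : S.c ≠ 0 := hinc.cos_ne_zero
  obtain ⟨G, w, h⟩ := hT.exists_tower hc
  obtain ⟨N, hN⟩ := h.add_lin_mem hT hc hΛ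
  obtain ⟨v, hv, hv0⟩ := h.exists_coincidence hT hc hrep (N + 1)
  obtain ⟨B, hB⟩ := exists_isLayered_of_tendsto hΛ'.1 fun ε hε => by
    obtain ⟨g, -, hg⟩ := hΛ'.2 ε hε
    obtain ⟨B, hB⟩ := h.exists_isLayered hN g
    exact ⟨_, B, hB, hg⟩
  refine Subset.antisymm (fun t ht => hB.eq_zero_of_period hinc hΛ'.1 hv hv0 ht) ?_
  rintro _ rfl
  exact zero_vadd E3 Λ'

end SCD

theorem proposition4 (ℓ φ h : ℝ) (hℓ : 0 < ℓ) (hh : 0 < h) (hφ : φ ∈ Set.Ioo 0 Real.pi)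
    (hincomm : SCD.IsIncommensurate φ)
    (T : Set (Set SCD.E3)) (hT : SCD.IsSCDTiling ℓ φ h T) (hrep : SCD.IsRepetitive T)
    (Λ : Set SCD.E3) (hΛ : SCD.IsDelone Λ) (hMLD : SCD.MLD Λ T) :
    SCD.TopologicallyAperiodic Λ ∧ ∀ Λ' ∈ SCD.euclideanHull Λ, SCD.IsNonperiodic Λ' := by
  let S : SCD.Shape := ⟨ℓ, φ, h, hℓ, hh, Real.sin_pos_of_mem_Ioo hφ⟩
  have key : ∀ Λ' ∈ SCD.euclideanHull Λ, SCD.IsNonperiodic Λ' := fun Λ' hΛ' =>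
    SCD.Shape.isNonperiodic_of_mem_euclideanHull (S := S) hincomm hT hrep hMLD.1 hΛ'
  exact ⟨fun Λ' hΛ' => key Λ' (SCD.hull_subset_euclideanHull hΛ hΛ'), key⟩
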